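/- **Setting.** Let $\Omega\subset\mathbb R^2$ be a bounded polygonal domain that is the interior of its closure (as every Lipschitz polygonal domain is), let $k\ge 0$ be an integer and $\rho_E,\rho_B>0$. Consider partitions of $\Omega$ into finitely many star-shaped polygons $S(\mathbf x)$ (primal elements), each with an interior point $\mathbf x$ that is joined to all vertices of $S(\mathbf x)$. Assume that the resulting triangulation $\mathcal T_h$ is conforming, that every edge $e$ of $S(\mathbf x)$ has length $h_e\ge\rho_E\,\mathrm{diam}\,S(\mathbf x)$, and that $S(\mathbf x)$ is star-shaped with respect to the ball of radius $\rho_B\,\mathrm{diam}\,S(\mathbf x)$ centred at $\mathbf x$. Let $\mathcal F_{pr}$ be the set of polygon edges ($\mathcal F_{pr}^0$ the interior ones), $\mathcal F_{dl}$ the set of edges that join $\mathbf x$ to vertices, $\mathcal F_h=\mathcal F_{pr}\cup\mathcal F_{dl}$ and $\mathcal F_h^0=\mathcal F_{pr}^0\cup\mathcal F_{dl}$. On an interior edge with adjacent triangles $\tau_\pm$ let $\mathbf n$ be the outward normal of $\tau_+$, $\mathbf t$ the corresponding unit tangent, $[v]=v|_{\tau_+}-v|_{\tau_-}$ and $\{v\}=\frac12(v|_{\tau_+}+v|_{\tau_-})$;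 on a boundary edge $[v]=\{v\}=v$ and $\mathbf n$ is outward. With $\mathbb P_k(\mathcal T_h)$ the piecewise polynomials of degree $\le k$, let $$H_h=\{H\in[\mathbb P_k(\mathcal T_h)]^{2\times2}: [H\mathbf n]_e=0\ \forall e\in\mathcal F_{pr}^0,\ [\mathbf t\cdot H\mathbf n]_e=0\ \forall e\in\mathcal F_{dl}\},$$ $$V_h=\{v\in[\mathbb P_k(\mathcal T_h)]^2: [v\cdot\mathbf n]_e=0\ \forall e\in\mathcal F_{dl}\},\qquad Q_h=\{q\in\mathbb P_k(\mathcal T_h): [q]_e=0\ \forall e\in\mathcal F_{pr}^0\},$$ $Q_h^0=\{q\in Q_h:\int_\Omega q=0\}$ and $V_h^{\mathrm{div}}=\{v\in V_h: v\in H(\mathrm{div};\Omega),\ \nabla\cdot v=0\}$. The norm of $V_h$ is $$\|v\|_h^2=\sum_{\tau\in\mathcal T_h}\|\nabla v\|_{L^2(\tau)}^2+\sum_{e\in\mathcal F_{pr}}h_e^{-1}\|[v]\|_{L^2(e)}^2+\sum_{e\in\mathcal F_{dl}}h_e^{-1}\|[v\cdot\mathbf t]\|_{L^2(e)}^2 .$$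 Put $$B_h(H,v)=\sum_\tau(H,\nabla v)_\tau-\sum_{e\in\mathcal F_{pr}}\langle H\mathbf n,[v]\rangle_e-\sum_{e\in\mathcal F_{dl}}\langle\mathbf t\cdot H\mathbf n,[v\cdot\mathbf t]\rangle_e,$$ $$B_h^*(v,H)=\sum_\tau(v,\mathrm{div}H)_\tau-\sum_{e\in\mathcal F_{dl}}\langle v\cdot\mathbf n,[\mathbf n\cdot H\mathbf n]\rangle_e,$$ $$b_h(v,q)=-\sum_\tau(v,\nabla q)_\tau+\sum_{e\in\mathcal F_{dl}}\langle v\cdot\mathbf n,[q]\rangle_e,\qquad b_h^*(q,v)=-\sum_\tau(q,\nabla\cdot v)_\tau+\sum_{e\in\mathcal F_{pr}}\langle q,[v\cdot\mathbf n]\rangle_e,$$ $$N_h(w;\psi,v)=-\sum_\tau(\psi\otimes w,\nabla v)_\tau+\sum_{e\in\mathcal F_h^0}\langle\{w\cdot\mathbf n\},\{\psi\}\cdot[v]\rangle_e+\sum_{e\in\mathcal F_h}\langle|\{w\cdot\mathbf n\}|,[\psi]\cdot[v]\rangle_e,$$ $$\beta_h=\inf_{0\ne v\in V_h}\ \sup_{0\ne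 H\in H_h}\frac{B_h(H,v)}{\|H\|_{L^2(\Omega)}\|v\|_h}.$$ For $\nu>0$, $f\in[L^2(\Omega)]^2$ and $z_h\in V_h^{\mathrm{div}}$, the image $w_h=T_h(z_h)\in V_h$ is defined by: for some $S_h\in H_h$, $r_h\in Q_h^0$ and all $(H,v,q)\in H_h\times V_h\times Q_h$, $$\nu^{-1}(S_h,H)+B_h^*(w_h,H)+B_h(S_h,v)+b_h^*(r_h,v)+b_h(w_h,q)+N_h(z_h;w_h,v)=(f,v).$$ **Lemma.** There are constants $C_B,C_P>0$ that depend only on $\Omega,k,\rho_E,\rho_B$ (not on the mesh, $\nu$, $f$ or $z_h$) such that for every such mesh $C_B\le\beta_h$ and the following holds. Let $\nu>0$ and let $f=f_0+\nabla\chi\in[L^2(\Omega)]^2$ be a Helmholtz–Hodge decomposition, i.e. $f_0\in H(\mathrm{div};\Omega)$, $\nabla\cdot f_0=0$, $\chi\in H^1(\Omega)$, $\int_\Omega\chi=0$. Then for every $z_h\in V_h^{\mathrm{div}}$ the image $w_h=T_h(z_h)$ exists, is unique, and satisfies $$\|w_h\|_h\le C_B^{-2}\,\nu^{-1}\,\|f_0\|_{L^2(\Omega)}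 .$$ More precisely, for every number $\beta$ with $0<\beta\le\beta_h$, $$\|w_h\|_h\le C_P\,\beta^{-2}\,\nu^{-1}\,\|f_0\|_{L^2(\Omega)} .$$ Moreover $T_h(z_h)$ does not change when $f$ is replaced by $f_0$. Consequently the discrete velocity is unaffected by the irrotational part of the force: $u_h\in V_h$ is the velocity of a solution $(G_h,u_h,p_h)\in H_h\times V_h\times Q_h^0$ of $$\nu^{-1}(G_h,H)+B_h^*(u_h,H)=0,\quad B_h(G_h,v)+N_h(u_h;u_h,v)+b_h^*(p_h,v)=(f,v),\quad b_h(u_h,q)=0$$ for all $(H,v,q)\in H_h\times V_h\times Q_h^0$ if and only if it is the velocity of a solution of the same problem with $f_0$ in place of $f$. -/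

import Mathlib

open MeasureTheory
open scoped ContDiff

namespace StaggeredDG

noncomputable section

/-- The Euclidean plane. -/
abbrev Pt := EuclideanSpace ℝ (Fin 2)

/-- Real polynomials in two variables. -/
abbrev Poly := MvPolynomial (Fin 2) ℝ

/-- Value of a polynomial at a point of the plane. -/
def ev (y : Pt) (p : Poly) : ℝ := MvPolynomial.eval (fun i => y i) p

/-- The determinant of two plane vectors. -/
def cross (u v : Pt) : ℝ := u 0 * v 1 - u 1 * v 0

/-! ### Sobolev notions on a plane set -/

/-- The space `C_c^∞(Ω)`. -/
def IsTestFunction (Ω : Set Pt) (φ : Pt → ℝ) : Prop :=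
  ContDiff ℝ ∞ φ ∧ HasCompactSupport φ ∧ tsupport φ ⊆ Ω

/-- `g` is the weak gradient of `χ` in `Ω`. -/
def HasWeakGradient (Ω : Set Pt) (χ : Pt → ℝ) (g : Pt → Pt) : Prop :=
  ∀ φ : Pt → ℝ, IsTestFunction Ω φ → ∀ i : Fin 2,
    ∫ y in Ω, χ y * fderiv ℝ φ y (EuclideanSpace.single i 1) = -∫ y in Ω, g y i * φ y

/-- `d` is the weak divergence of `v` in `Ω`. -/
def HasWeakDiv (Ω : Set Pt) (v : Pt → Pt) (d : Pt → ℝ) : Prop :=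
  ∀ φ : Pt → ℝ, IsTestFunction Ω φ →
    ∫ y in Ω, fderiv ℝ φ y (v y) = -∫ y in Ω, d y * φ y

/-- The norm of `[L²(Ω)]²`. -/
def l2Norm (Ω : Set Pt) (f : Pt → Pt) : ℝ := (eLpNorm f 2 (volume.restrict Ω)).toReal

/-- `f = f₀ + ∇χ` is a Helmholtz-Hodge decomposition: `f₀ ∈ H(div; Ω)` with `∇ · f₀ = 0`, and
`χ ∈ H¹(Ω) ∩ L²₀(Ω)`. -/
structure IsHelmholtzHodge (Ω : Set Pt) (f f₀ : Pt → Pt) (χ : Pt → ℝ) : Prop where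
  memLp_solenoidal : MemLp f₀ 2 (volume.restrict Ω)
  div_solenoidal : HasWeakDiv Ω f₀ 0
  memLp_potential : MemLp χ 2 (volume.restrict Ω)
  mean_potential : ∫ y in Ω, χ y = 0
  decomposition : ∃ g : Pt → Pt, MemLp g 2 (volume.restrict Ω) ∧ HasWeakGradient Ω χ g ∧
    f =ᵐ[volume.restrict Ω] f₀ + g

/-! ### Edges -/

/-- Arc length integral over the segment from `a` to `b`. -/
def edgeInt (a b : Pt) (F : Pt → ℝ) : ℝ :=
  dist a b * ∫ s in (0 : ℝ)..1, F (AffineMap.lineMap a b s)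

/-- Unit tangential vector of the directed segment from `a` to `b`. -/
def utan (a b : Pt) : Pt := (dist a b)⁻¹ • (b - a)

/-- Unit normal vector of the directed segment from `a` to `b`, pointing to its right; it is the
outward normal when the segment is a counter-clockwise part of the boundary of a triangle. -/
def unor (a b : Pt) : Pt := !₂[utan a b 1, -(utan a b 0)]

/-! ### Staggered meshes -/

/-- A staggered mesh of `Ω`, given through its conforming triangulation by `N` triangles. The
triangle `τ` has the counter-clockwise vertices `ctr τ`, `src τ`, `tgt τ`; `ctr τ` is the interior
point of the primal element to which `τ` belongs, and the segment from `src τ` to `tgt τ` is a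
primal edge. The primal element of an interior point is the union of the triangles around it. -/
structure StaggeredMesh (Ω : Set Pt) where
  N : ℕ
  ctr : Fin N → Pt
  src : Fin N → Pt
  tgt : Fin N → Pt
  ccw : ∀ τ, 0 < cross (src τ - ctr τ) (tgt τ - ctr τ)
  distinct : ∀ σ τ, ({ctr σ, src σ, tgt σ} : Set Pt) = {ctr τ, src τ, tgt τ} → σ = τ
  conforming : ∀ σ τ, convexHull ℝ ({ctr σ, src σ, tgt σ} : Set Pt) ∩
      convexHull ℝ ({ctr τ, src τ, tgt τ} : Set Pt) =
    convexHull ℝ (({ctr σ, src σ, tgt σ} : Set Pt) ∩ {ctr τ, src τ, tgt τ})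
  domain_eq : Ω = interior (⋃ τ, convexHull ℝ ({ctr τ, src τ, tgt τ} : Set Pt))
  /-- Interior points of primal elements are not vertices of primal elements. -/
  ctr_ne_src : ∀ σ τ, ctr σ ≠ src τ
  /-- The next triangle in the counter-clockwise order around the same interior point. -/
  next : Fin N → Fin N
  ctr_next : ∀ τ, ctr (next τ) = ctr τ
  src_next : ∀ τ, src (next τ) = tgt τ
  /-- The triangle across the primal edge; there is none for a boundary edge. -/
  nbr : Fin N → Option (Fin N)
  nbr_eq_some : ∀ σ τ, nbr τ = some σ ↔ src σ = tgt τ ∧ tgt σ = src τ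
  /-- The triangles that are the element `τ₊` of their primal edge: this is the arbitrary choice
  of the normal vectors on the interior primal edges. -/
  plus : Finset (Fin N)
  plus_boundary : ∀ τ, nbr τ = none → τ ∈ plus
  plus_interior : ∀ σ τ, nbr τ = some σ → (τ ∈ plus ↔ σ ∉ plus)

namespace StaggeredMesh

variable {Ω : Set Pt} (M : StaggeredMesh Ω)

/-- The closed triangle `τ`. -/
def cell (τ : Fin M.N) : Set Pt := convexHull ℝ {M.ctr τ, M.src τ, M.tgt τ}

/-- The primal element that contains the triangle `τ`. -/
def primal (τ : Fin M.N) : Set Pt := ⋃ σ ∈ {σ | M.ctr σ = M.ctr τ}, M.cell σ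

/-- Mesh regularity: every edge of a primal element `S` has length at least `ρE * diam S`, and
`S` is star-shaped with respect to the ball of radius `ρB * diam S` around its interior point. -/
def IsRegular (ρE ρB : ℝ) : Prop :=
  ∀ τ, ρE * Metric.diam (M.primal τ) ≤ dist (M.src τ) (M.tgt τ) ∧
    ∀ y ∈ Metric.ball (M.ctr τ) (ρB * Metric.diam (M.primal τ)), StarConvex ℝ y (M.primal τ)

/-! Every primal edge is represented by its triangle `τ₊ ∈ M.plus`. Every dual edge is represented
by the triangle `τ` for which it is the segment from `tgt τ` to `ctr τ`; there `τ₊ = τ` and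
`τ₋ = next τ`. -/

/-- The interior primal edges. -/
def plusInt : Finset (Fin M.N) := M.plus.filter fun τ => (M.nbr τ).isSome

/-- Length, tangential vector, normal vector and integral for primal and for dual edges. -/
def lenPr (τ : Fin M.N) : ℝ := dist (M.src τ) (M.tgt τ)
def tanPr (τ : Fin M.N) : Pt := utan (M.src τ) (M.tgt τ)
def norPr (τ : Fin M.N) : Pt := unor (M.src τ) (M.tgt τ)
def intPr (τ : Fin M.N) (F : Pt → ℝ) : ℝ := edgeInt (M.src τ) (M.tgt τ) F
def lenDl (τ : Fin M.N) : ℝ := dist (M.tgt τ) (M.ctr τ)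
def tanDl (τ : Fin M.N) : Pt := utan (M.tgt τ) (M.ctr τ)
def norDl (τ : Fin M.N) : Pt := unor (M.tgt τ) (M.ctr τ)
def intDl (τ : Fin M.N) (F : Pt → ℝ) : ℝ := edgeInt (M.tgt τ) (M.ctr τ) F

/-- Jump and average across primal and dual edges of a function given triangle by triangle. On a
boundary edge, both are the value in the only adjacent triangle. -/
def jumpPr (F : Fin M.N → Pt → ℝ) (τ : Fin M.N) (y : Pt) : ℝ :=
  (M.nbr τ).elim (F τ y) fun σ => F τ y - F σ y
def avgPr (F : Fin M.N → Pt → ℝ) (τ : Fin M.N) (y : Pt) : ℝ :=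
  (M.nbr τ).elim (F τ y) fun σ => (F τ y + F σ y) / 2
def jumpDl (F : Fin M.N → Pt → ℝ) (τ : Fin M.N) (y : Pt) : ℝ := F τ y - F (M.next τ) y
def avgDl (F : Fin M.N → Pt → ℝ) (τ : Fin M.N) (y : Pt) : ℝ := (F τ y + F (M.next τ) y) / 2

/-- The sum over all triangles of the integral of a function given triangle by triangle. -/
def meshInt (F : Fin M.N → Pt → ℝ) : ℝ := ∑ τ, ∫ y in M.cell τ, F τ y

/-! ### Piecewise polynomials -/

/-- Scalar, vector and `2 × 2` tensor valued piecewise polynomials. -/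
abbrev Sca := Fin M.N → Poly
abbrev Vec := Fin M.N → Fin 2 → Poly
abbrev Ten := Fin M.N → Fin 2 → Fin 2 → Poly

variable {M}

/-- The functions `q`, `∂ⱼ q`, `vᵢ`, `v · a`, `∂ⱼ vᵢ`, `∇ · v`, `Hᵢⱼ`, `(H a)ᵢ`, `b · H a` and
`(div H)ᵢ`, triangle by triangle. -/
def Sca.val (q : M.Sca) : Fin M.N → Pt → ℝ := fun τ y => ev y (q τ)
def Sca.grad (q : M.Sca) (j : Fin 2) : Fin M.N → Pt → ℝ :=
  fun τ y => ev y (MvPolynomial.pderiv j (q τ))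
def Vec.comp (v : M.Vec) (i : Fin 2) : Fin M.N → Pt → ℝ := fun τ y => ev y (v τ i)
def Vec.dot (v : M.Vec) (a : Pt) : Fin M.N → Pt → ℝ := fun τ y => ∑ i, ev y (v τ i) * a i
def Vec.grad (v : M.Vec) (i j : Fin 2) : Fin M.N → Pt → ℝ :=
  fun τ y => ev y (MvPolynomial.pderiv j (v τ i))
def Vec.div (v : M.Vec) : Fin M.N → Pt → ℝ := fun τ y => ∑ i, v.grad i i τ y
def Ten.comp (H : M.Ten) (i j : Fin 2) : Fin M.N → Pt → ℝ := fun τ y => ev y (H τ i j)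
def Ten.app (H : M.Ten) (a : Pt) (i : Fin 2) : Fin M.N → Pt → ℝ :=
  fun τ y => ∑ j, ev y (H τ i j) * a j
def Ten.quad (H : M.Ten) (b a : Pt) : Fin M.N → Pt → ℝ := fun τ y => ∑ i, b i * H.app a i τ y
def Ten.div (H : M.Ten) (i : Fin 2) : Fin M.N → Pt → ℝ :=
  fun τ y => ∑ j, ev y (MvPolynomial.pderiv j (H τ i j))

/-- The piecewise polynomial vector field as a function on the plane, with the value zero on the
edges. -/
def Vec.glue (v : M.Vec) : Pt → Pt := fun y =>
  ∑ τ, (interior (M.cell τ)).indicator (fun y => WithLp.toLp 2 fun i => ev y (v τ i)) y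

variable (M)

/-! ### Discrete spaces -/

/-- The space `H_h`. -/
def HSpace (k : ℕ) : Set M.Ten :=
  {H | (∀ τ i j, (H τ i j).totalDegree ≤ k) ∧
    (∀ τ, (M.nbr τ).isSome → ∀ y ∈ segment ℝ (M.src τ) (M.tgt τ), ∀ i,
      M.jumpPr (H.app (M.norPr τ) i) τ y = 0) ∧
    ∀ τ, ∀ y ∈ segment ℝ (M.tgt τ) (M.ctr τ),
      M.jumpDl (H.quad (M.tanDl τ) (M.norDl τ)) τ y = 0}

/-- The space `V_h`. -/
def VSpace (k : ℕ) : Set M.Vec :=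
  {v | (∀ τ i, (v τ i).totalDegree ≤ k) ∧
    ∀ τ, ∀ y ∈ segment ℝ (M.tgt τ) (M.ctr τ), M.jumpDl (v.dot (M.norDl τ)) τ y = 0}

/-- The space `Q_h`. -/
def QSpace (k : ℕ) : Set M.Sca :=
  {q | (∀ τ, (q τ).totalDegree ≤ k) ∧
    ∀ τ, (M.nbr τ).isSome → ∀ y ∈ segment ℝ (M.src τ) (M.tgt τ), M.jumpPr q.val τ y = 0}

/-- The space `Q_h^0` of functions in `Q_h` with mean zero. -/
def QSpaceZero (k : ℕ) : Set M.Sca := {q | q ∈ M.QSpace k ∧ M.meshInt q.val = 0}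

/-- The space `V_h^div` of fields in `V_h` that lie in `H(div; Ω)` and have divergence zero. -/
def VDiv (k : ℕ) : Set M.Vec := {v | v ∈ M.VSpace k ∧ HasWeakDiv Ω v.glue 0}

/-- The inner product and the norm of `[L²(Ω)]^{2×2}` on piecewise polynomials. -/
def tenInner (G H : M.Ten) : ℝ := M.meshInt fun τ y => ∑ i, ∑ j, G.comp i j τ y * H.comp i j τ y
def tenNorm (H : M.Ten) : ℝ := √(M.tenInner H H)

/-- The norm `‖·‖_h` of `V_h`. -/
def hNorm (v : M.Vec) : ℝ :=
  √((M.meshInt fun τ y => ∑ i, ∑ j, v.grad i j τ y ^ 2) +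
    (∑ τ ∈ M.plus, (M.lenPr τ)⁻¹ * M.intPr τ fun y => ∑ i, M.jumpPr (v.comp i) τ y ^ 2) +
    ∑ τ, (M.lenDl τ)⁻¹ * M.intDl τ fun y => M.jumpDl (v.dot (M.tanDl τ)) τ y ^ 2)

/-! ### Discrete forms

Quantities that are single valued on an edge for members of the discrete spaces are written as
their averages there. -/

/-- `B_h(H, v)`. -/
def formB (H : M.Ten) (v : M.Vec) : ℝ :=
  (M.meshInt fun τ y => ∑ i, ∑ j, H.comp i j τ y * v.grad i j τ y)
  - (∑ τ ∈ M.plus, M.intPr τ fun y =>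
      ∑ i, M.avgPr (H.app (M.norPr τ) i) τ y * M.jumpPr (v.comp i) τ y)
  - ∑ τ, M.intDl τ fun y =>
      M.avgDl (H.quad (M.tanDl τ) (M.norDl τ)) τ y * M.jumpDl (v.dot (M.tanDl τ)) τ y

/-- `B_h^*(v, H)`. -/
def formBStar (v : M.Vec) (H : M.Ten) : ℝ :=
  (M.meshInt fun τ y => ∑ i, v.comp i τ y * H.div i τ y)
  - ∑ τ, M.intDl τ fun y =>
      M.avgDl (v.dot (M.norDl τ)) τ y * M.jumpDl (H.quad (M.norDl τ) (M.norDl τ)) τ y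

/-- `b_h(v, q)`. -/
def formb (v : M.Vec) (q : M.Sca) : ℝ :=
  -(M.meshInt fun τ y => ∑ i, v.comp i τ y * q.grad i τ y)
  + ∑ τ, M.intDl τ fun y => M.avgDl (v.dot (M.norDl τ)) τ y * M.jumpDl q.val τ y

/-- `b_h^*(q, v)`. -/
def formbStar (q : M.Sca) (v : M.Vec) : ℝ :=
  -(M.meshInt fun τ y => q.val τ y * v.div τ y)
  + ∑ τ ∈ M.plus, M.intPr τ fun y => M.avgPr q.val τ y * M.jumpPr (v.dot (M.norPr τ)) τ y

/-- `N_h(w; ψ, v)`. -/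
def formN (w ψ v : M.Vec) : ℝ :=
  -(M.meshInt fun τ y => ∑ i, ∑ j, ψ.comp i τ y * w.comp j τ y * v.grad i j τ y)
  + ((∑ τ ∈ M.plusInt, M.intPr τ fun y => M.avgPr (w.dot (M.norPr τ)) τ y *
        ∑ i, M.avgPr (ψ.comp i) τ y * M.jumpPr (v.comp i) τ y)
    + ∑ τ, M.intDl τ fun y => M.avgDl (w.dot (M.norDl τ)) τ y *
        ∑ i, M.avgDl (ψ.comp i) τ y * M.jumpDl (v.comp i) τ y)
  + ((∑ τ ∈ M.plus, M.intPr τ fun y => |M.avgPr (w.dot (M.norPr τ)) τ y| *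
        ∑ i, M.jumpPr (ψ.comp i) τ y * M.jumpPr (v.comp i) τ y)
    + ∑ τ, M.intDl τ fun y => |M.avgDl (w.dot (M.norDl τ)) τ y| *
        ∑ i, M.jumpDl (ψ.comp i) τ y * M.jumpDl (v.comp i) τ y)

/-- The load `(f, v)`. -/
def load (f : Pt → Pt) (v : M.Vec) : ℝ := M.meshInt fun τ y => ∑ i, f y i * v.comp i τ y

/-- `A_h((S, w, r), (H, v, q))`. -/
def formA (ν : ℝ) (S : M.Ten) (w : M.Vec) (r : M.Sca) (H : M.Ten) (v : M.Vec) (q : M.Sca) : ℝ :=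
  ν⁻¹ * M.tenInner S H + M.formBStar w H + M.formB S v + M.formbStar r v + M.formb w q

/-- The inf-sup constant of `B_h`:
`inf_{0 ≠ v ∈ V_h} sup_{0 ≠ H ∈ H_h} B_h(H, v) / (‖H‖_{L²} ‖v‖_h)`. -/
def infSup (k : ℕ) : EReal :=
  ⨅ v ∈ {v | v ∈ M.VSpace k ∧ v ≠ 0}, ⨆ H ∈ {H | H ∈ M.HSpace k ∧ H ≠ 0},
    ((M.formB H v / (M.tenNorm H * M.hNorm v) : ℝ) : EReal)

/-! ### The discrete problem and the solution operator -/

/-- `(G, u, p)` solves the staggered discontinuous Galerkin scheme with force `f` and homogeneous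
boundary values. -/
def IsDiscreteSolution (k : ℕ) (ν : ℝ) (f : Pt → Pt) (G : M.Ten) (u : M.Vec) (p : M.Sca) : Prop :=
  G ∈ M.HSpace k ∧ u ∈ M.VSpace k ∧ p ∈ M.QSpaceZero k ∧
  (∀ H ∈ M.HSpace k, ν⁻¹ * M.tenInner G H + M.formBStar u H = 0) ∧
  (∀ v ∈ M.VSpace k, M.formB G v + M.formN u u v + M.formbStar p v = M.load f v) ∧
  ∀ q ∈ M.QSpaceZero k, M.formb u q = 0

/-- `w ∈ V_h` satisfies the equation that defines `T_h(z)`, together with some `S ∈ H_h` and some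
`r ∈ Q_h^0`. -/
def IsThImage (k : ℕ) (ν : ℝ) (f : Pt → Pt) (z w : M.Vec) : Prop :=
  w ∈ M.VSpace k ∧ ∃ S ∈ M.HSpace k, ∃ r ∈ M.QSpaceZero k,
    ∀ H ∈ M.HSpace k, ∀ v ∈ M.VSpace k, ∀ q ∈ M.QSpace k,
      M.formA ν S w r H v q + M.formN z w v = M.load f v

/-- The solution operator `T_h`. -/
def Th (k : ℕ) (ν : ℝ) (f : Pt → Pt) (z : M.Vec) : M.Vec :=
  Classical.epsilon (M.IsThImage k ν f z)

end StaggeredMesh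

end

end StaggeredDG

namespace StaggeredDG
noncomputable section

/-! ### Triangles -/

/-- The affine parametrisation of the triangle `a b c` over the unit triangle. -/
def tri (a b c : Pt) (s t : ℝ) : Pt := a + s • (b - a) + t • (c - a)

lemma cross_cyc (a b c : Pt) : cross (c - b) (a - b) = cross (b - a) (c - a) := by
  simp only [cross, PiLp.sub_apply]; ring

lemma cross_add_cross_add_cross (a b c x : Pt) :
    cross (b - a) (x - a) + cross (c - b) (x - b) + cross (a - c) (x - c)
      = cross (b - a) (c - a) := by
  simp only [cross, PiLp.sub_apply]; ring

lemma continuous_cross_sub (a b : Pt) : Continuous fun x : Pt => cross (b - a) (x - a) := by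
  unfold cross; fun_prop

lemma pt_ext {x y : Pt} (h0 : x 0 = y 0) (h1 : x 1 = y 1) : x = y := by
  ext i; fin_cases i <;> assumption

lemma tri_cross {a b c : Pt} (hD : 0 < cross (b - a) (c - a)) (x : Pt) :
    tri a b c (cross (a - c) (x - c) / cross (b - a) (c - a))
      (cross (b - a) (x - a) / cross (b - a) (c - a)) = x := by
  have := hD.ne'
  apply pt_ext <;> simp only [tri, PiLp.add_apply, PiLp.smul_apply, PiLp.sub_apply, smul_eq_mul] <;>
    field_simp <;> simp only [cross, PiLp.sub_apply] <;> ring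

lemma tri_mem_hull (a b c : Pt) {s t : ℝ} (hs : 0 ≤ s) (ht : 0 ≤ t) (hst : s + t ≤ 1) :
    tri a b c s t ∈ convexHull ℝ ({a, b, c} : Set Pt) := by
  have h := (convex_convexHull ℝ ({a, b, c} : Set Pt)).sum_mem (t := Finset.univ)
    (w := ![1 - s - t, s, t]) (z := ![a, b, c]) (by
      intro i _; fin_cases i <;> simp <;> linarith) (by simp [Fin.sum_univ_three]; ring) (by
      intro i _; apply subset_convexHull; fin_cases i <;> simp)
  convert h using 1
  simp only [tri, Fin.sum_univ_three, Matrix.cons_val_zero, Matrix.cons_val_one, Matrix.cons_val]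
  module

lemma convex_cross_nonneg (a b : Pt) : Convex ℝ {x : Pt | 0 ≤ cross (b - a) (x - a)} := by
  intro x hx y hy s t hs ht hst
  simp only [Set.mem_ofPred_eq, cross, PiLp.sub_apply, PiLp.add_apply, PiLp.smul_apply,
    smul_eq_mul] at *
  have : (b 0 - a 0) * (s * x 1 + t * y 1 - a 1) - (b 1 - a 1) * (s * x 0 + t * y 0 - a 0)
    = s * ((b 0 - a 0) * (x 1 - a 1) - (b 1 - a 1) * (x 0 - a 0)) +
      t * ((b 0 - a 0) * (y 1 - a 1) - (b 1 - a 1) * (y 0 - a 0)) +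
      (s + t - 1) * ((b 0 - a 0) * a 1 - (b 1 - a 1) * a 0) := by ring
  rw [this, hst]
  have := mul_nonneg hs hx
  have := mul_nonneg ht hy
  linarith

lemma cross_self_right (a b : Pt) : cross (b - a) (a - a) = 0 := by simp [cross]
lemma cross_self_diff (a b : Pt) : cross (b - a) (b - a) = 0 := by simp [cross]; ring

lemma mem_hull_iff {a b c : Pt} (hD : 0 < cross (b - a) (c - a)) (x : Pt) :
    x ∈ convexHull ℝ ({a, b, c} : Set Pt) ↔
      0 ≤ cross (b - a) (x - a) ∧ 0 ≤ cross (c - b) (x - b) ∧ 0 ≤ cross (a - c) (x - c) := by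
  constructor
  · intro hx
    have h1 := cross_cyc a b c
    have h2 := cross_cyc b c a
    refine ⟨?_, ?_, ?_⟩
    · refine convexHull_min ?_ (convex_cross_nonneg a b) hx
      rintro y (rfl | rfl | rfl)
      · exact (cross_self_right _ _).ge
      · exact (cross_self_diff _ _).ge
      · exact hD.le
    · refine convexHull_min ?_ (convex_cross_nonneg b c) hx
      rintro y (rfl | rfl | rfl)
      · exact hD.le.trans_eq h1.symm
      · exact (cross_self_right _ _).ge
      · exact (cross_self_diff _ _).ge
    · refine convexHull_min ?_ (convex_cross_nonneg c a) hx
      rintro y (rfl | rfl | rfl)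
      · exact (cross_self_diff _ _).ge
      · exact hD.le.trans_eq (h2.trans h1).symm
      · exact (cross_self_right _ _).ge
  · rintro ⟨h1, h2, h3⟩
    rw [← tri_cross hD x]
    refine tri_mem_hull _ _ _ (by positivity) (by positivity) ?_
    rw [← add_div, div_le_one hD]
    have := cross_add_cross_add_cross a b c x
    linarith

lemma mem_interior_hull {a b c : Pt} (hD : 0 < cross (b - a) (c - a)) {x : Pt}
    (h1 : 0 < cross (b - a) (x - a)) (h2 : 0 < cross (c - b) (x - b))
    (h3 : 0 < cross (a - c) (x - c)) : x ∈ interior (convexHull ℝ ({a, b, c} : Set Pt)) := by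
  rw [mem_interior]
  refine ⟨{x | 0 < cross (b - a) (x - a)} ∩ ({x | 0 < cross (c - b) (x - b)} ∩
    {x | 0 < cross (a - c) (x - c)}), ?_, ?_, h1, h2, h3⟩
  · rintro y ⟨h1, h2, h3⟩
    exact (mem_hull_iff hD y).2 ⟨h1.le, h2.le, h3.le⟩
  · exact (isOpen_lt continuous_const (continuous_cross_sub _ _)).inter
      ((isOpen_lt continuous_const (continuous_cross_sub _ _)).inter
      (isOpen_lt continuous_const (continuous_cross_sub _ _)))

lemma isCompact_hull (a b c : Pt) : IsCompact (convexHull ℝ ({a, b, c} : Set Pt)) :=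
  Set.Finite.isCompact_convexHull ℝ (Set.toFinite _)

/-! ### Integration over a triangle -/

/-- The unit triangle. -/
def unitTri : Set Pt := {y | 0 ≤ y 0 ∧ 0 ≤ y 1 ∧ y 0 + y 1 ≤ 1}

lemma isClosed_unitTri : IsClosed unitTri := by
  have h0 : Continuous fun y : Pt => y 0 := by fun_prop
  have h1 : Continuous fun y : Pt => y 1 := by fun_prop
  exact (isClosed_le continuous_const h0).inter
    ((isClosed_le continuous_const h1).inter (isClosed_le (h0.add h1) continuous_const))

lemma integral_unitTri {f : Pt → ℝ} (hf : Continuous f) :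
    ∫ y in unitTri, f y = ∫ s in (0 : ℝ)..1, ∫ t in (0 : ℝ)..(1 - s), f !₂[s, t] := by
  let e : Pt ≃ᵐ ℝ × ℝ := (MeasurableEquiv.toLp 2 (Fin 2 → ℝ)).symm.trans
    (MeasurableEquiv.finTwoArrow (α := ℝ))
  have he : MeasurePreserving e.symm volume volume :=
    ((volume_preserving_finTwoArrow ℝ).comp
      (EuclideanSpace.volume_preserving_symm_measurableEquiv_toLp (Fin 2))).symm e
  have hes : ∀ p : ℝ × ℝ, e.symm p = !₂[p.1, p.2] := by
    intro p; rfl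
  have hT : MeasurableSet unitTri := isClosed_unitTri.measurableSet
  rw [← integral_indicator hT, ← he.integral_comp e.symm.measurableEmbedding]
  have hcomp : IsCompact unitTri := by
    refine Metric.isCompact_of_isClosed_isBounded isClosed_unitTri ?_
    refine (Metric.isBounded_closedBall (x := (0 : Pt)) (r := 2)).subset ?_
    rintro y ⟨h0, h1, h2⟩
    rw [mem_closedBall_zero_iff, EuclideanSpace.norm_eq, Real.sqrt_le_left (by norm_num)]
    simp only [Fin.sum_univ_two, Real.norm_eq_abs, sq_abs]
    nlinarith
  have hi : Integrable (unitTri.indicator f) volume := by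
    rw [integrable_indicator_iff hT]
    exact hf.continuousOn.integrableOn_compact hcomp
  have hi2 : Integrable (fun p : ℝ × ℝ => unitTri.indicator f (e.symm p)) (volume.prod volume) :=
    he.integrable_comp_of_integrable hi
  rw [Measure.volume_eq_prod, integral_prod _ hi2,
    intervalIntegral.integral_of_le zero_le_one, ← integral_Icc_eq_integral_Ioc,
    ← integral_indicator measurableSet_Icc]
  congr 1
  ext s
  by_cases hs : s ∈ Set.Icc (0 : ℝ) 1
  · rw [Set.indicator_of_mem hs, intervalIntegral.integral_of_le (by linarith [hs.2]),
      ← integral_Icc_eq_integral_Ioc, ← integral_indicator measurableSet_Icc]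
    congr 1
    ext t
    simp only [hes, Set.indicator_apply, unitTri, Set.mem_ofPred_eq, Set.mem_Icc]
    refine if_congr ?_ rfl rfl
    simp
    constructor
    · rintro ⟨h1, h2, h3⟩; exact ⟨h2, by linarith⟩
    · rintro ⟨h1, h2⟩; exact ⟨hs.1, h1, by linarith⟩
  · rw [Set.indicator_of_notMem hs]
    convert integral_zero ℝ ℝ with t
    apply Set.indicator_of_notMem
    rw [hes]
    rintro ⟨h1, h2, h3⟩
    simp at h1 h2 h3
    exact hs ⟨h1, by linarith⟩

lemma integral_hull (a b c : Pt) (hD : 0 < cross (b - a) (c - a)) {f : Pt → ℝ}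
    (hf : Continuous f) :
    ∫ y in convexHull ℝ ({a, b, c} : Set Pt), f y =
      cross (b - a) (c - a) * ∫ s in (0 : ℝ)..1, ∫ t in (0 : ℝ)..(1 - s), f (tri a b c s t) := by
  let A : Matrix (Fin 2) (Fin 2) ℝ := !![(b - a) 0, (c - a) 0; (b - a) 1, (c - a) 1]
  let L : Pt →L[ℝ] Pt := LinearMap.toContinuousLinearMap (Matrix.toEuclideanLin A)
  have hLdet : L.det = cross (b - a) (c - a) := by
    change LinearMap.det (Matrix.toEuclideanLin A) = _
    rw [Matrix.toEuclideanLin_eq_toLin_orthonormal, LinearMap.det_toLin, Matrix.det_fin_two]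
    simp [A, cross]; ring
  have hL : ∀ y : Pt, a + L y = tri a b c (y 0) (y 1) := by
    intro y
    apply pt_ext <;> simp [L, A, tri, Matrix.toLpLin_apply, dotProduct] <;> ring
  have himg : (fun y => a + L y) '' unitTri = convexHull ℝ ({a, b, c} : Set Pt) := by
    ext x
    constructor
    · rintro ⟨y, ⟨h0, h1, h2⟩, rfl⟩
      simp only [hL]
      exact tri_mem_hull _ _ _ h0 h1 h2
    · intro hx
      obtain ⟨h1, h2, h3⟩ := (mem_hull_iff hD x).1 hx
      refine ⟨!₂[cross (a - c) (x - c) / cross (b - a) (c - a),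
        cross (b - a) (x - a) / cross (b - a) (c - a)], ⟨?_, ?_, ?_⟩, ?_⟩
      · simp; positivity
      · simp; positivity
      · have := cross_add_cross_add_cross a b c x
        simp
        rw [← add_div, div_le_one hD]; linarith
      · simp only [hL]
        exact tri_cross hD x
  have hinj : Set.InjOn (fun y => a + L y) unitTri := by
    intro y _ y' _ h
    simp only [hL] at h
    have h0 := congrArg (fun z : Pt => z 0) h
    have h1 := congrArg (fun z : Pt => z 1) h
    simp only [tri, PiLp.add_apply, PiLp.smul_apply, smul_eq_mul] at h0 h1
    have hd := hD.ne'
    apply pt_ext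
    · apply mul_left_cancel₀ hd
      unfold cross; linear_combination h0 * (c - a) 1 - h1 * (c - a) 0
    · apply mul_left_cancel₀ hd
      unfold cross; linear_combination h1 * (b - a) 0 - h0 * (b - a) 1
  rw [← himg, integral_image_eq_integral_abs_det_fderiv_smul volume isClosed_unitTri.measurableSet
    (f' := fun _ => L) (fun y _ => ((L.hasFDerivAt).const_add a).hasFDerivWithinAt) hinj]
  simp only [hLdet, abs_of_pos hD, smul_eq_mul]
  rw [integral_const_mul, integral_unitTri (by fun_prop)]
  simp only [hL]
  simp

end
end StaggeredDG

namespace StaggeredDG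
noncomputable section

/-! ### Green's formula on a triangle -/

/-- The mean value over the segment from `a` to `b`. -/
def segMean (a b : Pt) (f : Pt → ℝ) : ℝ := ∫ s in (0 : ℝ)..1, f (AffineMap.lineMap a b s)

lemma continuous_lineMap_pt (a b : Pt) : Continuous fun s : ℝ => AffineMap.lineMap (k := ℝ) a b s :=
  AffineMap.lineMap_continuous

lemma segMean_comm (a b : Pt) (f : Pt → ℝ) : segMean a b f = segMean b a f := by
  unfold segMean
  have := intervalIntegral.integral_comp_sub_left (a := 0) (b := 1)
    (fun s => f (AffineMap.lineMap a b s)) 1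
  simp only [AffineMap.lineMap_apply_one_sub, sub_self, sub_zero] at this
  exact this.symm

lemma edgeInt_eq (a b : Pt) (f : Pt → ℝ) : edgeInt a b f = dist a b * segMean a b f := rfl

lemma edgeInt_comm (a b : Pt) (f : Pt → ℝ) : edgeInt a b f = edgeInt b a f := by
  rw [edgeInt_eq, edgeInt_eq, segMean_comm, dist_comm]

lemma segMean_add (a b : Pt) {f g : Pt → ℝ} (hf : Continuous f) (hg : Continuous g) :
    segMean a b (fun y => f y + g y) = segMean a b f + segMean a b g :=
  intervalIntegral.integral_add
    ((hf.comp (continuous_lineMap_pt a b)).intervalIntegrable _ _)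
    ((hg.comp (continuous_lineMap_pt a b)).intervalIntegrable _ _)

lemma segMean_const_mul (a b : Pt) (r : ℝ) (f : Pt → ℝ) :
    segMean a b (fun y => r * f y) = r * segMean a b f :=
  intervalIntegral.integral_const_mul _ _

lemma edgeInt_add (a b : Pt) {f g : Pt → ℝ} (hf : Continuous f) (hg : Continuous g) :
    edgeInt a b (fun y => f y + g y) = edgeInt a b f + edgeInt a b g := by
  simp only [edgeInt_eq, segMean_add a b hf hg, mul_add]

lemma edgeInt_const_mul (a b : Pt) (r : ℝ) (f : Pt → ℝ) :
    edgeInt a b (fun y => r * f y) = r * edgeInt a b f := by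
  simp only [edgeInt_eq, segMean_const_mul]; ring

lemma edgeInt_congr {a b : Pt} {f g : Pt → ℝ} (h : ∀ y ∈ segment ℝ a b, f y = g y) :
    edgeInt a b f = edgeInt a b g := by
  unfold edgeInt
  congr 1
  refine intervalIntegral.integral_congr fun s hs => h _ ?_
  rw [Set.uIcc_of_le zero_le_one] at hs
  rw [segment_eq_image_lineMap]
  exact ⟨s, hs, rfl⟩

lemma edgeInt_mono {a b : Pt} {f g : Pt → ℝ} (hf : Continuous f) (hg : Continuous g)
    (h : ∀ y ∈ segment ℝ a b, f y ≤ g y) : edgeInt a b f ≤ edgeInt a b g := by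
  refine mul_le_mul_of_nonneg_left (intervalIntegral.integral_mono_on zero_le_one
    ((hf.comp (continuous_lineMap_pt a b)).intervalIntegrable _ _)
    ((hg.comp (continuous_lineMap_pt a b)).intervalIntegrable _ _) fun s hs => h _ ?_) dist_nonneg
  rw [segment_eq_image_lineMap]
  exact ⟨s, hs, rfl⟩

lemma edgeInt_nonneg {a b : Pt} {f : Pt → ℝ} (h : ∀ y, 0 ≤ f y) : 0 ≤ edgeInt a b f :=
  mul_nonneg dist_nonneg (intervalIntegral.integral_nonneg zero_le_one fun _ _ => h _)

lemma eq_zero_of_edgeInt_sq {a b : Pt} (hab : a ≠ b) {f : Pt → ℝ} (hf : Continuous f)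
    (h : edgeInt a b (fun y => f y ^ 2) = 0) : ∀ y ∈ segment ℝ a b, f y = 0 := by
  have hm : segMean a b (fun y => f y ^ 2) = 0 := by
    simpa [edgeInt_eq, dist_eq_zero, hab] using h
  intro y hy
  rw [segment_eq_image_lineMap] at hy
  obtain ⟨s, hs, rfl⟩ := hy
  by_contra hne
  have := intervalIntegral.integral_pos (a := 0) (b := 1) zero_lt_one
    (f := fun s => f (AffineMap.lineMap a b s) ^ 2)
    (((hf.comp (continuous_lineMap_pt a b)).pow 2).continuousOn) (fun _ _ => sq_nonneg _)
    ⟨s, hs, by positivity⟩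
  exact this.ne' hm

lemma dist_mul_unor_zero (a b : Pt) : dist a b * unor a b 0 = (b - a) 1 := by
  by_cases h : a = b
  · simp [h]
  · simp [unor, utan, dist_ne_zero.2 h]

lemma dist_mul_unor_one (a b : Pt) : dist a b * unor a b 1 = -(b - a) 0 := by
  by_cases h : a = b
  · simp [h]
  · simp [unor, utan, dist_ne_zero.2 h]

lemma utan_swap (a b : Pt) : utan b a = -utan a b := by
  rw [utan, utan, dist_comm, ← smul_neg, neg_sub]

lemma unor_swap (a b : Pt) : unor b a = -unor a b := by
  apply pt_ext <;> simp [unor, utan_swap a b]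

lemma integral_hull_fderiv_dir {a b c : Pt} (hD : 0 < cross (b - a) (c - a)) {f : Pt → ℝ}
    (hf : ContDiff ℝ 1 f) :
    ∫ y in convexHull ℝ ({a, b, c} : Set Pt), fderiv ℝ f y (c - a) =
      cross (b - a) (c - a) * (segMean b c f - segMean a b f) := by
  have hc : Continuous fun y => fderiv ℝ f y (c - a) :=
    (hf.continuous_fderiv one_ne_zero).clm_apply continuous_const
  rw [integral_hull a b c hD hc]
  congr 1
  have hin : ∀ s : ℝ, ∫ t in (0 : ℝ)..(1 - s), fderiv ℝ f (tri a b c s t) (c - a)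
      = f (AffineMap.lineMap c b s) - f (AffineMap.lineMap a b s) := by
    intro s
    have hd : ∀ t : ℝ, HasDerivAt (fun t => f (tri a b c s t))
        (fderiv ℝ f (tri a b c s t) (c - a)) t := by
      intro t
      have h1 : HasDerivAt (fun t => tri a b c s t) (c - a) t := by
        simpa [tri] using ((hasDerivAt_id t).smul_const (c - a)).const_add (a + s • (b - a))
      exact ((hf.differentiable one_ne_zero _).hasFDerivAt).comp_hasDerivAt t h1
    have hct : Continuous fun t => tri a b c s t := by unfold tri; fun_prop
    rw [intervalIntegral.integral_eq_sub_of_hasDerivAt (fun t _ => hd t)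
      ((hc.comp hct).intervalIntegrable _ _)]
    congr 2
    · simp only [tri, AffineMap.lineMap_apply, vsub_eq_sub, vadd_eq_add]; module
    · simp only [tri, AffineMap.lineMap_apply, vsub_eq_sub, vadd_eq_add]; module
  simp_rw [hin]
  rw [intervalIntegral.integral_sub, segMean_comm b c]
  · rfl
  · exact (hf.continuous.comp (continuous_lineMap_pt _ _)).intervalIntegrable _ _
  · exact (hf.continuous.comp (continuous_lineMap_pt _ _)).intervalIntegrable _ _

lemma insert_rotate (a b c : Pt) : ({b, c, a} : Set Pt) = {a, b, c} := by
  ext x; simp only [Set.mem_insert_iff, Set.mem_singleton_iff]; tauto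

lemma integral_hull_fderiv {a b c : Pt} (hD : 0 < cross (b - a) (c - a)) {f : Pt → ℝ}
    (hf : ContDiff ℝ 1 f) (j : Fin 2) :
    ∫ y in convexHull ℝ ({a, b, c} : Set Pt), fderiv ℝ f y (EuclideanSpace.single j 1) =
      edgeInt a b (fun y => f y * unor a b j) + edgeInt b c (fun y => f y * unor b c j) +
      edgeInt c a (fun y => f y * unor c a j) := by
  have hw := integral_hull_fderiv_dir hD hf
  have hu := integral_hull_fderiv_dir (a := b) (b := c) (c := a) (by rwa [cross_cyc]) hf
  rw [insert_rotate, cross_cyc] at hu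
  have hc : ∀ v : Pt, IntegrableOn (fun y => fderiv ℝ f y v) (convexHull ℝ ({a, b, c} : Set Pt)) :=
    fun v => ((hf.continuous_fderiv one_ne_zero).clm_apply
      continuous_const).continuousOn.integrableOn_compact (isCompact_hull a b c)
  have key : ∀ v : Pt, cross (b - a) (c - a) * ∫ y in convexHull ℝ ({a, b, c} : Set Pt),
      fderiv ℝ f y v = - cross v (c - a) * (∫ y in convexHull ℝ ({a, b, c} : Set Pt),
      fderiv ℝ f y (a - b)) + cross (b - a) v * ∫ y in convexHull ℝ ({a, b, c} : Set Pt),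
      fderiv ℝ f y (c - a) := by
    intro v
    simp only [← integral_const_mul]
    rw [← integral_add ((hc _).const_mul _) ((hc _).const_mul _)]
    congr 1
    ext y
    have : cross (b - a) (c - a) • v = -cross v (c - a) • (a - b) + cross (b - a) v • (c - a) := by
      apply pt_ext <;> simp only [cross, PiLp.add_apply, PiLp.smul_apply, PiLp.sub_apply,
        smul_eq_mul] <;> ring
    have h2 := congrArg (fderiv ℝ f y) this
    simpa only [map_add, map_smul, smul_eq_mul] using h2
  have hk := key (EuclideanSpace.single j 1)
  rw [hw, hu] at hk
  apply mul_left_cancel₀ hD.ne'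
  rw [hk]
  have e : ∀ p q : Pt, edgeInt p q (fun y => f y * unor p q j) = (dist p q * unor p q j) *
      segMean p q f := by
    intro p q
    simp_rw [mul_comm (f _)]
    rw [edgeInt_const_mul, edgeInt_eq]; ring
  rw [e, e, e]
  fin_cases j
  · simp only [Fin.zero_eta, dist_mul_unor_zero]
    simp [cross]; ring
  · simp only [Fin.mk_one, dist_mul_unor_one]
    simp [cross]; ring

end
end StaggeredDG

namespace StaggeredDG
noncomputable section

/-! ### Polynomials in the plane -/

@[simp] lemma ev_add (y : Pt) (p q : Poly) : ev y (p + q) = ev y p + ev y q := by simp [ev]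
@[simp] lemma ev_sub (y : Pt) (p q : Poly) : ev y (p - q) = ev y p - ev y q := by simp [ev]
@[simp] lemma ev_neg (y : Pt) (p : Poly) : ev y (-p) = -ev y p := by simp [ev]
@[simp] lemma ev_mul (y : Pt) (p q : Poly) : ev y (p * q) = ev y p * ev y q := by simp [ev]
@[simp] lemma ev_pow (y : Pt) (p : Poly) (n : ℕ) : ev y (p ^ n) = ev y p ^ n := by simp [ev]
@[simp] lemma ev_zero (y : Pt) : ev y 0 = 0 := by simp [ev]
@[simp] lemma ev_one (y : Pt) : ev y 1 = 1 := by simp [ev]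
@[simp] lemma ev_C (y : Pt) (r : ℝ) : ev y (MvPolynomial.C r) = r := by simp [ev]
@[simp] lemma ev_X (y : Pt) (i : Fin 2) : ev y (MvPolynomial.X i) = y i := by simp [ev]
@[simp] lemma ev_smul (y : Pt) (r : ℝ) (p : Poly) : ev y (r • p) = r * ev y p := by simp [ev]
@[simp] lemma ev_sum {ι : Type*} (s : Finset ι) (y : Pt) (p : ι → Poly) :
    ev y (∑ i ∈ s, p i) = ∑ i ∈ s, ev y (p i) := by simp [ev]

lemma contDiff_ev (p : Poly) : ContDiff ℝ ∞ fun y : Pt => ev y p := by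
  induction p using MvPolynomial.induction_on with
  | C r => simp only [ev_C]; fun_prop
  | add p q hp hq => simp only [ev_add]; exact hp.add hq
  | mul_X p i hp =>
    simp only [ev_mul, ev_X]
    exact hp.mul (by fun_prop)

lemma continuous_ev (p : Poly) : Continuous fun y : Pt => ev y p := (contDiff_ev p).continuous

attribute [fun_prop] continuous_ev

lemma fderiv_ev (p : Poly) (y : Pt) (j : Fin 2) :
    fderiv ℝ (fun y : Pt => ev y p) y (EuclideanSpace.single j 1) =
      ev y (MvPolynomial.pderiv j p) := by
  have hd : ∀ p : Poly, DifferentiableAt ℝ (fun y : Pt => ev y p) y := fun p =>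
    (contDiff_ev p).differentiable (by simp) y
  induction p using MvPolynomial.induction_on with
  | C r => simp
  | add p q hp hq =>
    simp only [ev_add, map_add]
    rw [fderiv_fun_add (hd p) (hd q)]
    simp [hp, hq]
  | mul_X p i hp =>
    have hx : HasFDerivAt (fun y : Pt => y i) (EuclideanSpace.proj i : Pt →L[ℝ] ℝ) y :=
      (EuclideanSpace.proj i : Pt →L[ℝ] ℝ).hasFDerivAt
    simp only [ev_mul, ev_X]
    rw [fderiv_fun_mul (hd p) hx.differentiableAt, hx.fderiv]
    simp only [add_apply, smul_apply, hp,
      Derivation.leibniz, MvPolynomial.pderiv_X, smul_eq_mul, ev_add, ev_mul, ev_X]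
    by_cases h : i = j
    · subst h; simp
    · simp [h]

lemma eq_zero_of_ev_eq_zero {U : Set Pt} (hU : IsOpen U) (hne : U.Nonempty) {p : Poly}
    (h : ∀ y ∈ U, ev y p = 0) : p = 0 := by
  obtain ⟨x, hx⟩ := hne
  obtain ⟨ε, hε, hb⟩ := Metric.isOpen_iff.1 hU x hx
  have : Nontrivial ℝ := inferInstance
  refine MvPolynomial.funext_set (fun i => Set.Ioo (x i - ε / 2) (x i + ε / 2))
    (fun i => Set.Ioo_infinite (by linarith)) ?_
  intro y hy
  rw [map_zero]
  refine h (WithLp.toLp 2 y) (hb ?_)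
  rw [Metric.mem_ball, EuclideanSpace.dist_eq, Real.sqrt_lt' hε]
  have h0 := hy 0 (Set.mem_univ _)
  have h1 := hy 1 (Set.mem_univ _)
  simp only [Set.mem_Ioo] at h0 h1
  simp only [Fin.sum_univ_two, Real.dist_eq, sq_abs]
  have a0 : |y 0 - x 0| < ε / 2 := abs_lt.2 ⟨by linarith, by linarith⟩
  have a1 : |y 1 - x 1| < ε / 2 := abs_lt.2 ⟨by linarith, by linarith⟩
  have b0 := sq_lt_sq' (by linarith [abs_nonneg (y 0 - x 0)]) a0
  have b1 := sq_lt_sq' (by linarith [abs_nonneg (y 1 - x 1)]) a1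
  rw [sq_abs] at b0 b1
  nlinarith

/-- Polynomials that have degree at most `k` after multiplication by an affine function. -/
def lowDeg : ℕ → Submodule ℝ Poly
  | 0 => ⊥
  | k + 1 => MvPolynomial.restrictTotalDegree (Fin 2) ℝ k

lemma mem_lowDeg {k : ℕ} {q : Poly} (hq : q.totalDegree + 1 ≤ k) : q ∈ lowDeg k := by
  obtain _ | k := k
  · omega
  · exact (MvPolynomial.mem_restrictTotalDegree _ _ _).2 (by omega)

lemma totalDegree_X_mul {k : ℕ} {q : Poly} (hq : q ∈ lowDeg k) (j : Fin 2) :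
    (MvPolynomial.X j * q).totalDegree ≤ k := by
  obtain _ | k := k
  · obtain rfl : q = 0 := hq
    simp
  · have := (MvPolynomial.mem_restrictTotalDegree _ _ _).1 hq
    refine (MvPolynomial.totalDegree_mul _ _).trans ?_
    rw [MvPolynomial.totalDegree_X]; omega

instance (k : ℕ) : Module.Finite ℝ (lowDeg k) := by
  obtain _ | k := k
  · change Module.Finite ℝ (⊥ : Submodule ℝ Poly); infer_instance
  · change Module.Finite ℝ (MvPolynomial.restrictTotalDegree (Fin 2) ℝ k); infer_instance

lemma pderiv_mem_lowDeg {k : ℕ} {p : Poly} (hp : p.totalDegree ≤ k) (j : Fin 2) :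
    MvPolynomial.pderiv j p ∈ lowDeg k := by
  obtain _ | k := k
  · rw [Nat.le_zero, MvPolynomial.totalDegree_eq_zero_iff_eq_C] at hp
    rw [hp]
    simp
  · refine (MvPolynomial.mem_restrictTotalDegree _ _ _).2 ?_
    refine Finset.sup_le fun m hm => ?_
    rw [MvPolynomial.mem_support_iff, MvPolynomial.coeff_pderiv] at hm
    have := MvPolynomial.le_totalDegree
      (MvPolynomial.mem_support_iff.2 (left_ne_zero_of_mul hm))
    rw [Finsupp.sum_add_index' (fun _ => rfl) (fun _ _ _ => rfl), Finsupp.sum_single_index rfl]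
      at this
    change m.sum (fun _ e => e) ≤ k
    omega

lemma mem_lowDeg_of_X_mul {k : ℕ} {q : Poly} {j : Fin 2}
    (hq : (MvPolynomial.X j * q).totalDegree ≤ k) : q ∈ lowDeg k := by
  by_cases h : q = 0
  · rw [h]; exact zero_mem _
  · rw [MvPolynomial.totalDegree_mul_of_isDomain (MvPolynomial.X_ne_zero j) h,
      MvPolynomial.totalDegree_X] at hq
    exact mem_lowDeg (by omega)

lemma exists_X_one_mul {p : Poly} (h : ∀ s ∈ Set.Icc (0 : ℝ) 1, ev !₂[s, 0] p = 0) :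
    ∃ r, p = MvPolynomial.X 1 * r := by
  have hdec := MvPolynomial.divMonomial_add_modMonomial_single p 1
  set p0 := p.modMonomial (Finsupp.single 1 1) with hp0
  have hind : ∀ y : Fin 2 → ℝ, MvPolynomial.eval y p0 = MvPolynomial.eval ![y 0, 0] p0 := by
    intro y
    simp only [MvPolynomial.eval_eq']
    refine Finset.sum_congr rfl fun d hd => ?_
    have hd1 : d 1 = 0 := by
      by_contra hne
      rw [MvPolynomial.mem_support_iff] at hd
      exact hd (MvPolynomial.coeff_modMonomial_of_le p
        (Finsupp.single_le_iff.2 (Nat.one_le_iff_ne_zero.2 hne)))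
    simp [Fin.prod_univ_two, hd1]
  have hz : p0 = 0 := by
    refine MvPolynomial.funext_set (fun _ => Set.Icc (0 : ℝ) 1)
      (fun i => Set.Icc_infinite zero_lt_one) ?_
    intro y hy
    rw [hind, map_zero]
    have h1 := h (y 0) (hy 0 trivial)
    rw [← hdec] at h1
    simp only [ev_add, ev_mul, ev_X] at h1
    have h2 : ev !₂[y 0, 0] p0 = 0 := by simpa using h1
    convert h2 using 1
    unfold ev
    congr 2
  exact ⟨_, by rw [← hdec, hz, add_zero]⟩

/-- Substitution of polynomials for the coordinates. -/
def subst (f : Fin 2 → Poly) (p : Poly) : Poly := MvPolynomial.aeval f p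

lemma ev_subst (f : Fin 2 → Poly) (p : Poly) (y : Pt) :
    ev y (subst f p) = ev !₂[ev y (f 0), ev y (f 1)] p := by
  have h : ∀ i, (!₂[ev y (f 0), ev y (f 1)] : Pt) i = ev y (f i) := by
    intro i; fin_cases i <;> rfl
  induction p using MvPolynomial.induction_on with
  | C r => simp [subst]
  | add p q hp hq => simp only [subst, map_add, ev_add] at *; rw [hp, hq]
  | mul_X p i hp =>
    simp only [subst, map_mul, ev_mul, MvPolynomial.aeval_X, ev_X] at *
    rw [hp, h]

lemma totalDegree_subst_le {f : Fin 2 → Poly} (hf : ∀ i, (f i).totalDegree ≤ 1) (p : Poly) :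
    (subst f p).totalDegree ≤ p.totalDegree := by
  rw [subst, MvPolynomial.aeval_def, MvPolynomial.eval₂_eq']
  refine MvPolynomial.totalDegree_finsetSum_le fun d hd => ?_
  refine (MvPolynomial.totalDegree_mul _ _).trans ?_
  rw [MvPolynomial.algebraMap_eq, MvPolynomial.totalDegree_C, zero_add]
  refine (MvPolynomial.totalDegree_finsetProd _ _).trans ?_
  refine le_trans ?_ (MvPolynomial.le_totalDegree hd)
  rw [Finsupp.sum_fintype _ _ (fun _ => rfl)]
  refine Finset.sum_le_sum fun i _ => (MvPolynomial.totalDegree_pow _ _).trans ?_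
  exact (Nat.mul_le_mul_left _ (hf i)).trans (by simp)

lemma subst_mem_lowDeg {f : Fin 2 → Poly} (hf : ∀ i, (f i).totalDegree ≤ 1) {k : ℕ} {p : Poly}
    (hp : p ∈ lowDeg k) : subst f p ∈ lowDeg k := by
  obtain _ | k := k
  · obtain rfl : p = 0 := hp
    simp [subst]
  · exact (MvPolynomial.mem_restrictTotalDegree _ _ _).2 ((totalDegree_subst_le hf p).trans
      ((MvPolynomial.mem_restrictTotalDegree _ _ _).1 hp))

/-- The affine polynomial `y ↦ r + u y₀ + v y₁`. -/
def affPoly (r u v : ℝ) : Poly :=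
  MvPolynomial.C r + (MvPolynomial.C u * MvPolynomial.X 0 + MvPolynomial.C v * MvPolynomial.X 1)

lemma totalDegree_affPoly (r u v : ℝ) : (affPoly r u v).totalDegree ≤ 1 := by
  have h : ∀ (u : ℝ) (i : Fin 2), (MvPolynomial.C u * MvPolynomial.X i : Poly).totalDegree ≤ 1 :=
    fun u i => (MvPolynomial.totalDegree_mul _ _).trans (by simp)
  refine (MvPolynomial.totalDegree_add _ _).trans (max_le (by simp) ?_)
  exact (MvPolynomial.totalDegree_add _ _).trans (max_le (h _ _) (h _ _))

@[simp] lemma ev_affPoly (y : Pt) (r u v : ℝ) : ev y (affPoly r u v) = r + (u * y 0 + v * y 1) := by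
  simp [affPoly]

/-- The pull-back of a polynomial under `tri a b c`. -/
def pull (a b c : Pt) : Poly → Poly :=
  subst fun i => affPoly (a i) ((b - a) i) ((c - a) i)

lemma ev_pull (a b c y : Pt) (p : Poly) : ev y (pull a b c p) = ev (tri a b c (y 0) (y 1)) p := by
  rw [pull, ev_subst]
  congr 1
  apply pt_ext <;> simp [tri] <;> ring

/-- The polynomial `y ↦ cross (b - a) (y - a)`. -/
def crossPoly (a b : Pt) : Poly :=
  affPoly ((b - a) 1 * a 0 - (b - a) 0 * a 1) (-(b - a) 1) ((b - a) 0)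

@[simp] lemma ev_crossPoly (a b y : Pt) : ev y (crossPoly a b) = cross (b - a) (y - a) := by
  simp [crossPoly, cross]; ring

/-- The inverse of `pull a b c`. -/
def push (a b c : Pt) : Poly → Poly :=
  subst ![(cross (b - a) (c - a))⁻¹ • crossPoly c a, (cross (b - a) (c - a))⁻¹ • crossPoly a b]

lemma totalDegree_push (a b c : Pt) (p : Poly) :
    (push a b c p).totalDegree ≤ p.totalDegree := by
  refine totalDegree_subst_le (fun i => ?_) p
  have h : ∀ (r : ℝ) (a b : Pt), (r • crossPoly a b).totalDegree ≤ 1 := fun r a b =>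
    (MvPolynomial.totalDegree_smul_le _ _).trans (totalDegree_affPoly _ _ _)
  fin_cases i
  · exact h _ _ _
  · exact h _ _ _

lemma ev_push_tri {a b c : Pt} (hD : 0 < cross (b - a) (c - a)) (p : Poly) (s t : ℝ) :
    ev (tri a b c s t) (push a b c p) = ev !₂[s, t] p := by
  rw [push, ev_subst]
  congr 1
  have := hD.ne'
  apply pt_ext
  · simp [tri, cross] at this ⊢; field_simp; ring
  · simp [tri, cross] at this ⊢; field_simp; ring

lemma integral_hull_ev {a b c : Pt} (hD : 0 < cross (b - a) (c - a)) (p : Poly) :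
    ∫ y in convexHull ℝ ({a, b, c} : Set Pt), ev y p =
      cross (b - a) (c - a) * ∫ y in unitTri, ev y (pull a b c p) := by
  rw [integral_hull a b c hD (continuous_ev p), integral_unitTri (continuous_ev _)]
  simp [ev_pull]

/-! ### Integrals as linear functionals on polynomials -/

/-- The integral over a compact set as a linear functional on polynomials. -/
def intL (K : Set Pt) (hK : IsCompact K) : Poly →ₗ[ℝ] ℝ where
  toFun p := ∫ y in K, ev y p
  map_add' p q := by
    simp only [ev_add]
    exact integral_add ((continuous_ev p).continuousOn.integrableOn_compact hK)
      ((continuous_ev q).continuousOn.integrableOn_compact hK)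
  map_smul' r p := by
    simp only [ev_smul, RingHom.id_apply, smul_eq_mul]
    exact integral_const_mul _ _

/-- The weighted integral over a segment as a linear functional on polynomials. -/
def segL (a b : Pt) (f : Pt → ℝ) (hf : Continuous f) : Poly →ₗ[ℝ] ℝ where
  toFun p := edgeInt a b fun y => f y * ev y p
  map_add' p q := by
    simp only [ev_add, mul_add]
    exact edgeInt_add a b (by fun_prop) (by fun_prop)
  map_smul' r p := by
    simp only [ev_smul, RingHom.id_apply, smul_eq_mul]
    rw [← edgeInt_const_mul]
    congr 1; ext y; ring

lemma eq_zero_of_integral_nonneg {K : Set Pt} (hK : IsCompact K) (hne : (interior K).Nonempty)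
    {p : Poly} (hp : ∀ y ∈ K, 0 ≤ ev y p) (h : ∫ y in K, ev y p = 0) : p = 0 := by
  have hc := continuous_ev p
  rw [setIntegral_eq_zero_iff_of_nonneg_ae
    ((ae_restrict_iff' hK.measurableSet).2 (ae_of_all _ hp))
    (hc.continuousOn.integrableOn_compact hK)] at h
  have h2 := Measure.eqOn_open_of_ae_eq (ae_restrict_of_ae_restrict_of_subset interior_subset h)
    isOpen_interior hc.continuousOn continuousOn_const
  exact eq_zero_of_ev_eq_zero isOpen_interior hne fun y hy => by simpa using h2 hy

lemma eq_zero_of_integral_sq {K : Set Pt} (hK : IsCompact K) (hne : (interior K).Nonempty)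
    {p : Poly} (h : ∫ y in K, ev y p ^ 2 = 0) : p = 0 := by
  have := eq_zero_of_integral_nonneg hK hne (p := p ^ 2)
    (fun y _ => by rw [ev_pow]; positivity) (by simpa using h)
  simpa using this

lemma isCompact_unitTri : IsCompact unitTri := by
  refine Metric.isCompact_of_isClosed_isBounded isClosed_unitTri ?_
  refine (Metric.isBounded_closedBall (x := (0 : Pt)) (r := 2)).subset ?_
  rintro y ⟨h0, h1, h2⟩
  rw [mem_closedBall_zero_iff, EuclideanSpace.norm_eq, Real.sqrt_le_left (by norm_num)]
  simp only [Fin.sum_univ_two, Real.norm_eq_abs, sq_abs]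
  nlinarith

lemma interior_unitTri_nonempty : (interior unitTri).Nonempty := by
  refine ⟨!₂[1 / 4, 1 / 4], mem_interior.2 ⟨{y | 0 < y 0} ∩ ({y | 0 < y 1} ∩ {y | y 0 + y 1 < 1}),
    ?_, ?_, ?_⟩⟩
  · rintro y ⟨h0, h1, h2⟩
    exact ⟨le_of_lt h0, le_of_lt h1, le_of_lt h2⟩
  · have h0 : Continuous fun y : Pt => y 0 := by fun_prop
    have h1 : Continuous fun y : Pt => y 1 := by fun_prop
    exact (isOpen_lt continuous_const h0).inter ((isOpen_lt continuous_const h1).inter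
      (isOpen_lt (h0.add h1) continuous_const))
  · refine ⟨?_, ?_, ?_⟩ <;> norm_num

lemma exists_bilin_le {V : Type*} [AddCommGroup V] [Module ℝ V] [Module.Finite ℝ V]
    (B₁ B₂ : V →ₗ[ℝ] V →ₗ[ℝ] ℝ) (hpos : ∀ x, x ≠ 0 → 0 < B₂ x x) :
    ∃ C, 0 < C ∧ ∀ x, B₁ x x ≤ C * B₂ x x := by
  let e := (Module.finBasis ℝ V).equivFun
  have hcont : ∀ B : V →ₗ[ℝ] V →ₗ[ℝ] ℝ, Continuous fun x => B (e.symm x) (e.symm x) := by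
    intro B
    have : (fun x => B (e.symm x) (e.symm x)) = fun x => ∑ i, ∑ j, x i * (x j *
        B (Module.finBasis ℝ V i) (Module.finBasis ℝ V j)) := by
      ext x
      simp [e, Module.Basis.equivFun_symm_apply, map_sum, LinearMap.sum_apply,
        Finset.mul_sum]
      rw [Finset.sum_comm]
      simp only [mul_left_comm]
    rw [this]; fun_prop
  have hS := isCompact_sphere (0 : Fin (Module.finrank ℝ V) → ℝ) 1
  have hp : ∀ x ∈ Metric.sphere (0 : Fin (Module.finrank ℝ V) → ℝ) 1,
      0 < B₂ (e.symm x) (e.symm x) := by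
    intro x hx
    refine hpos _ fun h => ?_
    rw [LinearEquiv.map_eq_zero_iff] at h
    simp [h] at hx
  obtain ⟨C, hC⟩ := hS.bddAbove_image (f := fun x => B₁ (e.symm x) (e.symm x) /
    B₂ (e.symm x) (e.symm x)) ((hcont B₁).continuousOn.div (hcont B₂).continuousOn
      fun x hx => (hp x hx).ne')
  refine ⟨max C 1, by positivity, fun x => ?_⟩
  by_cases hx : x = 0
  · simp [hx]
  have hex : e x ≠ 0 := by simpa using hx
  have hn : ‖e x‖ ≠ 0 := norm_ne_zero_iff.2 hex
  have hmem : ‖e x‖⁻¹ • e x ∈ Metric.sphere (0 : Fin (Module.finrank ℝ V) → ℝ) 1 := by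
    rw [mem_sphere_zero_iff_norm, norm_smul, norm_inv, norm_norm, inv_mul_cancel₀ hn]
  have h1 := hC (Set.mem_image_of_mem _ hmem)
  have h2 := hp _ hmem
  simp only [map_smul, LinearEquiv.symm_apply_apply, LinearMap.smul_apply, smul_eq_mul] at h1 h2
  have h3 := hpos x hx
  have h4 : B₁ x x / B₂ x x ≤ max C 1 := by
    refine le_trans (le_of_eq ?_) (h1.trans (le_max_left _ _))
    field_simp
  rwa [div_le_iff₀ h3] at h4

end
end StaggeredDG

namespace StaggeredDG
noncomputable section

/-! ### Lifting edge values and moments to polynomials -/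

lemma lineMap_unit (s : ℝ) :
    AffineMap.lineMap (!₂[0, 0] : Pt) (!₂[1, 0] : Pt) s = (!₂[s, 0] : Pt) := by
  apply pt_ext <;> simp [AffineMap.lineMap_apply]

lemma edgeInt_unit (f : Pt → ℝ) :
    edgeInt !₂[0, 0] !₂[1, 0] f = ∫ s in (0 : ℝ)..1, f !₂[s, 0] := by
  simp [edgeInt, lineMap_unit, EuclideanSpace.dist_eq]

/-- The bilinear form `(p, q) ↦ L (p * q)` on a space of polynomials. -/
def mulForm (V : Submodule ℝ Poly) (L : Poly →ₗ[ℝ] ℝ) : V →ₗ[ℝ] V →ₗ[ℝ] ℝ :=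
  ((LinearMap.mul ℝ Poly).compr₂ L).domRestrict₁₂ V V

lemma mulForm_apply (V : Submodule ℝ Poly) (L : Poly →ₗ[ℝ] ℝ) (p q : V) :
    mulForm V L p q = L (p * q) := rfl

/-- Integration over the unit triangle and over its lower edge. -/
def unitL : Poly →ₗ[ℝ] ℝ := intL unitTri isCompact_unitTri
def unitEdgeL : Poly →ₗ[ℝ] ℝ := segL !₂[0, 0] !₂[1, 0] (fun _ => 1) continuous_const

lemma unitEdgeL_apply (p : Poly) : unitEdgeL p = ∫ s in (0 : ℝ)..1, ev !₂[s, 0] p := by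
  simp [unitEdgeL, segL, edgeInt_unit]

lemma unitL_sq_pos {p : Poly} (hp : p ≠ 0) : 0 < unitL (p * p) := by
  refine lt_of_le_of_ne (setIntegral_nonneg isCompact_unitTri.measurableSet fun y _ => ?_) ?_
  · rw [ev_mul]; exact mul_self_nonneg _
  · intro h
    refine hp (eq_zero_of_integral_sq isCompact_unitTri interior_unitTri_nonempty ?_)
    rw [h]; simp [unitL, intL, pow_two]

lemma exists_trace_const (k : ℕ) : ∃ C, 0 < C ∧ ∀ p : Poly, p.totalDegree ≤ k →
    unitEdgeL (p * p) ≤ C * unitL (p * p) := by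
  obtain ⟨C, hC, h⟩ := exists_bilin_le
    (mulForm (MvPolynomial.restrictTotalDegree (Fin 2) ℝ k) unitEdgeL)
    (mulForm (MvPolynomial.restrictTotalDegree (Fin 2) ℝ k) unitL)
    (fun x hx => unitL_sq_pos (by simpa using hx))
  exact ⟨C, hC, fun p hp => h ⟨p, (MvPolynomial.mem_restrictTotalDegree _ _ _).2 hp⟩⟩


lemma unitEdgeL_sq_nonneg (p : Poly) : 0 ≤ unitEdgeL (p * p) := by
  rw [unitEdgeL_apply]
  refine intervalIntegral.integral_nonneg zero_le_one fun s _ => ?_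
  rw [ev_mul]; exact mul_self_nonneg _

lemma eq_zero_of_unitEdgeL_sq {p : Poly} (h : unitEdgeL (p * p) = 0) :
    ∀ s ∈ Set.Icc (0 : ℝ) 1, ev !₂[s, 0] p = 0 := by
  intro s hs
  have h01 : (!₂[0, 0] : Pt) ≠ !₂[1, 0] := by
    intro h; simpa using congrArg (fun z : Pt => z 0) h
  refine eq_zero_of_edgeInt_sq h01 (continuous_ev p) ?_ _ ?_
  · refine Eq.trans ?_ h
    rw [edgeInt_unit, unitEdgeL_apply]; simp [pow_two]
  · rw [segment_eq_image_lineMap]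
    exact ⟨s, hs, lineMap_unit s⟩

/-- The product of the moments against `b`. -/
def momForm (V : Submodule ℝ Poly) (b : Poly) : V →ₗ[ℝ] V →ₗ[ℝ] ℝ :=
  let φ : V →ₗ[ℝ] ℝ := (unitL ∘ₗ (LinearMap.mul ℝ Poly) b).domRestrict V
  φ.smulRight φ

lemma momForm_apply (V : Submodule ℝ Poly) (b : Poly) (p q : V) :
    momForm V b p q = unitL (b * p) * unitL (b * q) := by
  simp [momForm]

lemma exists_lift_unit (k : ℕ) : ∃ C, 0 < C ∧ ∀ J G : Poly, J.totalDegree ≤ k →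
    G.totalDegree ≤ k → ∃ p : Poly, p.totalDegree ≤ k ∧
      (∀ s, ev !₂[s, 0] p = ev !₂[s, 0] J) ∧
      (∀ q ∈ lowDeg k, unitL ((p - G) * q) = 0) ∧
      unitL (p * p) ≤ C * (unitL (G * G) + unitEdgeL (J * J)) := by
  set V := MvPolynomial.restrictTotalDegree (Fin 2) ℝ k with hV
  let R : Submodule ℝ Poly := lowDeg k
  let b := Module.finBasis ℝ R
  have memV : ∀ p : Poly, p ∈ V ↔ p.totalDegree ≤ k := fun p =>
    MvPolynomial.mem_restrictTotalDegree _ _ _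
  have hspan : ∀ p : Poly, (∀ j, unitL ((b j : Poly) * p) = 0) → ∀ q ∈ R, unitL (p * q) = 0 := by
    intro p hp q hq
    have h0 : (unitL ∘ₗ (LinearMap.mul ℝ Poly) p).domRestrict R = 0 := by
      refine b.ext fun j => ?_
      simpa [mul_comm] using hp j
    simpa using LinearMap.congr_fun h0 ⟨q, hq⟩
  let BM : V →ₗ[ℝ] V →ₗ[ℝ] ℝ := ∑ j, momForm V (b j)
  have hBM : ∀ p : V, BM p p = ∑ j, unitL ((b j : Poly) * p) ^ 2 := by
    intro p; simp [BM, LinearMap.sum_apply, momForm_apply, pow_two]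
  have hpos1 : ∀ x : V, x ≠ 0 → 0 < mulForm V unitL x x := fun x hx =>
    unitL_sq_pos (by simpa using hx)
  have hpos2 : ∀ x : V, x ≠ 0 → 0 < (BM + mulForm V unitEdgeL) x x := by
    intro x hx
    have n1 : 0 ≤ BM x x := by rw [hBM]; positivity
    have n2 := unitEdgeL_sq_nonneg x
    rw [LinearMap.add_apply, LinearMap.add_apply, mulForm_apply]
    refine lt_of_le_of_ne (by positivity) fun h => ?_
    have e1 : BM x x = 0 := by linarith
    have e2 : unitEdgeL ((x : Poly) * x) = 0 := by linarith
    obtain ⟨r, hr⟩ := exists_X_one_mul (eq_zero_of_unitEdgeL_sq e2)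
    have hrR : r ∈ R := mem_lowDeg_of_X_mul (j := 1) (by rw [← hr]; exact (memV _).1 x.2)
    rw [hBM, Finset.sum_eq_zero_iff_of_nonneg (fun _ _ => sq_nonneg _)] at e1
    have e3 := hspan x (fun j => by simpa using e1 j (Finset.mem_univ _)) r hrR
    rw [hr, mul_assoc] at e3
    have e4 := eq_zero_of_integral_nonneg isCompact_unitTri interior_unitTri_nonempty
      (p := MvPolynomial.X 1 * (r * r)) (by
        rintro y ⟨h0, h1, h2⟩
        rw [ev_mul, ev_X, ev_mul]
        exact mul_nonneg h1 (mul_self_nonneg _)) e3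
    have e5 : r = 0 := by simpa using e4
    exact hx (Subtype.ext (by rw [hr, e5]; simp))
  obtain ⟨C₁, hC₁, h₁⟩ := exists_bilin_le (mulForm V unitL) _ hpos2
  obtain ⟨C₂, hC₂, h₂⟩ := exists_bilin_le BM (mulForm V unitL) hpos1
  refine ⟨C₁ * (C₂ + 1), by positivity, fun J G hJ hG => ?_⟩
  let T : R →ₗ[ℝ] Module.Dual ℝ R := mulForm R (unitL ∘ₗ (LinearMap.mul ℝ Poly) (MvPolynomial.X 1))
  have hT : Function.Injective T := by
    rw [injective_iff_map_eq_zero]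
    intro r hr
    have e3 : unitL (MvPolynomial.X 1 * ((r : Poly) * (r : Poly))) = 0 := LinearMap.congr_fun hr r
    have e4 := eq_zero_of_integral_nonneg isCompact_unitTri interior_unitTri_nonempty
      (p := MvPolynomial.X 1 * ((r : Poly) * (r : Poly))) (by
        rintro y ⟨h0, h1, h2⟩
        rw [ev_mul, ev_X, ev_mul]
        exact mul_nonneg h1 (mul_self_nonneg _)) e3
    simpa using e4
  have hTs := (LinearMap.injective_iff_surjective_of_finrank_eq_finrank
    (Subspace.dual_finrank_eq (K := ℝ) (V := R)).symm).1 hT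
  obtain ⟨r, hr⟩ := hTs ((unitL ∘ₗ (LinearMap.mul ℝ Poly) (G - J)).domRestrict R)
  have hp : (J + MvPolynomial.X 1 * (r : Poly)).totalDegree ≤ k :=
    (MvPolynomial.totalDegree_add _ _).trans (max_le hJ (totalDegree_X_mul r.2 1))
  have hedge : ∀ s : ℝ, ev !₂[s, 0] (J + MvPolynomial.X 1 * (r : Poly)) = ev !₂[s, 0] J := by
    intro s; simp
  have hmom : ∀ q ∈ R, unitL ((J + MvPolynomial.X 1 * (r : Poly) - G) * q) = 0 := by
    intro q hq
    have h := LinearMap.congr_fun hr ⟨q, hq⟩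
    have h' : unitL (MvPolynomial.X 1 * ((r : Poly) * q)) = unitL ((G - J) * q) := h
    have : (J + MvPolynomial.X 1 * (r : Poly) - G) * q =
      MvPolynomial.X 1 * ((r : Poly) * q) - (G - J) * q := by ring
    rw [this, map_sub, h', sub_self]
  refine ⟨J + MvPolynomial.X 1 * (r : Poly), hp, hedge, hmom, ?_⟩
  set p := J + MvPolynomial.X 1 * (r : Poly) with hpdef
  have i1 := h₁ ⟨p, (memV p).2 hp⟩
  have i2 := h₂ ⟨G, (memV G).2 hG⟩
  have i3 : BM ⟨p, (memV p).2 hp⟩ ⟨p, (memV p).2 hp⟩ =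
      BM ⟨G, (memV G).2 hG⟩ ⟨G, (memV G).2 hG⟩ := by
    rw [hBM, hBM]
    refine Finset.sum_congr rfl fun j _ => ?_
    have := hmom (b j) (b j).2
    rw [sub_mul, map_sub, sub_eq_zero] at this
    simp only [mul_comm (b j : Poly)]
    rw [this]
  have i4 : unitEdgeL (p * p) = unitEdgeL (J * J) := by
    simp only [unitEdgeL_apply, ev_mul, hedge]
  rw [LinearMap.add_apply, LinearMap.add_apply, i3] at i1
  simp only [mulForm_apply] at i1 i2
  rw [i4] at i1
  refine i1.trans ?_
  have n1 : 0 ≤ unitL (G * G) := by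
    refine setIntegral_nonneg isCompact_unitTri.measurableSet fun y _ => ?_
    rw [ev_mul]; exact mul_self_nonneg _
  have n2 := unitEdgeL_sq_nonneg J
  rw [mul_assoc]
  refine mul_le_mul_of_nonneg_left ?_ hC₁.le
  nlinarith

lemma isCompact_hull_interior_nonempty {a b c : Pt} (hD : 0 < cross (b - a) (c - a)) :
    (interior (convexHull ℝ ({a, b, c} : Set Pt))).Nonempty := by
  refine ⟨tri a b c (1 / 3) (1 / 3), mem_interior_hull hD ?_ ?_ ?_⟩ <;>
    simp [tri, cross] at hD ⊢ <;> linarith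

lemma lineMap_eq_tri (a b c : Pt) (s : ℝ) : AffineMap.lineMap a b s = tri a b c s 0 := by
  simp [AffineMap.lineMap_apply, tri, add_comm]

lemma segMean_ev (a b c : Pt) (p : Poly) :
    segMean a b (fun y => ev y p) = unitEdgeL (pull a b c p) := by
  simp [segMean, unitEdgeL_apply, ev_pull, lineMap_eq_tri a b c]

lemma pull_mul (a b c : Pt) (p q : Poly) : pull a b c (p * q) = pull a b c p * pull a b c q := by
  simp [pull, subst]

lemma pull_sub (a b c : Pt) (p q : Poly) : pull a b c (p - q) = pull a b c p - pull a b c q := by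
  simp [pull, subst]

lemma pull_push {a b c : Pt} (hD : 0 < cross (b - a) (c - a)) (p : Poly) :
    pull a b c (push a b c p) = p := by
  rw [← sub_eq_zero]
  refine eq_zero_of_ev_eq_zero isOpen_univ ⟨0, trivial⟩ fun y _ => ?_
  rw [ev_sub, ev_pull, ev_push_tri hD, sub_eq_zero]
  congr 1
  apply pt_ext <;> rfl

lemma exists_lift (k : ℕ) : ∃ C, 0 < C ∧ ∀ a b c : Pt, 0 < cross (b - a) (c - a) →
    ∀ J G : Poly, J.totalDegree ≤ k → G.totalDegree ≤ k → ∃ p : Poly, p.totalDegree ≤ k ∧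
      (∀ y ∈ segment ℝ a b, ev y p = ev y J) ∧
      (∀ q ∈ lowDeg k, ∫ y in convexHull ℝ ({a, b, c} : Set Pt), ev y ((p - G) * q) = 0) ∧
      ∫ y in convexHull ℝ ({a, b, c} : Set Pt), ev y p ^ 2 ≤
        C * ((∫ y in convexHull ℝ ({a, b, c} : Set Pt), ev y G ^ 2) +
          cross (b - a) (c - a) * segMean a b fun y => ev y J ^ 2) := by
  obtain ⟨C, hC, h⟩ := exists_lift_unit k
  refine ⟨C, hC, fun a b c hD J G hJ hG => ?_⟩
  have hdeg : ∀ p : Poly, (pull a b c p).totalDegree ≤ p.totalDegree := fun p =>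
    totalDegree_subst_le (fun i => totalDegree_affPoly _ _ _) p
  have hint : ∀ p : Poly, ∫ y in convexHull ℝ ({a, b, c} : Set Pt), ev y p =
      cross (b - a) (c - a) * unitL (pull a b c p) := fun p => integral_hull_ev hD p
  obtain ⟨p, hp, hedge, hmom, hbd⟩ := h (pull a b c J) (pull a b c G) ((hdeg _).trans hJ)
    ((hdeg _).trans hG)
  refine ⟨push a b c p, (totalDegree_push a b c p).trans hp, ?_, ?_, ?_⟩
  · intro y hy
    rw [segment_eq_image_lineMap] at hy
    obtain ⟨s, -, rfl⟩ := hy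
    rw [lineMap_eq_tri a b c, ev_push_tri hD, hedge, ev_pull]
    simp
  · intro q hq
    rw [hint, pull_mul, pull_sub, pull_push hD,
      hmom (pull a b c q) (subst_mem_lowDeg (fun i => totalDegree_affPoly _ _ _) hq), mul_zero]
  · simp only [← ev_pow]
    rw [hint, hint, segMean_ev a b c, ← mul_add, ← mul_assoc, mul_comm C, mul_assoc]
    refine mul_le_mul_of_nonneg_left ?_ hD.le
    simpa only [pow_two, pull_mul, pull_push hD] using hbd

lemma exists_trace (k : ℕ) : ∃ C, 0 < C ∧ ∀ a b c : Pt, 0 < cross (b - a) (c - a) →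
    ∀ p : Poly, p.totalDegree ≤ k → cross (b - a) (c - a) * segMean a b (fun y => ev y p ^ 2) ≤
      C * ∫ y in convexHull ℝ ({a, b, c} : Set Pt), ev y p ^ 2 := by
  obtain ⟨C, hC, h⟩ := exists_trace_const k
  refine ⟨C, hC, fun a b c hD p hp => ?_⟩
  have := h (pull a b c p)
    ((totalDegree_subst_le (fun i => totalDegree_affPoly _ _ _) p).trans hp)
  simp only [← ev_pow]
  rw [integral_hull_ev hD, segMean_ev a b c, ← mul_assoc, mul_comm C, mul_assoc]
  change _ ≤ _ * (_ * unitL _)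
  refine mul_le_mul_of_nonneg_left ?_ hD.le
  simpa only [pow_two, pull_mul] using this

end
end StaggeredDG

namespace StaggeredDG
noncomputable section

namespace StaggeredMesh

variable {Ω : Set Pt} (M : StaggeredMesh Ω)

/-! ### Geometry of staggered meshes -/

/-- The vertices of a triangle. -/
def verts (τ : Fin M.N) : Set Pt := {M.ctr τ, M.src τ, M.tgt τ}

lemma ccw_src (τ : Fin M.N) : 0 < cross (M.tgt τ - M.src τ) (M.ctr τ - M.src τ) := by
  rw [cross_cyc]; exact M.ccw τ

lemma ccw_tgt (τ : Fin M.N) : 0 < cross (M.ctr τ - M.tgt τ) (M.src τ - M.tgt τ) := by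
  rw [cross_cyc]; exact M.ccw_src τ

lemma cell_eq_src (τ : Fin M.N) :
    M.cell τ = convexHull ℝ ({M.src τ, M.tgt τ, M.ctr τ} : Set Pt) := by
  rw [insert_rotate]; rfl

lemma cell_eq_tgt (τ : Fin M.N) :
    M.cell τ = convexHull ℝ ({M.tgt τ, M.ctr τ, M.src τ} : Set Pt) := by
  rw [cell_eq_src, ← insert_rotate]

lemma isCompact_cell (τ : Fin M.N) : IsCompact (M.cell τ) := isCompact_hull _ _ _

lemma convex_cell (τ : Fin M.N) : Convex ℝ (M.cell τ) := convex_convexHull _ _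

lemma measurableSet_cell (τ : Fin M.N) : MeasurableSet (M.cell τ) :=
  (M.isCompact_cell τ).measurableSet

lemma interior_cell_nonempty (τ : Fin M.N) : (interior (M.cell τ)).Nonempty :=
  isCompact_hull_interior_nonempty (M.ccw τ)

lemma ne_of_cross_pos {a b c : Pt} (h : 0 < cross (b - a) (c - a)) : a ≠ b ∧ b ≠ c ∧ c ≠ a := by
  refine ⟨?_, ?_, ?_⟩
  · rintro rfl; simp [cross] at h
  · rintro rfl; rw [cross_self_diff] at h; exact lt_irrefl _ h
  · rintro rfl; simp [cross] at h

lemma src_ne_tgt (τ : Fin M.N) : M.src τ ≠ M.tgt τ := (ne_of_cross_pos (M.ccw τ)).2.1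

lemma tgt_ne_ctr (τ : Fin M.N) : M.tgt τ ≠ M.ctr τ := (ne_of_cross_pos (M.ccw τ)).2.2

lemma verts_eq_of_subset {σ τ : Fin M.N} (h : M.verts τ ⊆ M.verts σ) : σ = τ := by
  have h3 : ∀ τ, (M.verts τ).ncard = 3 := by
    intro τ
    obtain ⟨h1, h2, h3⟩ := ne_of_cross_pos (M.ccw τ)
    exact Set.ncard_eq_three.2 ⟨_, _, _, h1, h3.symm, h2, rfl⟩
  have := Set.eq_of_subset_of_ncard_le h (by rw [h3, h3])
    (Set.finite_of_ncard_ne_zero (by rw [h3]; norm_num))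
  exact M.distinct _ _ this.symm

lemma hull_pair_cross {a b x : Pt} {S : Set Pt} (hS : S ⊆ {a, b}) (hx : x ∈ convexHull ℝ S) :
    cross (b - a) (x - a) = 0 := by
  have := convexHull_mono hS hx
  rw [convexHull_pair, segment_eq_image_lineMap] at this
  obtain ⟨s, -, rfl⟩ := this
  simp [AffineMap.lineMap_apply, cross]; ring

/-- Distinct triangles meet in a line through two vertices of the second one; the third vertex of
the second is not a vertex of the first. -/
lemma inter_cell_subset {σ τ : Fin M.N} (h : σ ≠ τ) :
    (M.tgt τ ∉ M.verts σ ∧ ∀ x ∈ M.cell σ ∩ M.cell τ,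
      cross (M.src τ - M.ctr τ) (x - M.ctr τ) = 0) ∨
    (M.ctr τ ∉ M.verts σ ∧ ∀ x ∈ M.cell σ ∩ M.cell τ,
      cross (M.tgt τ - M.src τ) (x - M.src τ) = 0) ∨
    (M.src τ ∉ M.verts σ ∧ ∀ x ∈ M.cell σ ∩ M.cell τ,
      cross (M.ctr τ - M.tgt τ) (x - M.tgt τ) = 0) := by
  have hc : M.cell σ ∩ M.cell τ = convexHull ℝ (M.verts σ ∩ M.verts τ) := M.conforming σ τ
  have hns : ¬ M.verts τ ⊆ M.verts σ := fun hs => h (M.verts_eq_of_subset hs)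
  rw [hc]
  rw [Set.not_subset] at hns
  obtain ⟨w, hw, hwσ⟩ := hns
  have key : ∀ a b : Pt, M.verts τ = {w, a, b} → M.verts σ ∩ M.verts τ ⊆ {a, b} := by
    intro a b hab x hx
    have h2 := hx.2
    rw [hab] at h2
    rcases h2 with rfl | h2
    · exact absurd hx.1 hwσ
    · exact h2
  rcases hw with rfl | rfl | rfl
  · exact Or.inr (Or.inl ⟨hwσ, fun x hx => hull_pair_cross (key _ _ rfl) hx⟩)
  · exact Or.inr (Or.inr ⟨hwσ, fun x hx =>
      hull_pair_cross (key _ _ (insert_rotate _ _ _).symm) hx⟩)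
  · exact Or.inl ⟨hwσ, fun x hx => hull_pair_cross (key _ _ (by
      rw [insert_rotate, insert_rotate]; rfl)) hx⟩

lemma volume_inter_cell {σ τ : Fin M.N} (h : σ ≠ τ) : volume (M.cell σ ∩ M.cell τ) = 0 := by
  have hcomp : IsCompact (M.cell σ ∩ M.cell τ) := (M.isCompact_cell σ).inter (M.isCompact_cell τ)
  have hint : interior (M.cell σ ∩ M.cell τ) = ∅ := by
    by_contra hne
    rw [← ne_eq, ← Set.nonempty_iff_ne_empty] at hne
    have key : ∀ a b c : Pt, 0 < cross (b - a) (c - a) →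
        ¬ ∀ x ∈ M.cell σ ∩ M.cell τ, cross (b - a) (x - a) = 0 := by
      intro a b c hpos hall
      have h0 : crossPoly a b = 0 := eq_zero_of_ev_eq_zero isOpen_interior hne fun y hy => by
        rw [ev_crossPoly]; exact hall y (interior_subset hy)
      have := ev_crossPoly a b c
      rw [h0, ev_zero] at this
      exact hpos.ne this
    rcases M.inter_cell_subset h with h1 | h1 | h1
    · exact key _ _ _ (M.ccw τ) h1.2
    · exact key _ _ _ (M.ccw_src τ) h1.2
    · exact key _ _ _ (M.ccw_tgt τ) h1.2
  have hfr := (((M.convex_cell σ).inter (M.convex_cell τ))).addHaar_frontier (volume : Measure Pt)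
  rwa [frontier, hint, Set.sdiff_empty, hcomp.isClosed.closure_eq] at hfr

lemma exists_common_point {a b c c' : Pt} (h : 0 < cross (b - a) (c - a))
    (h' : 0 < cross (b - a) (c' - a)) :
    ∃ x ∈ convexHull ℝ ({a, b, c} : Set Pt) ∩ convexHull ℝ ({a, b, c'} : Set Pt),
      0 < cross (b - a) (x - a) := by
  let X : ℝ → Pt := fun ε => tri a b c ((1 - ε) / 2) ε
  have hX : Continuous X := by simp only [X, tri]; fun_prop
  have hx0 : X 0 = tri a b c' (1 / 2) 0 := by simp [X, tri]
  have c1 : 0 < cross (c' - b) (X 0 - b) := by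
    rw [hx0]; simp [tri, cross] at h' ⊢; linarith
  have c2 : 0 < cross (a - c') (X 0 - c') := by
    rw [hx0]; simp [tri, cross] at h' ⊢; linarith
  have e1 := (((continuous_cross_sub b c').comp hX).tendsto 0).eventually_const_lt c1
  have e2 := (((continuous_cross_sub c' a).comp hX).tendsto 0).eventually_const_lt c2
  obtain ⟨ε, ⟨he1, he2⟩, he0, he3⟩ := (((e1.and e2).filter_mono nhdsWithin_le_nhds).and
    (Ioo_mem_nhdsGT (zero_lt_one' ℝ))).exists
  have hpos : 0 < cross (b - a) (X ε - a) := by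
    have : cross (b - a) (X ε - a) = ε * cross (b - a) (c - a) := by
      simp [X, tri, cross]; ring
    rw [this]; positivity
  refine ⟨X ε, ⟨tri_mem_hull _ _ _ (by linarith) he0.le (by linarith),
    (mem_hull_iff h' _).2 ⟨hpos.le, he1.le, he2.le⟩⟩, hpos⟩

lemma next_injective : Function.Injective M.next := by
  intro σ τ hστ
  by_contra hne
  have hc : M.ctr σ = M.ctr τ := by rw [← M.ctr_next σ, hστ, M.ctr_next]
  have ht : M.tgt σ = M.tgt τ := by rw [← M.src_next σ, hστ, M.src_next]
  have hσ := M.ccw_tgt σ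
  rw [hc, ht] at hσ
  obtain ⟨x, ⟨hx1, hx2⟩, hx⟩ := exists_common_point hσ (M.ccw_tgt τ)
  rw [← hc, ← ht, ← M.cell_eq_tgt] at hx1
  rw [← M.cell_eq_tgt] at hx2
  rcases M.inter_cell_subset hne with h1 | h1 | h1
  · exact h1.1 (by simp [verts, ht])
  · exact h1.1 (by simp [verts, hc])
  · exact hx.ne' (h1.2 x ⟨hx1, hx2⟩)

lemma sum_next (g : Fin M.N → ℝ) : ∑ τ, g (M.next τ) = ∑ τ, g τ :=
  Function.Bijective.sum_comp (Finite.injective_iff_bijective.1 M.next_injective) g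

lemma nbr_symm {σ τ : Fin M.N} (h : M.nbr τ = some σ) : M.nbr σ = some τ := by
  rw [M.nbr_eq_some] at h ⊢
  exact ⟨h.2.symm, h.1.symm⟩

lemma sum_primal (g : Fin M.N → ℝ) :
    ∑ τ, g τ = ∑ τ ∈ M.plus, (g τ + (M.nbr τ).elim 0 g) := by
  rw [Finset.sum_add_distrib, ← Finset.sum_add_sum_compl M.plus g]
  congr 1
  have h1 : ∑ τ ∈ M.plus, (M.nbr τ).elim 0 g = ∑ τ ∈ M.plusInt, g ((M.nbr τ).getD τ) := by
    rw [plusInt, Finset.sum_filter]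
    refine Finset.sum_congr rfl fun τ _ => ?_
    cases M.nbr τ <;> simp
  rw [h1]
  refine Finset.sum_nbij' (fun τ => (M.nbr τ).getD τ) (fun τ => (M.nbr τ).getD τ) ?_ ?_ ?_ ?_ ?_
  · intro τ hτ
    rw [Finset.mem_compl] at hτ
    obtain ⟨σ, hσ⟩ : ∃ σ, M.nbr τ = some σ := by
      rw [← Option.ne_none_iff_exists']
      exact fun h => hτ (M.plus_boundary τ h)
    have := M.plus_interior _ _ hσ
    simp only [plusInt, Finset.mem_filter, hσ, Option.getD_some, M.nbr_symm hσ]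
    exact ⟨by tauto, rfl⟩
  · intro τ hτ
    rw [plusInt, Finset.mem_filter, Option.isSome_iff_exists] at hτ
    obtain ⟨h1, σ, hσ⟩ := hτ
    rw [hσ, Option.getD_some, Finset.mem_compl]
    exact (M.plus_interior _ _ hσ).1 h1
  · intro τ hτ
    rw [Finset.mem_compl] at hτ
    obtain ⟨σ, hσ⟩ : ∃ σ, M.nbr τ = some σ := by
      rw [← Option.ne_none_iff_exists']
      exact fun h => hτ (M.plus_boundary τ h)
    simp [hσ, M.nbr_symm hσ]
  · intro τ hτ
    rw [plusInt, Finset.mem_filter, Option.isSome_iff_exists] at hτ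
    obtain ⟨h1, σ, hσ⟩ := hτ
    simp [hσ, M.nbr_symm hσ]
  · intro τ hτ
    rw [Finset.mem_compl] at hτ
    obtain ⟨σ, hσ⟩ : ∃ σ, M.nbr τ = some σ := by
      rw [← Option.ne_none_iff_exists']
      exact fun h => hτ (M.plus_boundary τ h)
    simp [hσ, M.nbr_symm hσ]

/-! ### Green's formula on the mesh -/

lemma continuous_dot (X : M.Vec) (a : Pt) (τ : Fin M.N) : Continuous (X.dot a τ) := by
  unfold Vec.dot; fun_prop

lemma continuous_jumpPr {F : Fin M.N → Pt → ℝ} (hF : ∀ τ, Continuous (F τ)) (τ : Fin M.N) :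
    Continuous (M.jumpPr F τ) := by
  unfold jumpPr
  cases M.nbr τ with
  | none => exact hF τ
  | some σ => exact (hF τ).sub (hF σ)

lemma continuous_avgPr {F : Fin M.N → Pt → ℝ} (hF : ∀ τ, Continuous (F τ)) (τ : Fin M.N) :
    Continuous (M.avgPr F τ) := by
  unfold avgPr
  cases M.nbr τ with
  | none => exact hF τ
  | some σ => exact ((hF τ).add (hF σ)).div_const 2

lemma continuous_jumpDl {F : Fin M.N → Pt → ℝ} (hF : ∀ τ, Continuous (F τ)) (τ : Fin M.N) :
    Continuous (M.jumpDl F τ) := (hF _).sub (hF _)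

lemma continuous_avgDl {F : Fin M.N → Pt → ℝ} (hF : ∀ τ, Continuous (F τ)) (τ : Fin M.N) :
    Continuous (M.avgDl F τ) := ((hF _).add (hF _)).div_const 2

lemma dot_neg (X : M.Vec) (a : Pt) (τ : Fin M.N) (y : Pt) : X.dot (-a) τ y = -X.dot a τ y := by
  simp [Vec.dot]

lemma edgeInt_neg (a b : Pt) (f : Pt → ℝ) : edgeInt a b (fun y => -f y) = -edgeInt a b f := by
  have := edgeInt_const_mul a b (-1) f
  simpa using this

lemma edgeInt_sub (a b : Pt) {f g : Pt → ℝ} (hf : Continuous f) (hg : Continuous g) :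
    edgeInt a b (fun y => f y - g y) = edgeInt a b f - edgeInt a b g := by
  simp only [sub_eq_add_neg]
  have := edgeInt_add a b hf hg.neg
  rw [← edgeInt_neg]
  exact this

lemma norPr_nbr {σ τ : Fin M.N} (h : M.nbr τ = some σ) : M.norPr σ = -M.norPr τ := by
  rw [M.nbr_eq_some] at h
  rw [norPr, h.1, h.2, unor_swap]; rfl

lemma intPr_nbr {σ τ : Fin M.N} (h : M.nbr τ = some σ) (F : Pt → ℝ) :
    M.intPr σ F = M.intPr τ F := by
  rw [M.nbr_eq_some] at h
  rw [intPr, h.1, h.2, edgeInt_comm]; rfl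

/-- Green's formula for `C¹` functions on a triangle of the mesh. -/
lemma integral_cell_fderiv (τ : Fin M.N) {f : Fin 2 → Pt → ℝ} (hf : ∀ j, ContDiff ℝ 1 (f j)) :
    ∫ y in M.cell τ, ∑ j, fderiv ℝ (f j) y (EuclideanSpace.single j 1) =
      M.intPr τ (fun y => ∑ j, f j y * M.norPr τ j) +
      M.intDl τ (fun y => ∑ j, f j y * M.norDl τ j) +
      edgeInt (M.ctr τ) (M.src τ) (fun y => ∑ j, f j y * unor (M.ctr τ) (M.src τ) j) := by
  have hi : ∀ j, IntegrableOn (fun y => fderiv ℝ (f j) y (EuclideanSpace.single j 1)) (M.cell τ) :=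
    fun j => (((hf j).continuous_fderiv one_ne_zero).clm_apply
      continuous_const).continuousOn.integrableOn_compact (M.isCompact_cell τ)
  have hc : ∀ j, Continuous (f j) := fun j => (hf j).continuous
  simp only [Fin.sum_univ_two]
  rw [integral_add (hi 0) (hi 1), M.cell_eq_src, integral_hull_fderiv (M.ccw_src τ) (hf 0),
    integral_hull_fderiv (M.ccw_src τ) (hf 1)]
  simp only [intPr, intDl, norPr, norDl]
  rw [edgeInt_add _ _ (by fun_prop) (by fun_prop), edgeInt_add _ _ (by fun_prop) (by fun_prop),
    edgeInt_add _ _ (by fun_prop) (by fun_prop)]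
  ring

lemma edgeInt_ctr_src_next (τ : Fin M.N) (X : Fin 2 → Pt → ℝ) :
    edgeInt (M.ctr (M.next τ)) (M.src (M.next τ))
      (fun y => ∑ j, X j y * unor (M.ctr (M.next τ)) (M.src (M.next τ)) j) =
    -M.intDl τ (fun y => ∑ j, X j y * M.norDl τ j) := by
  rw [M.ctr_next, M.src_next, edgeInt_comm, unor_swap, intDl, ← edgeInt_neg]
  simp [norDl]

/-- The sum of edge contributions over the boundaries of all triangles. -/
lemma sum_boundary {X : Fin M.N → Fin 2 → Pt → ℝ} (hX : ∀ τ j, Continuous (X τ j)) :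
    ∑ τ, (M.intPr τ (fun y => ∑ j, X τ j y * M.norPr τ j) +
      M.intDl τ (fun y => ∑ j, X τ j y * M.norDl τ j) +
      edgeInt (M.ctr τ) (M.src τ) (fun y => ∑ j, X τ j y * unor (M.ctr τ) (M.src τ) j)) =
    (∑ τ ∈ M.plus, M.intPr τ (M.jumpPr (fun σ y => ∑ j, X σ j y * M.norPr τ j) τ)) +
      ∑ τ, M.intDl τ (M.jumpDl (fun σ y => ∑ j, X σ j y * M.norDl τ j) τ) := by
  rw [Finset.sum_add_distrib, Finset.sum_add_distrib,
    ← M.sum_next (fun τ => edgeInt (M.ctr τ) (M.src τ) _), add_assoc, ← Finset.sum_add_distrib,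
    M.sum_primal]
  congr 1
  · refine Finset.sum_congr rfl fun τ _ => ?_
    unfold jumpPr
    rcases h : M.nbr τ with _ | σ
    · simp
    · simp only [Option.elim_some]
      rw [M.intPr_nbr h, M.norPr_nbr h, intPr, intPr, intPr, edgeInt_sub _ _ (by fun_prop)
        (by fun_prop), sub_eq_add_neg, ← edgeInt_neg]
      simp
  · refine Finset.sum_congr rfl fun τ _ => ?_
    rw [M.edgeInt_ctr_src_next τ (X (M.next τ))]
    unfold jumpDl intDl
    rw [edgeInt_sub _ _ (by fun_prop) (by fun_prop), sub_eq_add_neg]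

lemma integral_cell_div (X : M.Vec) (τ : Fin M.N) :
    ∫ y in M.cell τ, X.div τ y = M.intPr τ (X.dot (M.norPr τ) τ) +
      M.intDl τ (X.dot (M.norDl τ) τ) +
      edgeInt (M.ctr τ) (M.src τ) (X.dot (unor (M.ctr τ) (M.src τ)) τ) := by
  have := M.integral_cell_fderiv τ (f := fun j y => ev y (X τ j))
    (fun j => (contDiff_ev _).of_le (by simp))
  simp only [fderiv_ev] at this
  exact this

lemma meshInt_div (X : M.Vec) :
    M.meshInt X.div = (∑ τ ∈ M.plus, M.intPr τ (M.jumpPr (X.dot (M.norPr τ)) τ)) +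
      ∑ τ, M.intDl τ (M.jumpDl (X.dot (M.norDl τ)) τ) := by
  simp only [meshInt, M.integral_cell_div]
  exact M.sum_boundary (X := fun τ j y => ev y (X τ j)) (fun τ j => continuous_ev _)

end StaggeredMesh
end
end StaggeredDG

namespace StaggeredDG
noncomputable section

namespace StaggeredMesh

variable {Ω : Set Pt} (M : StaggeredMesh Ω)

/-! ### Linear maps between spaces of piecewise polynomials -/

/-- Integration over a triangle and over its edges. -/
def cellL (τ : Fin M.N) : Poly →ₗ[ℝ] ℝ := intL (M.cell τ) (M.isCompact_cell τ)
def prL (τ : Fin M.N) : Poly →ₗ[ℝ] ℝ := segL (M.src τ) (M.tgt τ) (fun _ => 1) continuous_const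
def dlL (τ : Fin M.N) : Poly →ₗ[ℝ] ℝ := segL (M.tgt τ) (M.ctr τ) (fun _ => 1) continuous_const

lemma cellL_apply (τ : Fin M.N) (p : Poly) : M.cellL τ p = ∫ y in M.cell τ, ev y p := rfl
lemma prL_apply (τ : Fin M.N) (p : Poly) : M.prL τ p = M.intPr τ fun y => ev y p := by
  simp [prL, segL, intPr]
lemma dlL_apply (τ : Fin M.N) (p : Poly) : M.dlL τ p = M.intDl τ fun y => ev y p := by
  simp [dlL, segL, intDl]

/-- The restriction of a piecewise polynomial to a triangle. -/
def atL (τ : Fin M.N) : M.Sca →ₗ[ℝ] Poly := LinearMap.proj (φ := fun _ => Poly) τ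

@[simp] lemma atL_apply (τ : Fin M.N) (q : M.Sca) : M.atL τ q = q τ := rfl

/-- Jumps and averages of piecewise polynomials. -/
def jmpPr (τ : Fin M.N) : M.Sca →ₗ[ℝ] Poly :=
  (M.nbr τ).elim (M.atL τ) fun σ => M.atL τ - M.atL σ
def mnPr (τ : Fin M.N) : M.Sca →ₗ[ℝ] Poly :=
  (M.nbr τ).elim (M.atL τ) fun σ => (2⁻¹ : ℝ) • (M.atL τ + M.atL σ)
def jmpDl (τ : Fin M.N) : M.Sca →ₗ[ℝ] Poly := M.atL τ - M.atL (M.next τ)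
def mnDl (τ : Fin M.N) : M.Sca →ₗ[ℝ] Poly := (2⁻¹ : ℝ) • (M.atL τ + M.atL (M.next τ))

lemma ev_jmpPr (τ : Fin M.N) (p : M.Sca) (y : Pt) :
    ev y (M.jmpPr τ p) = M.jumpPr (fun σ y => ev y (p σ)) τ y := by
  unfold jmpPr jumpPr
  cases M.nbr τ <;> simp
lemma ev_mnPr (τ : Fin M.N) (p : M.Sca) (y : Pt) :
    ev y (M.mnPr τ p) = M.avgPr (fun σ y => ev y (p σ)) τ y := by
  unfold mnPr avgPr
  cases M.nbr τ <;> simp; ring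
lemma ev_jmpDl (τ : Fin M.N) (p : M.Sca) (y : Pt) :
    ev y (M.jmpDl τ p) = M.jumpDl (fun σ y => ev y (p σ)) τ y := by
  simp [jmpDl, jumpDl]
lemma ev_mnDl (τ : Fin M.N) (p : M.Sca) (y : Pt) :
    ev y (M.mnDl τ p) = M.avgDl (fun σ y => ev y (p σ)) τ y := by
  simp [mnDl, avgDl]; ring

/-- Components, derivatives and directional components. -/
def compL (i : Fin 2) : M.Vec →ₗ[ℝ] M.Sca where
  toFun v τ := v τ i
  map_add' _ _ := rfl
  map_smul' _ _ := rfl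
def gradL (i j : Fin 2) : M.Vec →ₗ[ℝ] M.Sca where
  toFun v τ := MvPolynomial.pderiv j (v τ i)
  map_add' _ _ := by ext1; simp
  map_smul' _ _ := by ext1; simp
def dotL (a : Pt) : M.Vec →ₗ[ℝ] M.Sca := ∑ i, a i • M.compL i
def divL : M.Vec →ₗ[ℝ] M.Sca := ∑ i, M.gradL i i
def tcompL (i j : Fin 2) : M.Ten →ₗ[ℝ] M.Sca where
  toFun H τ := H τ i j
  map_add' _ _ := rfl
  map_smul' _ _ := rfl
def appL (a : Pt) (i : Fin 2) : M.Ten →ₗ[ℝ] M.Sca := ∑ j, a j • M.tcompL i j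
def quadL (b a : Pt) : M.Ten →ₗ[ℝ] M.Sca := ∑ i, b i • M.appL a i

lemma ev_compL (i : Fin 2) (v : M.Vec) : (fun τ y => ev y (M.compL i v τ)) = v.comp i := rfl
lemma ev_dotL (a : Pt) (v : M.Vec) : (fun τ y => ev y (M.dotL a v τ)) = v.dot a := by
  ext τ y; simp [dotL, Vec.dot, compL, mul_comm]
lemma ev_divL (v : M.Vec) : (fun τ y => ev y (M.divL v τ)) = v.div := by
  ext τ y; simp [divL, Vec.div, Vec.grad, gradL]
lemma ev_appL (a : Pt) (i : Fin 2) (H : M.Ten) :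
    (fun τ y => ev y (M.appL a i H τ)) = H.app a i := by
  ext τ y; simp [appL, Ten.app, tcompL, mul_comm]
lemma ev_quadL (b a : Pt) (H : M.Ten) : (fun τ y => ev y (M.quadL b a H τ)) = H.quad b a := by
  ext τ y
  simp [quadL, Ten.quad, ← ev_appL]

lemma tenInner_eq (G H : M.Ten) : M.tenInner G H =
    ∑ τ, M.cellL τ (∑ i, ∑ j, M.tcompL i j G τ * M.tcompL i j H τ) := by
  simp only [tenInner, meshInt, cellL_apply, ev_sum, ev_mul]
  rfl

lemma formB_eq (H : M.Ten) (v : M.Vec) : M.formB H v =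
    (∑ τ, M.cellL τ (∑ i, ∑ j, M.tcompL i j H τ * M.gradL i j v τ))
    - (∑ τ ∈ M.plus, M.prL τ
        (∑ i, M.mnPr τ (M.appL (M.norPr τ) i H) * M.jmpPr τ (M.compL i v)))
    - ∑ τ, M.dlL τ (M.mnDl τ (M.quadL (M.tanDl τ) (M.norDl τ) H) *
        M.jmpDl τ (M.dotL (M.tanDl τ) v)) := by
  simp only [formB, meshInt, cellL_apply, prL_apply, dlL_apply, ev_sum, ev_mul, ev_mnPr, ev_jmpPr,
    ev_mnDl, ev_jmpDl, ev_appL, ev_quadL, ev_dotL, ev_compL]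
  rfl

lemma formbStar_eq (q : M.Sca) (v : M.Vec) : M.formbStar q v =
    -(∑ τ, M.cellL τ (q τ * M.divL v τ))
    + ∑ τ ∈ M.plus, M.prL τ (M.mnPr τ q * M.jmpPr τ (M.dotL (M.norPr τ) v)) := by
  simp only [formbStar, meshInt, cellL_apply, prL_apply, ev_mul, ev_mnPr, ev_jmpPr, ev_dotL,
    ← ev_divL]
  rfl

lemma continuous_comp (v : M.Vec) (i : Fin 2) (τ : Fin M.N) : Continuous (v.comp i τ) := by
  unfold Vec.comp; fun_prop

lemma formN_eq (w ψ v : M.Vec) : M.formN w ψ v =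
    -(∑ τ, M.cellL τ (∑ i, ∑ j, M.compL i ψ τ * M.compL j w τ * M.gradL i j v τ))
    + ((∑ τ ∈ M.plusInt, segL (M.src τ) (M.tgt τ) (M.avgPr (w.dot (M.norPr τ)) τ)
          (M.continuous_avgPr (M.continuous_dot w _) τ)
          (∑ i, M.mnPr τ (M.compL i ψ) * M.jmpPr τ (M.compL i v)))
      + ∑ τ, segL (M.tgt τ) (M.ctr τ) (M.avgDl (w.dot (M.norDl τ)) τ)
          (M.continuous_avgDl (M.continuous_dot w _) τ)
          (∑ i, M.mnDl τ (M.compL i ψ) * M.jmpDl τ (M.compL i v)))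
    + ((∑ τ ∈ M.plus, segL (M.src τ) (M.tgt τ) (fun y => |M.avgPr (w.dot (M.norPr τ)) τ y|)
          (M.continuous_avgPr (M.continuous_dot w _) τ).abs
          (∑ i, M.jmpPr τ (M.compL i ψ) * M.jmpPr τ (M.compL i v)))
      + ∑ τ, segL (M.tgt τ) (M.ctr τ) (fun y => |M.avgDl (w.dot (M.norDl τ)) τ y|)
          (M.continuous_avgDl (M.continuous_dot w _) τ).abs
          (∑ i, M.jmpDl τ (M.compL i ψ) * M.jmpDl τ (M.compL i v))) := by
  simp only [formN, meshInt, cellL_apply, segL, LinearMap.coe_mk, AddHom.coe_mk, ev_sum, ev_mul,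
    ev_mnPr, ev_jmpPr, ev_mnDl, ev_jmpDl, ev_compL]
  rfl

/-- The forms as bilinear maps. -/
def tenInnerL : M.Ten →ₗ[ℝ] M.Ten →ₗ[ℝ] ℝ := LinearMap.mk₂ ℝ M.tenInner
  (fun _ _ _ => by
    simp only [tenInner_eq, map_add, Pi.add_apply, add_mul, Finset.sum_add_distrib])
  (fun _ _ _ => by
    simp only [tenInner_eq, map_smul, Pi.smul_apply, smul_mul_assoc, ← Finset.smul_sum])
  (fun _ _ _ => by
    simp only [tenInner_eq, map_add, Pi.add_apply, mul_add, Finset.sum_add_distrib])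
  (fun _ _ _ => by
    simp only [tenInner_eq, map_smul, Pi.smul_apply, mul_smul_comm, ← Finset.smul_sum])

def formBL : M.Ten →ₗ[ℝ] M.Vec →ₗ[ℝ] ℝ := LinearMap.mk₂ ℝ M.formB
  (fun _ _ _ => by
    simp only [formB_eq, map_add, Pi.add_apply, add_mul, Finset.sum_add_distrib]; ring)
  (fun _ _ _ => by
    simp only [formB_eq, map_smul, Pi.smul_apply, smul_mul_assoc, ← Finset.smul_sum, smul_sub])
  (fun _ _ _ => by
    simp only [formB_eq, map_add, Pi.add_apply, mul_add, Finset.sum_add_distrib]; ring)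
  (fun _ _ _ => by
    simp only [formB_eq, map_smul, Pi.smul_apply, mul_smul_comm, ← Finset.smul_sum, smul_sub])

def formbStarL : M.Sca →ₗ[ℝ] M.Vec →ₗ[ℝ] ℝ := LinearMap.mk₂ ℝ M.formbStar
  (fun _ _ _ => by
    simp only [formbStar_eq, map_add, Pi.add_apply, add_mul, Finset.sum_add_distrib]; ring)
  (fun _ _ _ => by
    simp only [formbStar_eq, map_smul, Pi.smul_apply, smul_mul_assoc, ← Finset.smul_sum, smul_add,
      smul_neg])
  (fun _ _ _ => by
    simp only [formbStar_eq, map_add, Pi.add_apply, mul_add, Finset.sum_add_distrib]; ring)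
  (fun _ _ _ => by
    simp only [formbStar_eq, map_smul, Pi.smul_apply, mul_smul_comm, ← Finset.smul_sum, smul_add,
      smul_neg])

def formNL (w : M.Vec) : M.Vec →ₗ[ℝ] M.Vec →ₗ[ℝ] ℝ := LinearMap.mk₂ ℝ (M.formN w)
  (fun _ _ _ => by
    simp only [formN_eq, map_add, Pi.add_apply, add_mul, Finset.sum_add_distrib]; ring)
  (fun _ _ _ => by
    simp only [formN_eq, map_smul, Pi.smul_apply, smul_mul_assoc, ← Finset.smul_sum, smul_add,
      smul_neg])
  (fun _ _ _ => by
    simp only [formN_eq, map_add, Pi.add_apply, mul_add, Finset.sum_add_distrib]; ring)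
  (fun _ _ _ => by
    simp only [formN_eq, map_smul, Pi.smul_apply, mul_smul_comm, ← Finset.smul_sum, smul_add,
      smul_neg])

/-! ### The discrete spaces as submodules -/

def HSub (k : ℕ) : Submodule ℝ M.Ten where
  carrier := M.HSpace k
  zero_mem' := by
    refine ⟨fun _ _ _ => by simp, fun τ _ y _ i => ?_, fun τ y _ => ?_⟩
    · rw [← ev_appL, ← ev_jmpPr, map_zero, map_zero, ev_zero]
    · rw [← ev_quadL, ← ev_jmpDl, map_zero, map_zero, ev_zero]
  add_mem' := by
    rintro G H ⟨g1, g2, g3⟩ ⟨h1, h2, h3⟩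
    refine ⟨fun τ i j => (MvPolynomial.totalDegree_add _ _).trans (max_le (g1 τ i j) (h1 τ i j)),
      fun τ hτ y hy i => ?_, fun τ y hy => ?_⟩
    · have a := g2 τ hτ y hy i
      have b := h2 τ hτ y hy i
      rw [← ev_appL, ← ev_jmpPr] at a b ⊢
      rw [map_add, map_add, ev_add, a, b, add_zero]
    · have a := g3 τ y hy
      have b := h3 τ y hy
      rw [← ev_quadL, ← ev_jmpDl] at a b ⊢
      rw [map_add, map_add, ev_add, a, b, add_zero]
  smul_mem' := by
    rintro r H ⟨h1, h2, h3⟩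
    refine ⟨fun τ i j => (MvPolynomial.totalDegree_smul_le _ _).trans (h1 τ i j),
      fun τ hτ y hy i => ?_, fun τ y hy => ?_⟩
    · have b := h2 τ hτ y hy i
      rw [← ev_appL, ← ev_jmpPr] at b ⊢
      rw [map_smul, map_smul, ev_smul, b, mul_zero]
    · have b := h3 τ y hy
      rw [← ev_quadL, ← ev_jmpDl] at b ⊢
      rw [map_smul, map_smul, ev_smul, b, mul_zero]

def VSub (k : ℕ) : Submodule ℝ M.Vec where
  carrier := M.VSpace k
  zero_mem' := by
    refine ⟨fun _ _ => by simp, fun τ y _ => ?_⟩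
    rw [← ev_dotL, ← ev_jmpDl, map_zero, map_zero, ev_zero]
  add_mem' := by
    rintro G H ⟨g1, g3⟩ ⟨h1, h3⟩
    refine ⟨fun τ i => (MvPolynomial.totalDegree_add _ _).trans (max_le (g1 τ i) (h1 τ i)),
      fun τ y hy => ?_⟩
    have a := g3 τ y hy
    have b := h3 τ y hy
    rw [← ev_dotL, ← ev_jmpDl] at a b ⊢
    rw [map_add, map_add, ev_add, a, b, add_zero]
  smul_mem' := by
    rintro r H ⟨h1, h3⟩
    refine ⟨fun τ i => (MvPolynomial.totalDegree_smul_le _ _).trans (h1 τ i), fun τ y hy => ?_⟩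
    have b := h3 τ y hy
    rw [← ev_dotL, ← ev_jmpDl] at b ⊢
    rw [map_smul, map_smul, ev_smul, b, mul_zero]

def QSub (k : ℕ) : Submodule ℝ M.Sca where
  carrier := M.QSpace k
  zero_mem' := by
    refine ⟨fun _ => by simp, fun τ _ y _ => ?_⟩
    change M.jumpPr (fun σ y => ev y ((0 : M.Sca) σ)) τ y = 0
    rw [← ev_jmpPr, map_zero, ev_zero]
  add_mem' := by
    rintro G H ⟨g1, g3⟩ ⟨h1, h3⟩
    refine ⟨fun τ => (MvPolynomial.totalDegree_add _ _).trans (max_le (g1 τ) (h1 τ)),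
      fun τ hτ y hy => ?_⟩
    have a : M.jumpPr (fun σ y => ev y (G σ)) τ y = 0 := g3 τ hτ y hy
    have b : M.jumpPr (fun σ y => ev y (H σ)) τ y = 0 := h3 τ hτ y hy
    change M.jumpPr (fun σ y => ev y ((G + H) σ)) τ y = 0
    rw [← ev_jmpPr] at a b ⊢
    rw [map_add, ev_add, a, b, add_zero]
  smul_mem' := by
    rintro r H ⟨h1, h3⟩
    refine ⟨fun τ => (MvPolynomial.totalDegree_smul_le _ _).trans (h1 τ), fun τ hτ y hy => ?_⟩
    have b : M.jumpPr (fun σ y => ev y (H σ)) τ y = 0 := h3 τ hτ y hy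
    change M.jumpPr (fun σ y => ev y ((r • H) σ)) τ y = 0
    rw [← ev_jmpPr] at b ⊢
    rw [map_smul, ev_smul, b, mul_zero]

/-- The mean value functional on piecewise polynomials. -/
def meshIntL : M.Sca →ₗ[ℝ] ℝ := ∑ τ, M.cellL τ ∘ₗ M.atL τ

lemma meshIntL_apply (q : M.Sca) : M.meshIntL q = M.meshInt q.val := by
  simp [meshIntL, meshInt, cellL_apply, Sca.val]

def QSubZero (k : ℕ) : Submodule ℝ M.Sca := M.QSub k ⊓ LinearMap.ker M.meshIntL

lemma mem_QSubZero {k : ℕ} {q : M.Sca} : q ∈ M.QSubZero k ↔ q ∈ M.QSpaceZero k := by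
  rw [QSubZero, Submodule.mem_inf, LinearMap.mem_ker, meshIntL_apply]; rfl

instance (k : ℕ) : Module.Finite ℝ (M.HSub k) := by
  let P := MvPolynomial.restrictTotalDegree (Fin 2) ℝ k
  let f : M.HSub k →ₗ[ℝ] (Fin M.N → Fin 2 → Fin 2 → P) :=
    { toFun := fun H τ i j => ⟨(H : M.Ten) τ i j,
        (MvPolynomial.mem_restrictTotalDegree _ _ _).2 (H.2.1 τ i j)⟩
      map_add' := fun _ _ => rfl
      map_smul' := fun _ _ => rfl }
  refine Module.Finite.of_injective f fun G H h => Subtype.ext ?_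
  ext1 τ; ext1 i; ext1 j
  exact congrArg Subtype.val (congrFun (congrFun (congrFun h τ) i) j)

instance (k : ℕ) : Module.Finite ℝ (M.VSub k) := by
  let P := MvPolynomial.restrictTotalDegree (Fin 2) ℝ k
  let f : M.VSub k →ₗ[ℝ] (Fin M.N → Fin 2 → P) :=
    { toFun := fun H τ i => ⟨(H : M.Vec) τ i,
        (MvPolynomial.mem_restrictTotalDegree _ _ _).2 (H.2.1 τ i)⟩
      map_add' := fun _ _ => rfl
      map_smul' := fun _ _ => rfl }
  refine Module.Finite.of_injective f fun G H h => Subtype.ext ?_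
  ext1 τ; ext1 i
  exact congrArg Subtype.val (congrFun (congrFun h τ) i)

end StaggeredMesh
end
end StaggeredDG

namespace StaggeredDG
noncomputable section

lemma utan_sq {a b : Pt} (h : a ≠ b) : utan a b 0 ^ 2 + utan a b 1 ^ 2 = 1 := by
  have hd : dist a b ≠ 0 := dist_ne_zero.2 h
  have h2 : dist a b ^ 2 = (b 0 - a 0) ^ 2 + (b 1 - a 1) ^ 2 := by
    rw [EuclideanSpace.dist_eq, Real.sq_sqrt (by positivity)]
    simp [Real.dist_eq]; ring
  simp only [utan, PiLp.smul_apply, PiLp.sub_apply, smul_eq_mul, mul_pow]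
  rw [← mul_add, ← h2]; field_simp

@[simp] lemma unor_zero (a b : Pt) : unor a b 0 = utan a b 1 := rfl
@[simp] lemma unor_one (a b : Pt) : unor a b 1 = -utan a b 0 := rfl

namespace StaggeredMesh

variable {Ω : Set Pt} (M : StaggeredMesh Ω)

/-! ### Continuity of the integrands -/

lemma continuous_grad (v : M.Vec) (i j : Fin 2) (τ : Fin M.N) : Continuous (v.grad i j τ) := by
  unfold Vec.grad; fun_prop
lemma continuous_div (v : M.Vec) (τ : Fin M.N) : Continuous (v.div τ) := by
  unfold Vec.div Vec.grad; fun_prop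
lemma continuous_tcomp (H : M.Ten) (i j : Fin 2) (τ : Fin M.N) : Continuous (H.comp i j τ) := by
  unfold Ten.comp; fun_prop
lemma continuous_quad (H : M.Ten) (b a : Pt) (τ : Fin M.N) : Continuous (H.quad b a τ) := by
  unfold Ten.quad Ten.app; fun_prop
lemma continuous_tdiv (H : M.Ten) (i : Fin 2) (τ : Fin M.N) : Continuous (H.div i τ) := by
  unfold Ten.div; fun_prop
lemma continuous_val (q : M.Sca) (τ : Fin M.N) : Continuous (q.val τ) := by
  unfold Sca.val; fun_prop
lemma continuous_sgrad (q : M.Sca) (j : Fin 2) (τ : Fin M.N) : Continuous (q.grad j τ) := by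
  unfold Sca.grad; fun_prop

lemma meshInt_add {F G : Fin M.N → Pt → ℝ} (hF : ∀ τ, Continuous (F τ))
    (hG : ∀ τ, Continuous (G τ)) :
    M.meshInt (fun τ y => F τ y + G τ y) = M.meshInt F + M.meshInt G := by
  simp only [meshInt]
  rw [← Finset.sum_add_distrib]
  exact Finset.sum_congr rfl fun τ _ => integral_add
    ((hF τ).continuousOn.integrableOn_compact (M.isCompact_cell τ))
    ((hG τ).continuousOn.integrableOn_compact (M.isCompact_cell τ))

/-! ### Discrete adjointness -/

lemma formBStar_eq_neg {k : ℕ} {H : M.Ten} {v : M.Vec} (hH : H ∈ M.HSpace k)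
    (hv : v ∈ M.VSpace k) : M.formBStar v H = -M.formB H v := by
  let X : M.Vec := fun τ j => ∑ i, H τ i j * v τ i
  have hX := M.meshInt_div X
  have cdiv := M.continuous_tdiv H
  have ccomp := M.continuous_comp v
  have ctc := M.continuous_tcomp H
  have cgr := M.continuous_grad v
  have e1 : M.meshInt X.div = (M.meshInt fun τ y => ∑ i, v.comp i τ y * H.div i τ y) +
      M.meshInt fun τ y => ∑ i, ∑ j, H.comp i j τ y * v.grad i j τ y := by
    rw [← M.meshInt_add (fun τ => by fun_prop) (fun τ => by fun_prop)]
    congr 1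
    ext τ y
    simp [X, Vec.div, Vec.grad, Ten.div, Ten.comp, Vec.comp, Fin.sum_univ_two]
    ring
  have e2 : ∀ τ ∈ M.plus, M.intPr τ (M.jumpPr (X.dot (M.norPr τ)) τ) = M.intPr τ fun y =>
      ∑ i, M.avgPr (H.app (M.norPr τ) i) τ y * M.jumpPr (v.comp i) τ y := by
    intro τ _
    refine edgeInt_congr fun y hy => ?_
    have h2 := hH.2.1 τ
    unfold jumpPr avgPr at *
    rcases h : M.nbr τ with _ | σ
    · simp [X, Vec.dot, Ten.app, Vec.comp, Fin.sum_univ_two]; ring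
    · have h0 := h2 (by rw [h]; rfl) y hy 0
      have h1 := h2 (by rw [h]; rfl) y hy 1
      simp [h, X, Vec.dot, Ten.app, Vec.comp, Fin.sum_univ_two] at h0 h1 ⊢
      linear_combination (ev y (v τ 0) + ev y (v σ 0)) / 2 * h0 +
        (ev y (v τ 1) + ev y (v σ 1)) / 2 * h1
  have e3 : ∀ τ, M.intDl τ (M.jumpDl (X.dot (M.norDl τ)) τ) = (M.intDl τ fun y =>
      M.avgDl (v.dot (M.norDl τ)) τ y * M.jumpDl (H.quad (M.norDl τ) (M.norDl τ)) τ y) +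
      M.intDl τ fun y => M.avgDl (H.quad (M.tanDl τ) (M.norDl τ)) τ y *
        M.jumpDl (v.dot (M.tanDl τ)) τ y := by
    intro τ
    unfold intDl
    refine Eq.trans ?_ (edgeInt_add _ _
      ((M.continuous_avgDl (M.continuous_dot v _) τ).mul
        (M.continuous_jumpDl (M.continuous_quad H _ _) τ))
      ((M.continuous_avgDl (M.continuous_quad H _ _) τ).mul
        (M.continuous_jumpDl (M.continuous_dot v _) τ)))
    refine edgeInt_congr fun y hy => ?_
    have h1 := hH.2.2 τ y hy
    have h2 := hv.2 τ y hy
    have h3 := utan_sq (M.tgt_ne_ctr τ)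
    have key : ∀ t0 t1 p q p' q' a b c d a' b' c' d' : ℝ, t0 ^ 2 + t1 ^ 2 = 1 →
        (t0 * (a * t1 + b * -t0) + t1 * (c * t1 + d * -t0)) -
          (t0 * (a' * t1 + b' * -t0) + t1 * (c' * t1 + d' * -t0)) = 0 →
        (p * t1 + q * -t0) - (p' * t1 + q' * -t0) = 0 →
        ((a * p + c * q) * t1 + (b * p + d * q) * -t0) -
          ((a' * p' + c' * q') * t1 + (b' * p' + d' * q') * -t0) =
        ((p * t1 + q * -t0) + (p' * t1 + q' * -t0)) / 2 *
          ((t1 * (a * t1 + b * -t0) + -t0 * (c * t1 + d * -t0)) -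
          (t1 * (a' * t1 + b' * -t0) + -t0 * (c' * t1 + d' * -t0))) +
        ((t0 * (a * t1 + b * -t0) + t1 * (c * t1 + d * -t0)) +
          (t0 * (a' * t1 + b' * -t0) + t1 * (c' * t1 + d' * -t0))) / 2 *
          ((p * t0 + q * t1) - (p' * t0 + q' * t1)) := by
      intro t0 t1 p q p' q' a b c d a' b' c' d' ht hq hn
      linear_combination (-(((a * p + c * q) * t1 + (b * p + d * q) * -t0) -
          ((a' * p' + c' * q') * t1 + (b' * p' + d' * q') * -t0))) * ht +
        ((p * t0 + q * t1) + (p' * t0 + q' * t1)) / 2 * hq +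
        ((t1 * (a * t1 + b * -t0) + -t0 * (c * t1 + d * -t0)) +
          (t1 * (a' * t1 + b' * -t0) + -t0 * (c' * t1 + d' * -t0))) / 2 * hn
    simp only [jumpDl, avgDl, Ten.quad, Ten.app, Vec.dot, norDl, tanDl, unor_zero, unor_one,
      Fin.sum_univ_two, X, ev_add, ev_mul] at h1 h2 ⊢
    exact key _ _ _ _ _ _ _ _ _ _ _ _ _ _ h3 h1 h2
  rw [Finset.sum_congr rfl e2, Finset.sum_congr rfl (fun τ _ => e3 τ), Finset.sum_add_distrib,
    e1] at hX
  unfold formBStar formB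
  linarith

lemma formb_eq_neg {k : ℕ} {q : M.Sca} {v : M.Vec} (hq : q ∈ M.QSpace k)
    (hv : v ∈ M.VSpace k) : M.formb v q = -M.formbStar q v := by
  let X : M.Vec := fun τ j => q τ * v τ j
  have hX := M.meshInt_div X
  have cval := M.continuous_val q
  have ccomp := M.continuous_comp v
  have cdiv := M.continuous_div v
  have cgr := M.continuous_sgrad q
  have e1 : M.meshInt X.div = (M.meshInt fun τ y => ∑ i, v.comp i τ y * q.grad i τ y) +
      M.meshInt fun τ y => q.val τ y * v.div τ y := by
    rw [← M.meshInt_add (fun τ => by fun_prop) (fun τ => by fun_prop)]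
    congr 1
    ext τ y
    simp [X, Vec.div, Vec.grad, Sca.grad, Sca.val, Vec.comp, Fin.sum_univ_two]
    ring
  have e2 : ∀ τ ∈ M.plus, M.intPr τ (M.jumpPr (X.dot (M.norPr τ)) τ) = M.intPr τ fun y =>
      M.avgPr q.val τ y * M.jumpPr (v.dot (M.norPr τ)) τ y := by
    intro τ _
    refine edgeInt_congr fun y hy => ?_
    have h2 := hq.2 τ
    unfold jumpPr avgPr at *
    rcases h : M.nbr τ with _ | σ
    · simp [X, Vec.dot, Sca.val, Fin.sum_univ_two]; ring
    · have h0 := h2 (by rw [h]; rfl) y hy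
      simp [h, X, Vec.dot, Sca.val, Fin.sum_univ_two] at h0 ⊢
      linear_combination (ev y (v τ 0) * M.norPr τ 0 + ev y (v τ 1) * M.norPr τ 1 +
        ev y (v σ 0) * M.norPr τ 0 + ev y (v σ 1) * M.norPr τ 1) / 2 * h0
  have e3 : ∀ τ, M.intDl τ (M.jumpDl (X.dot (M.norDl τ)) τ) = M.intDl τ fun y =>
      M.avgDl (v.dot (M.norDl τ)) τ y * M.jumpDl q.val τ y := by
    intro τ
    refine edgeInt_congr fun y hy => ?_
    have h2 := hv.2 τ y hy
    simp only [jumpDl, avgDl, Vec.dot, Sca.val, Fin.sum_univ_two, X, ev_mul] at h2 ⊢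
    linear_combination (ev y (q τ) + ev y (q (M.next τ))) / 2 * h2
  rw [Finset.sum_congr rfl e2, Finset.sum_congr rfl (fun τ _ => e3 τ), e1] at hX
  unfold formb formbStar
  linarith

/-! ### Positivity of the convective form -/

lemma formN_nonneg {k : ℕ} {z : M.Vec} (hz : z ∈ M.VSpace k) (hdiv : ∀ τ y, z.div τ y = 0)
    (hjump : ∀ τ, (M.nbr τ).isSome → ∀ y ∈ segment ℝ (M.src τ) (M.tgt τ),
      M.jumpPr (z.dot (M.norPr τ)) τ y = 0) (w : M.Vec) : 0 ≤ M.formN z w w := by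
  let X : M.Vec := fun τ j => MvPolynomial.C (1 / 2) * (z τ j * (w τ 0 * w τ 0 + w τ 1 * w τ 1))
  have hX := M.meshInt_div X
  have e1 : M.meshInt X.div = M.meshInt fun τ y =>
      ∑ i, ∑ j, w.comp i τ y * z.comp j τ y * w.grad i j τ y := by
    congr 1
    ext τ y
    have := hdiv τ y
    simp [X, Vec.div, Vec.grad, Vec.comp, Fin.sum_univ_two] at this ⊢
    linear_combination (ev y (w τ 0) ^ 2 + ev y (w τ 1) ^ 2) / 2 * this
  have cw := M.continuous_comp w
  have cz := fun a => M.continuous_avgPr (M.continuous_dot z a)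
  have cz' := fun a => M.continuous_avgDl (M.continuous_dot z a)
  have cj := fun i => M.continuous_jumpPr (cw i)
  have cj' := fun i => M.continuous_jumpDl (cw i)
  have ca := fun i => M.continuous_avgPr (cw i)
  have ca' := fun i => M.continuous_avgDl (cw i)
  have cX := fun a => M.continuous_jumpPr (M.continuous_dot X a)
  have e3 : ∀ τ, M.intDl τ (M.jumpDl (X.dot (M.norDl τ)) τ) = M.intDl τ fun y =>
      M.avgDl (z.dot (M.norDl τ)) τ y * ∑ i, M.avgDl (w.comp i) τ y * M.jumpDl (w.comp i) τ y := by
    intro τ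
    refine edgeInt_congr fun y hy => ?_
    have h2 := hz.2 τ y hy
    simp [jumpDl, avgDl, Vec.dot, Vec.comp, Fin.sum_univ_two, X] at h2 ⊢
    linear_combination (ev y (w τ 0) ^ 2 + ev y (w τ 1) ^ 2 + ev y (w (M.next τ) 0) ^ 2 +
      ev y (w (M.next τ) 1) ^ 2) / 4 * h2
  have e4 : ∑ τ ∈ M.plusInt, (M.intPr τ fun y => M.avgPr (z.dot (M.norPr τ)) τ y *
      ∑ i, M.avgPr (w.comp i) τ y * M.jumpPr (w.comp i) τ y) =
      ∑ τ ∈ M.plus, if (M.nbr τ).isSome then (M.intPr τ fun y => M.avgPr (z.dot (M.norPr τ)) τ y *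
      ∑ i, M.avgPr (w.comp i) τ y * M.jumpPr (w.comp i) τ y) else 0 := by
    rw [plusInt, Finset.sum_filter]
  have e5 : 0 ≤ ∑ τ, M.intDl τ fun y => |M.avgDl (z.dot (M.norDl τ)) τ y| *
        ∑ i, M.jumpDl (w.comp i) τ y * M.jumpDl (w.comp i) τ y :=
    Finset.sum_nonneg fun τ _ => edgeInt_nonneg fun y => mul_nonneg (abs_nonneg _)
      (Finset.sum_nonneg fun i _ => mul_self_nonneg _)
  have e6 : ∑ τ ∈ M.plus, M.intPr τ (M.jumpPr (X.dot (M.norPr τ)) τ) ≤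
      (∑ τ ∈ M.plusInt, M.intPr τ fun y => M.avgPr (z.dot (M.norPr τ)) τ y *
        ∑ i, M.avgPr (w.comp i) τ y * M.jumpPr (w.comp i) τ y) +
      ∑ τ ∈ M.plus, M.intPr τ fun y => |M.avgPr (z.dot (M.norPr τ)) τ y| *
        ∑ i, M.jumpPr (w.comp i) τ y * M.jumpPr (w.comp i) τ y := by
    rw [e4, ← Finset.sum_add_distrib]
    refine Finset.sum_le_sum fun τ _ => ?_
    by_cases h : (M.nbr τ).isSome
    · rw [if_pos h, intPr, intPr, intPr, ← edgeInt_add _ _ (by fun_prop) (by fun_prop)]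
      refine edgeInt_mono (by fun_prop) (by fun_prop) fun y hy => ?_
      have h2 := hjump τ h y hy
      have h3 : 0 ≤ |M.avgPr (z.dot (M.norPr τ)) τ y| *
        ∑ i, M.jumpPr (w.comp i) τ y * M.jumpPr (w.comp i) τ y := mul_nonneg (abs_nonneg _)
          (Finset.sum_nonneg fun i _ => mul_self_nonneg _)
      refine le_trans (le_of_eq ?_) (le_add_of_nonneg_right h3)
      obtain ⟨σ, hσ⟩ := Option.isSome_iff_exists.1 h
      simp [jumpPr, avgPr, hσ, Vec.dot, Vec.comp, Fin.sum_univ_two, X] at h2 ⊢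
      linear_combination (ev y (w τ 0) ^ 2 + ev y (w τ 1) ^ 2 + ev y (w σ 0) ^ 2 +
        ev y (w σ 1) ^ 2) / 4 * h2
    · rw [if_neg h, zero_add]
      refine edgeInt_mono (by fun_prop) (by fun_prop) fun y hy => ?_
      have hσ : M.nbr τ = none := by simpa using h
      have h3 : 0 ≤ ∑ i, M.jumpPr (w.comp i) τ y * M.jumpPr (w.comp i) τ y :=
        Finset.sum_nonneg fun i _ => mul_self_nonneg _
      have h4 := mul_le_mul_of_nonneg_right (le_abs_self (M.avgPr (z.dot (M.norPr τ)) τ y)) h3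
      have h5 := mul_nonneg (abs_nonneg (M.avgPr (z.dot (M.norPr τ)) τ y)) h3
      have h6 : M.jumpPr (X.dot (M.norPr τ)) τ y = 1 / 2 * (M.avgPr (z.dot (M.norPr τ)) τ y *
          ∑ i, M.jumpPr (w.comp i) τ y * M.jumpPr (w.comp i) τ y) := by
        simp [jumpPr, avgPr, hσ, Vec.dot, Vec.comp, Fin.sum_univ_two, X]; ring
      rw [h6]; linarith
  rw [Finset.sum_congr rfl (fun τ _ => e3 τ), e1] at hX
  unfold formN
  linarith

end StaggeredMesh
end
end StaggeredDG

namespace StaggeredDG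
noncomputable section

lemma cross_unor {a b : Pt} (h : a ≠ b) (r : ℝ) (c : Pt) :
    cross (b - a) (c + r • unor a b - a) = cross (b - a) (c - a) - r * dist a b := by
  have h2 := utan_sq h
  have e0 := dist_mul_unor_one a b
  have e1 := dist_mul_unor_zero a b
  simp only [unor_zero, unor_one] at e0 e1
  simp only [cross, PiLp.sub_apply, PiLp.add_apply, PiLp.smul_apply, unor_zero, unor_one,
    smul_eq_mul] at *
  linear_combination r * dist a b * (-h2) - r * utan a b 0 * e0 + r * utan a b 1 * e1

lemma edge_young {a b : Pt} (hab : a ≠ b) {R A n : ℝ} (hA : 0 < A) (hn : |n| ≤ 1)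
    (hR : ∀ y ∈ segment ℝ a b, |y 0| ≤ R) (p q : Fin 2 → Poly) :
    edgeInt a b (fun y => y 0 * n * (∑ i, (ev y (p i) ^ 2 - ev y (q i) ^ 2))) ≤
      A * ((dist a b)⁻¹ * edgeInt a b fun y => ∑ i, (ev y (p i) - ev y (q i)) ^ 2) +
      R ^ 2 / (2 * A) * ((dist a b * edgeInt a b fun y => ∑ i, ev y (p i) ^ 2) +
        dist a b * edgeInt a b fun y => ∑ i, ev y (q i) ^ 2) := by
  have hh : 0 < dist a b := dist_pos.2 hab
  set h := dist a b
  have e : A * (h⁻¹ * edgeInt a b fun y => ∑ i, (ev y (p i) - ev y (q i)) ^ 2) +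
      R ^ 2 / (2 * A) * ((h * edgeInt a b fun y => ∑ i, ev y (p i) ^ 2) +
        h * edgeInt a b fun y => ∑ i, ev y (q i) ^ 2) =
      edgeInt a b fun y => (A * h⁻¹) * (∑ i, (ev y (p i) - ev y (q i)) ^ 2) +
        (R ^ 2 / (2 * A) * h) * ((∑ i, ev y (p i) ^ 2) + ∑ i, ev y (q i) ^ 2) := by
    rw [edgeInt_add _ _ (by fun_prop) (by fun_prop), edgeInt_const_mul, edgeInt_const_mul,
      edgeInt_add _ _ (by fun_prop) (by fun_prop)]
    ring
  rw [e]
  refine edgeInt_mono (by fun_prop) (by fun_prop) fun y hy => ?_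
  have hc : (y 0 * n) ^ 2 ≤ R ^ 2 := by
    have h1 := hR y hy
    have h2 : |y 0 * n| ≤ R := by
      rw [abs_mul]
      exact (mul_le_of_le_one_right (abs_nonneg _) hn).trans h1
    exact sq_le_sq' (abs_le.1 h2).1 (abs_le.1 h2).2
  have young : ∀ u v : ℝ, y 0 * n * (u ^ 2 - v ^ 2) ≤
      A * h⁻¹ * (u - v) ^ 2 + R ^ 2 / (2 * A) * h * (u ^ 2 + v ^ 2) := by
    intro u v
    have h1 : 0 ≤ A * h⁻¹ * ((u - v) - y 0 * n * h / (2 * A) * (u + v)) ^ 2 := by positivity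
    have h2 : A * h⁻¹ * ((u - v) - y 0 * n * h / (2 * A) * (u + v)) ^ 2 =
        A * h⁻¹ * (u - v) ^ 2 - y 0 * n * (u ^ 2 - v ^ 2) +
          (y 0 * n) ^ 2 / (4 * A) * h * (u + v) ^ 2 := by
      field_simp; ring
    have h3 : (y 0 * n) ^ 2 / (4 * A) * h * (u + v) ^ 2 ≤
        R ^ 2 / (4 * A) * h * (2 * (u ^ 2 + v ^ 2)) := by
      have : (u + v) ^ 2 ≤ 2 * (u ^ 2 + v ^ 2) := by nlinarith [sq_nonneg (u - v)]
      gcongr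
    have h4 : R ^ 2 / (4 * A) * h * (2 * (u ^ 2 + v ^ 2)) =
        R ^ 2 / (2 * A) * h * (u ^ 2 + v ^ 2) := by
      field_simp; ring
    linarith
  simp only [Fin.sum_univ_two]
  have y0 := young (ev y (p 0)) (ev y (q 0))
  have y1 := young (ev y (p 1)) (ev y (q 1))
  linarith

namespace StaggeredMesh

variable {Ω : Set Pt} (M : StaggeredMesh Ω)

/-! ### Mesh regularity -/

lemma cell_subset_primal (τ : Fin M.N) : M.cell τ ⊆ M.primal τ :=
  Set.subset_biUnion_of_mem (u := fun σ => M.cell σ) (show τ ∈ {σ | M.ctr σ = M.ctr τ} from rfl)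

lemma isBounded_primal (τ : Fin M.N) : Bornology.IsBounded (M.primal τ) :=
  (Bornology.isBounded_biUnion (Set.toFinite _)).2 fun σ _ => (M.isCompact_cell σ).isBounded

lemma ctr_mem_cell (τ : Fin M.N) : M.ctr τ ∈ M.cell τ := subset_convexHull _ _ (by simp)
lemma src_mem_cell (τ : Fin M.N) : M.src τ ∈ M.cell τ := subset_convexHull _ _ (by simp)
lemma tgt_mem_cell (τ : Fin M.N) : M.tgt τ ∈ M.cell τ := subset_convexHull _ _ (by simp)

lemma dist_le_diam {τ : Fin M.N} {x y : Pt} (hx : x ∈ M.cell τ) (hy : y ∈ M.cell τ) :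
    dist x y ≤ Metric.diam (M.primal τ) :=
  Metric.dist_le_diam_of_mem (M.isBounded_primal τ) (M.cell_subset_primal τ hx)
    (M.cell_subset_primal τ hy)

lemma lenPr_pos (τ : Fin M.N) : 0 < M.lenPr τ := dist_pos.2 (M.src_ne_tgt τ)
lemma lenDl_pos (τ : Fin M.N) : 0 < M.lenDl τ := dist_pos.2 (M.tgt_ne_ctr τ)

lemma diam_primal_pos (τ : Fin M.N) : 0 < Metric.diam (M.primal τ) :=
  (M.lenPr_pos τ).trans_le (M.dist_le_diam (M.src_mem_cell τ) (M.tgt_mem_cell τ))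

/-- Points with respect to which the primal element is star-shaped lie to the left of its edges. -/
lemma cross_nonneg_of_starConvex {τ : Fin M.N} {y : Pt} (hy : StarConvex ℝ y (M.primal τ)) :
    0 ≤ cross (M.tgt τ - M.src τ) (y - M.src τ) := by
  by_contra! hneg
  have hD := M.ccw τ
  set m := AffineMap.lineMap (k := ℝ) (M.src τ) (M.tgt τ) (1 / 2 : ℝ) with hm
  have hmτ : m ∈ M.cell τ := by
    refine M.convex_cell τ |>.segment_subset (M.src_mem_cell τ) (M.tgt_mem_cell τ) ?_
    rw [segment_eq_image_lineMap]
    exact ⟨1 / 2, by norm_num, rfl⟩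
  let K : Set Pt := ⋃ σ ∈ {σ | M.ctr σ = M.ctr τ ∧ σ ≠ τ}, M.cell σ
  have hK : IsClosed K := (Set.toFinite _).isClosed_biUnion fun σ _ => (M.isCompact_cell σ).isClosed
  let X : ℝ → Pt := fun ε => AffineMap.lineMap m y ε
  have hX : Continuous X := continuous_lineMap_pt _ _
  have hXK : ∀ ε ∈ Set.Ioo (0 : ℝ) 1, X ε ∈ K := by
    intro ε hε
    have h1 : X ε ∈ M.primal τ := by
      refine starConvex_iff_segment_subset.1 hy (M.cell_subset_primal τ hmτ) ?_
      rw [segment_symm, segment_eq_image_lineMap]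
      exact ⟨ε, ⟨hε.1.le, hε.2.le⟩, rfl⟩
    have h2 : X ε ∉ M.cell τ := by
      intro h
      rw [M.cell_eq_src, mem_hull_iff (M.ccw_src τ)] at h
      have : cross (M.tgt τ - M.src τ) (X ε - M.src τ) =
          ε * cross (M.tgt τ - M.src τ) (y - M.src τ) := by
        simp [X, hm, AffineMap.lineMap_apply, cross]; ring
      nlinarith [h.1, hε.1]
    simp only [primal, Set.mem_iUnion] at h1
    obtain ⟨σ, hσ, hx⟩ := h1
    refine Set.mem_biUnion (show σ ∈ {σ | M.ctr σ = M.ctr τ ∧ σ ≠ τ} from ⟨hσ, ?_⟩) hx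
    rintro rfl
    exact h2 hx
  have hmK : m ∈ K := by
    have h0 : X 0 = m := by simp [X]
    rw [← h0]
    refine hK.mem_of_tendsto ((hX.tendsto 0).mono_left nhdsWithin_le_nhds)
      (Filter.mem_of_superset (Ioo_mem_nhdsGT (zero_lt_one' ℝ)) hXK)
  simp only [K, Set.mem_iUnion] at hmK
  obtain ⟨σ, ⟨hc, hne⟩, hmσ⟩ := hmK
  rcases M.inter_cell_subset hne with h1 | h1 | h1
  · have := h1.2 m ⟨hmσ, hmτ⟩
    simp [hm, AffineMap.lineMap_apply, cross] at this hD
    linarith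
  · exact h1.1 (by simp [verts, hc])
  · have := h1.2 m ⟨hmσ, hmτ⟩
    simp [hm, AffineMap.lineMap_apply, cross] at this hD
    linarith

variable {M} in
lemma IsRegular.area_ge {ρE ρB : ℝ} (hρB : 0 < ρB) (hM : M.IsRegular ρE ρB)
    (τ : Fin M.N) : ρE * ρB * Metric.diam (M.primal τ) ^ 2 ≤
      cross (M.src τ - M.ctr τ) (M.tgt τ - M.ctr τ) := by
  obtain ⟨h1, h2⟩ := hM τ
  have hd := M.diam_primal_pos τ
  set d := Metric.diam (M.primal τ)
  have hl : 0 < dist (M.src τ) (M.tgt τ) := M.lenPr_pos τ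
  rw [← cross_cyc]
  set D := cross (M.tgt τ - M.src τ) (M.ctr τ - M.src τ) with hD
  have key : ρB * d * dist (M.src τ) (M.tgt τ) ≤ D := by
    by_contra! hlt
    rw [← div_lt_iff₀ hl] at hlt
    obtain ⟨r, hr1, hr2⟩ := exists_between hlt
    have hDp : 0 < D := M.ccw_src τ
    have hr0 : 0 < r := lt_trans (by positivity) hr1
    have := M.cross_nonneg_of_starConvex (h2 (M.ctr τ + r • unor (M.src τ) (M.tgt τ)) (by
      rw [Metric.mem_ball, dist_eq_norm, add_sub_cancel_left, norm_smul, EuclideanSpace.norm_eq]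
      simp only [Fin.sum_univ_two, unor_zero, unor_one, Real.norm_eq_abs, sq_abs]
      rw [neg_sq, add_comm (_ ^ 2), utan_sq (M.src_ne_tgt τ), Real.sqrt_one, abs_of_pos hr0, mul_one]
      exact hr2))
    rw [cross_unor (M.src_ne_tgt τ)] at this
    rw [div_lt_iff₀ hl] at hr1
    linarith
  refine le_trans ?_ key
  have : ρB * d * (ρE * d) ≤ ρB * d * dist (M.src τ) (M.tgt τ) :=
    mul_le_mul_of_nonneg_left h1 (by positivity)
  linarith

lemma cell_subset_closure (τ : Fin M.N) : M.cell τ ⊆ closure Ω := by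
  have h1 : interior (M.cell τ) ⊆ Ω := by
    exact (interior_mono (Set.subset_iUnion (fun τ => M.cell τ) τ)).trans_eq M.domain_eq.symm
  have h2 := (M.convex_cell τ).closure_interior_eq_closure_of_nonempty_interior
    (M.interior_cell_nonempty τ)
  rw [(M.isCompact_cell τ).isClosed.closure_eq] at h2
  rw [← h2]
  exact closure_mono h1

/-! ### The discrete Poincaré inequality -/

/-- The three parts of the square of the norm of `V_h`. -/
def gradSq (v : M.Vec) : ℝ := M.meshInt fun τ y => ∑ i, ∑ j, v.grad i j τ y ^ 2
def jumpPrSq (v : M.Vec) : ℝ :=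
  ∑ τ ∈ M.plus, (M.lenPr τ)⁻¹ * M.intPr τ fun y => ∑ i, M.jumpPr (v.comp i) τ y ^ 2
def jumpDlSq (v : M.Vec) : ℝ :=
  ∑ τ, (M.lenDl τ)⁻¹ * M.intDl τ fun y => M.jumpDl (v.dot (M.tanDl τ)) τ y ^ 2

lemma gradSq_nonneg (v : M.Vec) : 0 ≤ M.gradSq v := by
  unfold gradSq meshInt
  exact Finset.sum_nonneg fun τ _ => setIntegral_nonneg (M.measurableSet_cell τ) fun y _ =>
    Finset.sum_nonneg fun _ _ => Finset.sum_nonneg fun _ _ => sq_nonneg _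

lemma jumpPrSq_nonneg (v : M.Vec) : 0 ≤ M.jumpPrSq v :=
  Finset.sum_nonneg fun τ _ => mul_nonneg (inv_nonneg.2 (M.lenPr_pos τ).le)
    (edgeInt_nonneg fun y => by positivity)

lemma jumpDlSq_nonneg (v : M.Vec) : 0 ≤ M.jumpDlSq v :=
  Finset.sum_nonneg fun τ _ => mul_nonneg (inv_nonneg.2 (M.lenDl_pos τ).le)
    (edgeInt_nonneg fun y => by positivity)

lemma hNorm_sq (v : M.Vec) : M.hNorm v ^ 2 = M.gradSq v + M.jumpPrSq v + M.jumpDlSq v :=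
  Real.sq_sqrt (add_nonneg (add_nonneg (M.gradSq_nonneg v) (M.jumpPrSq_nonneg v))
    (M.jumpDlSq_nonneg v))

lemma hNorm_nonneg (v : M.Vec) : 0 ≤ M.hNorm v := Real.sqrt_nonneg _

/-- The square of the `L²` norm on a triangle. -/
def cellSq (v : M.Vec) (τ : Fin M.N) : ℝ := ∫ y in M.cell τ, ∑ i, v.comp i τ y ^ 2

lemma cellSq_nonneg (v : M.Vec) (τ : Fin M.N) : 0 ≤ M.cellSq v τ :=
  setIntegral_nonneg (M.measurableSet_cell τ) fun y _ => by positivity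

lemma trace_aux {a b c : Pt} {κ C d : ℝ} (hab : dist a b ≤ d) (hκ : κ * d ^ 2 ≤ cross (b - a) (c - a)) (hκ0 : 0 < κ) {p : Poly}
    (h : cross (b - a) (c - a) * segMean a b (fun y => ev y p ^ 2) ≤
      C * ∫ y in convexHull ℝ ({a, b, c} : Set Pt), ev y p ^ 2) :
    dist a b * edgeInt a b (fun y => ev y p ^ 2) ≤
      C / κ * ∫ y in convexHull ℝ ({a, b, c} : Set Pt), ev y p ^ 2 := by
  have hs : 0 ≤ segMean a b (fun y => ev y p ^ 2) :=
    intervalIntegral.integral_nonneg zero_le_one fun _ _ => sq_nonneg _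
  have h1 : dist a b ^ 2 ≤ d ^ 2 := by gcongr
  have h2 : κ * dist a b ^ 2 * segMean a b (fun y => ev y p ^ 2) ≤
      cross (b - a) (c - a) * segMean a b (fun y => ev y p ^ 2) := by
    refine mul_le_mul_of_nonneg_right (le_trans ?_ hκ) hs
    gcongr
  rw [edgeInt_eq, div_mul_eq_mul_div, le_div_iff₀ hκ0]
  linarith

variable {M} in
lemma exists_trace_mesh (k : ℕ) {ρE ρB : ℝ} (hρE : 0 < ρE) (hρB : 0 < ρB) :
    ∃ C, 0 < C ∧ ∀ {Ω : Set Pt} (M : StaggeredMesh Ω), M.IsRegular ρE ρB → ∀ (τ : Fin M.N)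
      (p : Fin 2 → Poly), (∀ i, (p i).totalDegree ≤ k) →
      (M.lenPr τ * M.intPr τ fun y => ∑ i, ev y (p i) ^ 2) ≤
        C * (∫ y in M.cell τ, ∑ i, ev y (p i) ^ 2) ∧
      (M.lenDl τ * M.intDl τ fun y => ∑ i, ev y (p i) ^ 2) ≤
        C * (∫ y in M.cell τ, ∑ i, ev y (p i) ^ 2) ∧
      (M.lenDl τ * M.intDl τ fun y => ∑ i, ev y (p i) ^ 2) ≤
        C * ∫ y in M.cell (M.next τ), ∑ i, ev y (p i) ^ 2 := by
  obtain ⟨C, hC, h⟩ := exists_trace k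
  refine ⟨C / (ρE * ρB), by positivity, fun {Ω} M hM τ p hp => ?_⟩
  have hκ : 0 < ρE * ρB := by positivity
  have hi : ∀ (σ : Fin M.N) (i : Fin 2), IntegrableOn (fun y => ev y (p i) ^ 2) (M.cell σ) :=
    fun σ i => ((continuous_ev (p i)).pow 2).continuousOn.integrableOn_compact (M.isCompact_cell σ)
  have t1 := fun (σ : Fin M.N) i => trace_aux
    (M.dist_le_diam (M.src_mem_cell σ) (M.tgt_mem_cell σ))
    (by rw [cross_cyc]; exact hM.area_ge hρB σ) hκ (h _ _ _ (M.ccw_src σ) (p i) (hp i))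
  have t2 := fun (σ : Fin M.N) i => trace_aux
    (M.dist_le_diam (M.tgt_mem_cell σ) (M.ctr_mem_cell σ))
    (by rw [cross_cyc, cross_cyc]; exact hM.area_ge hρB σ) hκ
    (h _ _ _ (M.ccw_tgt σ) (p i) (hp i))
  have t3 := fun (σ : Fin M.N) i => trace_aux
    (M.dist_le_diam (M.ctr_mem_cell σ) (M.src_mem_cell σ))
    (hM.area_ge hρB σ) hκ (h _ _ _ (M.ccw σ) (p i) (hp i))
  simp only [← M.cell_eq_src, ← M.cell_eq_tgt] at t1 t2
  change ∀ (σ : Fin M.N) i, _ ≤ C / (ρE * ρB) * ∫ y in M.cell σ, _ at t3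
  simp only [Fin.sum_univ_two, intPr, intDl, lenPr, lenDl]
  rw [edgeInt_add _ _ (by fun_prop) (by fun_prop), edgeInt_add _ _ (by fun_prop) (by fun_prop),
    integral_add (hi _ 0) (hi _ 1), integral_add (hi _ 0) (hi _ 1)]
  refine ⟨?_, ?_, ?_⟩
  · have a := t1 τ 0
    have b := t1 τ 1
    linarith
  · have a := t2 τ 0
    have b := t2 τ 1
    linarith
  · have a := t3 (M.next τ) 0
    have b := t3 (M.next τ) 1
    rw [M.ctr_next, M.src_next, edgeInt_comm, dist_comm] at a b
    linarith

lemma sum_jump_sq {k : ℕ} {v : M.Vec} (hv : v ∈ M.VSpace k) (τ : Fin M.N) {y : Pt}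
    (hy : y ∈ segment ℝ (M.tgt τ) (M.ctr τ)) :
    ∑ i, (ev y (v τ i) - ev y (v (M.next τ) i)) ^ 2 =
      M.jumpDl (v.dot (M.tanDl τ)) τ y ^ 2 := by
  have h2 := hv.2 τ y hy
  have h3 := utan_sq (M.tgt_ne_ctr τ)
  simp only [jumpDl, Vec.dot, norDl, tanDl, unor_zero, unor_one, Fin.sum_univ_two] at h2 ⊢
  set t0 := utan (M.tgt τ) (M.ctr τ) 0
  set t1 := utan (M.tgt τ) (M.ctr τ) 1
  set a := ev y (v τ 0)
  set b := ev y (v τ 1)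
  set c := ev y (v (M.next τ) 0)
  set d := ev y (v (M.next τ) 1)
  linear_combination (-((a - c) ^ 2 + (b - d) ^ 2)) * h3 +
    (a * t1 + b * -t0 - (c * t1 + d * -t0)) * h2

lemma abs_unor_le (a b : Pt) (h : a ≠ b) : |unor a b 0| ≤ 1 := by
  have := utan_sq h
  rw [unor_zero, ← sq_le_one_iff_abs_le_one]
  nlinarith [sq_nonneg (utan a b 0)]

lemma exists_poincare (Ω : Set Pt) (hbdd : Bornology.IsBounded Ω) (k : ℕ) {ρE ρB : ℝ}
    (hρE : 0 < ρE) (hρB : 0 < ρB) :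
    ∃ C, 0 < C ∧ ∀ M : StaggeredMesh Ω, M.IsRegular ρE ρB → ∀ v ∈ M.VSpace k,
      ∑ τ, M.cellSq v τ ≤ C * M.hNorm v ^ 2 := by
  obtain ⟨C, hC, htr⟩ := exists_trace_mesh k hρE hρB
  obtain ⟨R, hR0, hR⟩ : ∃ R : ℝ, 0 < R ∧ ∀ y ∈ closure Ω, |y 0| ≤ R := by
    obtain ⟨R, hR0, hR⟩ := hbdd.closure.exists_pos_norm_le
    exact ⟨R, hR0, fun y hy => (PiLp.norm_apply_le y 0).trans (hR y hy)⟩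
  set A := 6 * R ^ 2 * C with hA
  have hA0 : 0 < A := by positivity
  refine ⟨2 * (4 * R ^ 2 + A), by positivity, fun M hM v hv => ?_⟩
  let X : M.Vec := fun τ => ![MvPolynomial.X 0 * (v τ 0 * v τ 0 + v τ 1 * v τ 1), 0]
  have hX := M.meshInt_div X
  have hseg : ∀ {τ : Fin M.N} {a b y : Pt}, a ∈ M.cell τ → b ∈ M.cell τ → y ∈ segment ℝ a b →
      |y 0| ≤ R := fun {τ a b y} ha hb hy =>
    hR y (M.cell_subset_closure τ ((M.convex_cell τ).segment_subset ha hb hy))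
  have cg := M.continuous_grad v
  have cc := M.continuous_comp v
  -- interior terms
  have e1 : 3 / 4 * ∑ τ, M.cellSq v τ ≤ M.meshInt X.div + 4 * R ^ 2 * M.gradSq v := by
    unfold gradSq meshInt cellSq
    rw [Finset.mul_sum, Finset.mul_sum, ← Finset.sum_add_distrib]
    refine Finset.sum_le_sum fun τ _ => ?_
    have i1 : IntegrableOn (X.div τ) (M.cell τ) :=
      (M.continuous_div X τ).continuousOn.integrableOn_compact (M.isCompact_cell τ)
    have i2 : IntegrableOn (fun y => ∑ i, ∑ j, v.grad i j τ y ^ 2) (M.cell τ) :=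
      (by fun_prop : Continuous fun y => ∑ i, ∑ j, v.grad i j τ y ^ 2)
        |>.continuousOn.integrableOn_compact (M.isCompact_cell τ)
    have i3 : IntegrableOn (fun y => ∑ i, v.comp i τ y ^ 2) (M.cell τ) :=
      (by fun_prop : Continuous fun y => ∑ i, v.comp i τ y ^ 2)
        |>.continuousOn.integrableOn_compact (M.isCompact_cell τ)
    rw [← integral_const_mul, ← integral_const_mul, ← integral_add i1 (i2.const_mul _)]
    refine setIntegral_mono_on (i3.const_mul _) (i1.add (i2.const_mul _))
      (M.measurableSet_cell τ) fun y hy => ?_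
    have hy0 := sq_le_sq' (abs_le.1 (hR y (M.cell_subset_closure τ hy))).1
      (abs_le.1 (hR y (M.cell_subset_closure τ hy))).2
    simp [X, Vec.div, Vec.grad, Vec.comp, Fin.sum_univ_two]
    set a := ev y (v τ 0)
    set b := ev y (v τ 1)
    set a' := ev y (MvPolynomial.pderiv 0 (v τ 0))
    set b' := ev y (MvPolynomial.pderiv 0 (v τ 1))
    set a'' := ev y (MvPolynomial.pderiv 1 (v τ 0))
    set b'' := ev y (MvPolynomial.pderiv 1 (v τ 1))
    have p1 := sq_nonneg (a / 2 + 2 * (y 0 * a'))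
    have p2 := sq_nonneg (b / 2 + 2 * (y 0 * b'))
    have p3 : y 0 ^ 2 * (a' ^ 2 + b' ^ 2) ≤ R ^ 2 * (a' ^ 2 + b' ^ 2) :=
      mul_le_mul_of_nonneg_right hy0 (by positivity)
    have p4 : 0 ≤ R ^ 2 * (a'' ^ 2 + b'' ^ 2) := by positivity
    linarith
  -- edge terms
  have hAC : R ^ 2 / (2 * A) * C = 1 / 12 := by rw [hA]; field_simp; norm_num
  have hcoef : 0 ≤ R ^ 2 / (2 * A) := by positivity
  have e2 : ∑ τ ∈ M.plus, M.intPr τ (M.jumpPr (X.dot (M.norPr τ)) τ) ≤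
      A * M.jumpPrSq v + 1 / 12 * ∑ τ, M.cellSq v τ := by
    rw [M.sum_primal, jumpPrSq, Finset.mul_sum, Finset.mul_sum, ← Finset.sum_add_distrib]
    refine Finset.sum_le_sum fun τ _ => ?_
    have hn := abs_unor_le _ _ (M.src_ne_tgt τ)
    have hy := fun y => hseg (y := y) (M.src_mem_cell τ) (M.tgt_mem_cell τ)
    have hT := (htr M hM τ (v τ) (hv.1 τ)).1
    rcases h : M.nbr τ with _ | σ
    · have hE := edge_young (M.src_ne_tgt τ) hA0 hn hy (v τ) 0
      have e : M.jumpPr (X.dot (M.norPr τ)) τ = fun y => y 0 * unor (M.src τ) (M.tgt τ) 0 *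
          ∑ i, (ev y (v τ i) ^ 2 - ev y ((0 : Fin 2 → Poly) i) ^ 2) := by
        ext y; simp [jumpPr, h, Vec.dot, X, norPr]; ring
      have z0 : edgeInt (M.src τ) (M.tgt τ) (fun _ => 0) = 0 := by simp [edgeInt]
      have hT' := mul_le_mul_of_nonneg_left hT hcoef
      rw [← mul_assoc _ C, hAC] at hT'
      unfold intPr lenPr at *
      rw [e]
      simp only [jumpPr, h, Option.elim_none, cellSq, Vec.comp] at *
      simp only [Pi.zero_apply, ev_zero, sub_zero, ne_eq, OfNat.ofNat_ne_zero, not_false_eq_true,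
        zero_pow, Finset.sum_const_zero, z0, mul_zero, add_zero] at hE ⊢
      linarith
    · have hE := edge_young (M.src_ne_tgt τ) hA0 hn hy (v τ) (v σ)
      have e : M.jumpPr (X.dot (M.norPr τ)) τ = fun y => y 0 * unor (M.src τ) (M.tgt τ) 0 *
          ∑ i, (ev y (v τ i) ^ 2 - ev y (v σ i) ^ 2) := by
        ext y; simp [jumpPr, h, Vec.dot, X, norPr, Fin.sum_univ_two]; ring
      have hTσ := (htr M hM σ (v σ) (hv.1 σ)).1
      rw [M.intPr_nbr h] at hTσ
      have hl : M.lenPr σ = M.lenPr τ := by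
        have := (M.nbr_eq_some σ τ).1 h
        rw [lenPr, this.1, this.2, dist_comm]; rfl
      rw [hl] at hTσ
      have hT' := mul_le_mul_of_nonneg_left hT hcoef
      have hTσ' := mul_le_mul_of_nonneg_left hTσ hcoef
      rw [← mul_assoc _ C, hAC] at hT' hTσ'
      unfold intPr lenPr at *
      rw [e]
      simp only [jumpPr, h, Option.elim_some, cellSq, Vec.comp] at *
      linarith
  have e3 : ∑ τ, M.intDl τ (M.jumpDl (X.dot (M.norDl τ)) τ) ≤
      A * M.jumpDlSq v + 1 / 12 * (∑ τ, M.cellSq v τ + ∑ τ, M.cellSq v (M.next τ)) := by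
    rw [jumpDlSq, Finset.mul_sum, ← Finset.sum_add_distrib, Finset.mul_sum,
      ← Finset.sum_add_distrib]
    refine Finset.sum_le_sum fun τ _ => ?_
    have hn := abs_unor_le _ _ (M.tgt_ne_ctr τ)
    have hy := fun y => hseg (y := y) (M.tgt_mem_cell τ) (M.ctr_mem_cell τ)
    have hT := (htr M hM τ (v τ) (hv.1 τ)).2.1
    have hTσ := (htr M hM τ (v (M.next τ)) (hv.1 _)).2.2
    have hE := edge_young (M.tgt_ne_ctr τ) hA0 hn hy (v τ) (v (M.next τ))
    have e : M.jumpDl (X.dot (M.norDl τ)) τ = fun y => y 0 * unor (M.tgt τ) (M.ctr τ) 0 *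
        ∑ i, (ev y (v τ i) ^ 2 - ev y (v (M.next τ) i) ^ 2) := by
      ext y; simp [jumpDl, Vec.dot, X, norDl, Fin.sum_univ_two]; ring
    have hT' := mul_le_mul_of_nonneg_left hT hcoef
    have hTσ' := mul_le_mul_of_nonneg_left hTσ hcoef
    rw [← mul_assoc _ C, hAC] at hT' hTσ'
    rw [edgeInt_congr (fun y hy => M.sum_jump_sq hv τ hy)] at hE
    unfold intDl lenDl at *
    rw [e]
    simp only [cellSq, Vec.comp] at *
    linarith
  rw [M.sum_next] at e3
  have n1 := M.jumpPrSq_nonneg v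
  have n2 := M.jumpDlSq_nonneg v
  have n3 := M.gradSq_nonneg v
  have n4 : 0 ≤ A * M.gradSq v := by positivity
  have n5 : 0 ≤ R ^ 2 * (M.jumpPrSq v + M.jumpDlSq v) := by positivity
  rw [M.hNorm_sq]
  nlinarith

end StaggeredMesh
end
end StaggeredDG

namespace StaggeredDG
noncomputable section

/-! ### Tensors with prescribed edge values and moments -/

lemma abs_coord_le_dist (a b : Pt) (i : Fin 2) : |(b - a) i| ≤ dist a b := by
  rw [dist_comm, dist_eq_norm]
  exact PiLp.norm_apply_le (b - a) i

lemma contraction_sq_le {d x0 x1 y0 y1 : ℝ} (hx0 : |x0| ≤ d) (hx1 : |x1| ≤ d) (hy0 : |y0| ≤ d)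
    (hy1 : |y1| ≤ d) (g : Fin 2 → Fin 2 → ℝ) :
    (x0 * y0 * g 0 0 + x0 * y1 * g 0 1 + x1 * y0 * g 1 0 + x1 * y1 * g 1 1) ^ 2 ≤
      4 * d ^ 4 * ∑ i, ∑ j, g i j ^ 2 := by
  have key : ∀ x y g : ℝ, |x| ≤ d → |y| ≤ d → (x * y * g) ^ 2 ≤ d ^ 4 * g ^ 2 := by
    intro x y g hx hy
    have h1 : x ^ 2 ≤ d ^ 2 := sq_le_sq' (abs_le.1 hx).1 (abs_le.1 hx).2
    have h2 : y ^ 2 ≤ d ^ 2 := sq_le_sq' (abs_le.1 hy).1 (abs_le.1 hy).2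
    calc (x * y * g) ^ 2 = x ^ 2 * y ^ 2 * g ^ 2 := by ring
      _ ≤ d ^ 2 * d ^ 2 * g ^ 2 := by gcongr
      _ = d ^ 4 * g ^ 2 := by ring
  have k1 := key x0 y0 (g 0 0) hx0 hy0
  have k2 := key x0 y1 (g 0 1) hx0 hy1
  have k3 := key x1 y0 (g 1 0) hx1 hy0
  have k4 := key x1 y1 (g 1 1) hx1 hy1
  simp only [Fin.sum_univ_two]
  generalize x0 * y0 * g 0 0 = A at *
  generalize x0 * y1 * g 0 1 = B at *
  generalize x1 * y0 * g 1 0 = C at *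
  generalize x1 * y1 * g 1 1 = E at *
  nlinarith [sq_nonneg (A - B), sq_nonneg (A - C), sq_nonneg (A - E), sq_nonneg (B - C),
    sq_nonneg (B - E), sq_nonneg (C - E)]

/-- The tensor entry `e ⊗ f` combination that shifts the four contractions by `α, β, γ, δ`. -/
def shiftEntry (c11 c12 c21 c22 : ℝ) (α β γ δ : Poly) : Poly :=
  c11 • α - c12 • (β + α) - c21 • (γ + δ) + c22 • δ

lemma totalDegree_shiftEntry {k : ℕ} (c11 c12 c21 c22 : ℝ) {α β γ δ : Poly}
    (hα : α.totalDegree ≤ k) (hβ : β.totalDegree ≤ k) (hγ : γ.totalDegree ≤ k)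
    (hδ : δ.totalDegree ≤ k) : (shiftEntry c11 c12 c21 c22 α β γ δ).totalDegree ≤ k := by
  simp only [← MvPolynomial.mem_restrictTotalDegree] at *
  exact add_mem (sub_mem (sub_mem (Submodule.smul_mem _ _ hα) (Submodule.smul_mem _ _
    (add_mem hβ hα))) (Submodule.smul_mem _ _ (add_mem hγ hδ))) (Submodule.smul_mem _ _ hδ)

lemma shift_sq_le {m c11 c12 c21 c22 : ℝ} (h11 : c11 ^ 2 ≤ m) (h12 : c12 ^ 2 ≤ m)
    (h21 : c21 ^ 2 ≤ m) (h22 : c22 ^ 2 ≤ m) (g α β γ δ : ℝ) :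
    (g + (c11 * α - c12 * (β + α) - c21 * (γ + δ) + c22 * δ)) ^ 2 ≤
      14 * g ^ 2 + 14 * m * (α ^ 2 + β ^ 2 + γ ^ 2 + δ ^ 2) := by
  have key : ∀ c x : ℝ, c ^ 2 ≤ m → (c * x) ^ 2 ≤ m * x ^ 2 := fun c x h => by
    rw [mul_pow]; exact mul_le_mul_of_nonneg_right h (sq_nonneg _)
  have k1 := key c11 α h11
  have k2 := key c12 β h12
  have k3 := key c12 α h12
  have k4 := key c21 γ h21
  have k5 := key c21 δ h21
  have k6 := key c22 δ h22
  have hm : 0 ≤ m := (sq_nonneg _).trans h11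
  have n1 : 0 ≤ m * β ^ 2 := by positivity
  have n2 : 0 ≤ m * γ ^ 2 := by positivity
  have cs : ∀ a b c d e f g : ℝ, (a + b + c + d + e + f + g) ^ 2 ≤
      7 * (a ^ 2 + b ^ 2 + c ^ 2 + d ^ 2 + e ^ 2 + f ^ 2 + g ^ 2) := by
    intro a b c d e f g
    have := sq_sum_le_card_mul_sum_sq (s := Finset.univ) (f := ![a, b, c, d, e, f, g])
    simp [Fin.sum_univ_succ] at this
    linarith
  have h := cs g (c11 * α) (-(c12 * β)) (-(c12 * α)) (-(c21 * γ)) (-(c21 * δ)) (c22 * δ)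
  simp only [neg_sq] at h
  have e : g + (c11 * α - c12 * (β + α) - c21 * (γ + δ) + c22 * δ) = g + c11 * α + -(c12 * β) +
    -(c12 * α) + -(c21 * γ) + -(c21 * δ) + c22 * δ := by ring
  rw [e]
  nlinarith [sq_nonneg g]

/-- Contraction of a tensor of polynomials with `x` and the rotated vector `(y₁, -y₀)`. -/
def contr (x y : Pt) (G : Fin 2 → Fin 2 → Poly) : Poly :=
  (x 0 * y 1) • G 0 0 + (x 0 * -y 0) • G 0 1 + (x 1 * y 1) • G 1 0 + (x 1 * -y 0) • G 1 1

lemma totalDegree_contr {k : ℕ} (x y : Pt) {G : Fin 2 → Fin 2 → Poly}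
    (hG : ∀ i j, (G i j).totalDegree ≤ k) : (contr x y G).totalDegree ≤ k := by
  simp only [← MvPolynomial.mem_restrictTotalDegree] at *
  exact add_mem (add_mem (add_mem (Submodule.smul_mem _ _ (hG _ _))
    (Submodule.smul_mem _ _ (hG _ _))) (Submodule.smul_mem _ _ (hG _ _)))
    (Submodule.smul_mem _ _ (hG _ _))

lemma ev_contr (x y : Pt) (G : Fin 2 → Fin 2 → Poly) (z : Pt) : ev z (contr x y G) =
    x 0 * y 1 * ev z (G 0 0) + x 0 * -y 0 * ev z (G 0 1) + x 1 * y 1 * ev z (G 1 0) +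
      x 1 * -y 0 * ev z (G 1 1) := by
  simp [contr]

/-- The tensor whose contractions differ from those of `G` by `α, β, γ, δ`. -/
def shiftTen (x y : Pt) (G : Fin 2 → Fin 2 → Poly) (α β γ δ : Poly) (i j : Fin 2) : Poly :=
  let D := cross x y
  let e1 : Fin 2 → ℝ := ![y 1 / D, -y 0 / D]
  let e2 : Fin 2 → ℝ := ![-x 1 / D, x 0 / D]
  let f1 : Fin 2 → ℝ := ![-y 0 / D, -y 1 / D]
  let f2 : Fin 2 → ℝ := ![x 0 / D, x 1 / D]
  G i j + shiftEntry (e1 i * f1 j) (e1 i * f2 j) (e2 i * f1 j) (e2 i * f2 j) α β γ δ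

lemma contr_shiftTen {x y : Pt} (hD : cross x y ≠ 0) (G : Fin 2 → Fin 2 → Poly)
    (α β γ δ : Poly) (z : Pt) :
    ev z (contr x x (shiftTen x y G α β γ δ)) = ev z (contr x x G) + ev z α ∧
    ev z (contr x (-x - y) (shiftTen x y G α β γ δ)) = ev z (contr x (-x - y) G) + ev z β ∧
    ev z (contr y (-x - y) (shiftTen x y G α β γ δ)) = ev z (contr y (-x - y) G) + ev z γ ∧
    ev z (contr y y (shiftTen x y G α β γ δ)) = ev z (contr y y G) + ev z δ := by
  simp only [ev_contr, shiftTen, shiftEntry, ev_add, ev_sub, ev_smul, Matrix.cons_val_zero,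
    Matrix.cons_val_one, PiLp.sub_apply, PiLp.neg_apply]
  have hD' : cross x y = x 0 * y 1 - x 1 * y 0 := rfl
  generalize cross x y = D at *
  refine ⟨?_, ?_, ?_, ?_⟩ <;> field_simp <;> rw [hD'] <;> ring

lemma contr_eq (x y : Pt) (G : Fin 2 → Fin 2 → Poly) (z : Pt) : ev z (contr x y G) =
    x 0 * (ev z (G 0 0) * y 1 + ev z (G 0 1) * -y 0) +
      x 1 * (ev z (G 1 0) * y 1 + ev z (G 1 1) * -y 0) := by
  rw [ev_contr]; ring

lemma smul_utan {a b : Pt} (h : a ≠ b) (i : Fin 2) : dist a b * utan a b i = (b - a) i := by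
  simp [utan, dist_ne_zero.2 h]

/-- A quadratic contraction with an edge vector determines the tangential-normal component. -/
lemma quad_of_contr {a b z : Pt} (h : a ≠ b) {H : Fin 2 → Fin 2 → Poly} {j : ℝ}
    (hc : ev z (contr (b - a) (b - a) H) = dist a b ^ 2 * j) :
    ∑ i, utan a b i * ∑ l, ev z (H i l) * unor a b l = j := by
  have hd : dist a b ≠ 0 := dist_ne_zero.2 h
  rw [contr_eq] at hc
  simp only [← smul_utan h] at hc
  simp only [Fin.sum_univ_two, unor_zero, unor_one]
  apply mul_left_cancel₀ (pow_ne_zero 2 hd)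
  linear_combination hc

lemma app_of_contr {x y a b z : Pt} (h : a ≠ b) (hD : cross x y ≠ 0) {H : Fin 2 → Fin 2 → Poly}
    {j0 j1 : ℝ} (hx : ev z (contr x (b - a) H) = dist a b * (x 0 * j0 + x 1 * j1))
    (hy : ev z (contr y (b - a) H) = dist a b * (y 0 * j0 + y 1 * j1)) :
    ∑ l, ev z (H 0 l) * unor a b l = j0 ∧ ∑ l, ev z (H 1 l) * unor a b l = j1 := by
  have hd : dist a b ≠ 0 := dist_ne_zero.2 h
  rw [contr_eq] at hx hy
  simp only [← smul_utan h] at hx hy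
  simp only [Fin.sum_univ_two, unor_zero, unor_one]
  unfold cross at hD
  constructor
  · apply mul_left_cancel₀ (mul_ne_zero hd hD)
    linear_combination y 1 * hx - x 1 * hy
  · apply mul_left_cancel₀ (mul_ne_zero hd hD)
    linear_combination x 0 * hy - y 0 * hx

set_option maxHeartbeats 2000000 in
lemma exists_local_tensor (k : ℕ) {κ : ℝ} (hκ : 0 < κ) :
    ∃ C, 0 < C ∧ ∀ (a b c : Pt) (d : ℝ), 0 < cross (b - a) (c - a) → dist a b ≤ d →
      dist b c ≤ d → dist c a ≤ d → κ * d ^ 2 ≤ cross (b - a) (c - a) →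
      ∀ (G : Fin 2 → Fin 2 → Poly) (j0 : Fin 2 → Poly) (j1 j2 : Poly),
      (∀ i j, (G i j).totalDegree ≤ k) → (∀ i, (j0 i).totalDegree ≤ k) →
      j1.totalDegree ≤ k → j2.totalDegree ≤ k →
      ∃ H : Fin 2 → Fin 2 → Poly, (∀ i j, (H i j).totalDegree ≤ k) ∧
        (∀ z ∈ segment ℝ a b, ∀ i, ∑ l, ev z (H i l) * unor a b l = ev z (j0 i)) ∧
        (∀ z ∈ segment ℝ b c, ∑ i, utan b c i * ∑ l, ev z (H i l) * unor b c l = ev z j1) ∧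
        (∀ z ∈ segment ℝ c a, ∑ i, utan c a i * ∑ l, ev z (H i l) * unor c a l = ev z j2) ∧
        (∀ i j, ∀ q ∈ lowDeg k,
          ∫ z in convexHull ℝ ({a, b, c} : Set Pt), ev z ((H i j - G i j) * q) = 0) ∧
        ∫ z in convexHull ℝ ({a, b, c} : Set Pt), ∑ i, ∑ j, ev z (H i j) ^ 2 ≤
          C * ((∫ z in convexHull ℝ ({a, b, c} : Set Pt), ∑ i, ∑ j, ev z (G i j) ^ 2) +
            (dist a b * edgeInt a b fun z => ∑ i, ev z (j0 i) ^ 2) +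
            (dist b c * edgeInt b c fun z => ev z j1 ^ 2) +
            dist c a * edgeInt c a fun z => ev z j2 ^ 2) := by
  obtain ⟨C, hC, hlift⟩ := exists_lift k
  refine ⟨14 + 1792 * (C + 1) * (κ ^ 4)⁻¹, by positivity, ?_⟩
  intro a b c d hD hab hbc hca hκD G j0 j1 j2 hG hj0 hj1 hj2
  obtain ⟨nab, nbc, nca⟩ := StaggeredMesh.ne_of_cross_pos hD
  set K := convexHull ℝ ({a, b, c} : Set Pt) with hK
  have hKc : IsCompact K := isCompact_hull a b c
  have hd0 : 0 < d := (dist_pos.2 nab).trans_le hab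
  set x := c - b with hx
  set y := a - c with hy
  have hE0 : b - a = -x - y := by rw [hx, hy]; abel
  have hDxy : cross x y = cross (b - a) (c - a) := by
    simp only [hx, hy, cross, PiLp.sub_apply]; ring
  have hDxy0 : cross x y ≠ 0 := by rw [hDxy]; exact hD.ne'
  have bx : ∀ i, |x i| ≤ d := fun i => (abs_coord_le_dist b c i).trans hbc
  have by' : ∀ i, |y i| ≤ d := fun i => (abs_coord_le_dist c a i).trans hca
  have b0 : ∀ i, |(b - a) i| ≤ d := fun i => (abs_coord_le_dist a b i).trans hab
  have hD1 : cross (c - b) (a - b) = cross (b - a) (c - a) := cross_cyc a b c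
  have hD2 : cross (a - c) (b - c) = cross (b - a) (c - a) := by rw [cross_cyc, cross_cyc]
  have hset1 : ({b, c, a} : Set Pt) = {a, b, c} := insert_rotate a b c
  have hset2 : ({c, a, b} : Set Pt) = {a, b, c} := by rw [insert_rotate b c a, hset1]
  set D := cross (b - a) (c - a) with hDdef
  have hD2d : D ≤ 2 * d ^ 2 := by
    have h1 := bx 0
    have h2 := by' 1
    have h3 := bx 1
    have h4 := by' 0
    have m1 := mul_le_mul h1 h2 (abs_nonneg _) hd0.le
    have m2 := mul_le_mul h3 h4 (abs_nonneg _) hd0.le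
    rw [← abs_mul] at m1 m2
    rw [← hDxy, cross]
    have := neg_abs_le (x 1 * y 0)
    have := le_abs_self (x 0 * y 1)
    linarith
  -- the four lifts
  have hdegC : ∀ (r : ℝ) (p : Poly), p.totalDegree ≤ k → (r • p).totalDegree ≤ k := fun r p hp =>
    (MvPolynomial.totalDegree_smul_le _ _).trans hp
  have hdegA : ∀ r s : ℝ, (r • j0 0 + s • j0 1).totalDegree ≤ k := fun r s =>
    (MvPolynomial.totalDegree_add _ _).trans (max_le (hdegC _ _ (hj0 0)) (hdegC _ _ (hj0 1)))
  obtain ⟨pα, dα, eα, mα, bα⟩ := hlift b c a (hD1 ▸ hD) (dist b c ^ 2 • j1) (contr x x G)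
    (hdegC _ _ hj1) (totalDegree_contr _ _ hG)
  obtain ⟨pδ, dδ, eδ, mδ, bδ⟩ := hlift c a b (hD2 ▸ hD) (dist c a ^ 2 • j2) (contr y y G)
    (hdegC _ _ hj2) (totalDegree_contr _ _ hG)
  obtain ⟨pβ, dβ, eβ, mβ, bβ⟩ := hlift a b c hD
    ((dist a b * x 0) • j0 0 + (dist a b * x 1) • j0 1) (contr x (b - a) G)
    (hdegA _ _) (totalDegree_contr _ _ hG)
  obtain ⟨pγ, dγ, eγ, mγ, bγ⟩ := hlift a b c hD
    ((dist a b * y 0) • j0 0 + (dist a b * y 1) • j0 1) (contr y (b - a) G)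
    (hdegA _ _) (totalDegree_contr _ _ hG)
  rw [hset1, hD1] at bα
  rw [hset1] at mα
  rw [hset2, hD2] at bδ
  rw [hset2] at mδ
  rw [← hK] at mα mβ mγ mδ bα bβ bγ bδ
  set W := (∫ z in K, ∑ i, ∑ j, ev z (G i j) ^ 2) +
    (dist a b * edgeInt a b fun z => ∑ i, ev z (j0 i) ^ 2) +
    (dist b c * edgeInt b c fun z => ev z j1 ^ 2) +
    dist c a * edgeInt c a fun z => ev z j2 ^ 2 with hW
  have w0 : 0 ≤ ∫ z in K, ∑ i, ∑ j, ev z (G i j) ^ 2 :=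
    setIntegral_nonneg hKc.measurableSet fun z _ =>
      Finset.sum_nonneg fun _ _ => Finset.sum_nonneg fun _ _ => sq_nonneg _
  have w1 : 0 ≤ dist a b * edgeInt a b fun z => ∑ i, ev z (j0 i) ^ 2 :=
    mul_nonneg dist_nonneg (edgeInt_nonneg fun z => by positivity)
  have w2 : 0 ≤ dist b c * edgeInt b c fun z => ev z j1 ^ 2 :=
    mul_nonneg dist_nonneg (edgeInt_nonneg fun z => by positivity)
  have w3 : 0 ≤ dist c a * edgeInt c a fun z => ev z j2 ^ 2 :=
    mul_nonneg dist_nonneg (edgeInt_nonneg fun z => by positivity)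
  have hint : ∀ {f : Pt → ℝ}, Continuous f → IntegrableOn f K := fun hf =>
    hf.continuousOn.integrableOn_compact hKc
  -- bounds for the contractions and for the edge data
  have cG : ∀ u v : Pt, (∀ i, |u i| ≤ d) → (∀ i, |v i| ≤ d) →
      ∫ z in K, ev z (contr u v G) ^ 2 ≤ 4 * d ^ 4 * ∫ z in K, ∑ i, ∑ j, ev z (G i j) ^ 2 := by
    intro u v hu hv
    rw [← integral_const_mul]
    refine integral_mono (hint (by fun_prop)) (hint (by fun_prop)) fun z => ?_
    have := contraction_sq_le (d := d) (hu 0) (hu 1) (hv 1) (y1 := -v 0)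
      (by rw [abs_neg]; exact hv 0) (fun i j => ev z (G i j))
    simpa only [ev_contr] using this
  have quadE : ∀ (p q : Pt) (j : Poly), p ≠ q → dist p q ≤ d →
      D * segMean p q (fun z => ev z (dist p q ^ 2 • j) ^ 2) ≤
        4 * d ^ 4 * (dist p q * edgeInt p q fun z => ev z j ^ 2) := by
    intro p q j hpq hle
    have hs : 0 ≤ segMean p q fun z => ev z j ^ 2 :=
      intervalIntegral.integral_nonneg zero_le_one fun _ _ => sq_nonneg _
    have e : (fun z => ev z (dist p q ^ 2 • j) ^ 2) = fun z => dist p q ^ 4 * ev z j ^ 2 := by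
      ext z; rw [ev_smul]; ring
    rw [e, segMean_const_mul, edgeInt_eq]
    have h1 : D * dist p q ^ 2 ≤ 4 * d ^ 4 := by
      have : dist p q ^ 2 ≤ d ^ 2 := by gcongr
      calc D * dist p q ^ 2 ≤ 2 * d ^ 2 * d ^ 2 := by gcongr
        _ ≤ 4 * d ^ 4 := by nlinarith [pow_pos hd0 4]
    calc D * (dist p q ^ 4 * segMean p q fun z => ev z j ^ 2)
        = D * dist p q ^ 2 * (dist p q ^ 2 * segMean p q fun z => ev z j ^ 2) := by ring
      _ ≤ 4 * d ^ 4 * (dist p q ^ 2 * segMean p q fun z => ev z j ^ 2) := by gcongr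
      _ = _ := by ring
  have linE : ∀ u : Pt, (∀ i, |u i| ≤ d) →
      D * segMean a b (fun z => ev z ((dist a b * u 0) • j0 0 + (dist a b * u 1) • j0 1) ^ 2) ≤
        4 * d ^ 4 * (dist a b * edgeInt a b fun z => ∑ i, ev z (j0 i) ^ 2) := by
    intro u hu
    have hs : 0 ≤ segMean a b fun z => ∑ i, ev z (j0 i) ^ 2 :=
      intervalIntegral.integral_nonneg zero_le_one fun _ _ =>
        Finset.sum_nonneg fun _ _ => sq_nonneg _
    have h1 : segMean a b (fun z => ev z ((dist a b * u 0) • j0 0 + (dist a b * u 1) • j0 1) ^ 2)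
        ≤ (2 * d ^ 2 * dist a b ^ 2) * segMean a b fun z => ∑ i, ev z (j0 i) ^ 2 := by
      rw [← segMean_const_mul]
      refine intervalIntegral.integral_mono_on zero_le_one
        (Continuous.intervalIntegrable (by fun_prop) _ _)
        (Continuous.intervalIntegrable (by fun_prop) _ _) fun s _ => ?_
      set z := AffineMap.lineMap (k := ℝ) a b s
      simp only [ev_add, ev_smul, Fin.sum_univ_two]
      have q0 : u 0 ^ 2 ≤ d ^ 2 := sq_le_sq' (abs_le.1 (hu 0)).1 (abs_le.1 (hu 0)).2
      have q1 : u 1 ^ 2 ≤ d ^ 2 := sq_le_sq' (abs_le.1 (hu 1)).1 (abs_le.1 (hu 1)).2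
      have r0 : u 0 ^ 2 * ev z (j0 0) ^ 2 ≤ d ^ 2 * ev z (j0 0) ^ 2 := by gcongr
      have r1 : u 1 ^ 2 * ev z (j0 1) ^ 2 ≤ d ^ 2 * ev z (j0 1) ^ 2 := by gcongr
      have r2 : (u 0 * ev z (j0 0) + u 1 * ev z (j0 1)) ^ 2 ≤
          2 * d ^ 2 * (ev z (j0 0) ^ 2 + ev z (j0 1) ^ 2) := by
        nlinarith [sq_nonneg (u 0 * ev z (j0 0) - u 1 * ev z (j0 1))]
      calc (dist a b * u 0 * ev z (j0 0) + dist a b * u 1 * ev z (j0 1)) ^ 2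
          = dist a b ^ 2 * (u 0 * ev z (j0 0) + u 1 * ev z (j0 1)) ^ 2 := by ring
        _ ≤ dist a b ^ 2 * (2 * d ^ 2 * (ev z (j0 0) ^ 2 + ev z (j0 1) ^ 2)) := by gcongr
        _ = _ := by ring
    rw [edgeInt_eq]
    calc _ ≤ D * ((2 * d ^ 2 * dist a b ^ 2) * segMean a b fun z => ∑ i, ev z (j0 i) ^ 2) := by
          gcongr
      _ ≤ (2 * d ^ 2) * ((2 * d ^ 2 * dist a b ^ 2) *
            segMean a b fun z => ∑ i, ev z (j0 i) ^ 2) := by gcongr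
      _ = _ := by ring
  have qα := quadE b c j1 nbc hbc
  have qδ := quadE c a j2 nca hca
  have lβ := linE x bx
  have lγ := linE y by'
  -- bounds for the lifts
  have fin : ∀ (p : Poly) (u v : Pt) (S w : ℝ), (∀ i, |u i| ≤ d) → (∀ i, |v i| ≤ d) →
      ∫ z in K, ev z p ^ 2 ≤ C * ((∫ z in K, ev z (contr u v G) ^ 2) + S) →
      S ≤ 4 * d ^ 4 * w → (∫ z in K, ∑ i, ∑ j, ev z (G i j) ^ 2) + w ≤ W →
      ∫ z in K, ev z (p - contr u v G) ^ 2 ≤ 8 * (C + 1) * d ^ 4 * W := by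
    intro p u v S w hu hv h1 h2 h3
    have h4 := cG u v hu hv
    have h5 : ∫ z in K, ev z p ^ 2 ≤ C * (4 * d ^ 4 * W) := by
      refine h1.trans (mul_le_mul_of_nonneg_left ?_ hC.le)
      have : 4 * d ^ 4 * ((∫ z in K, ∑ i, ∑ j, ev z (G i j) ^ 2) + w) ≤ 4 * d ^ 4 * W := by gcongr
      linarith
    have h6 : ∫ z in K, ev z (contr u v G) ^ 2 ≤ 4 * d ^ 4 * W := by
      refine h4.trans ?_
      have : (∫ z in K, ∑ i, ∑ j, ev z (G i j) ^ 2) ≤ W := by linarith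
      gcongr
    have h7 : ∫ z in K, ev z (p - contr u v G) ^ 2 ≤
        ∫ z in K, (2 * ev z p ^ 2 + 2 * ev z (contr u v G) ^ 2) := by
      refine integral_mono (hint (by fun_prop)) (hint (by fun_prop)) fun z => ?_
      simp only [ev_sub]
      nlinarith [sq_nonneg (ev z p + ev z (contr u v G))]
    rw [integral_add (hint (by fun_prop)) (hint (by fun_prop)), integral_const_mul,
      integral_const_mul] at h7
    linarith
  have Fα := fin pα x x _ _ bx bx bα qα (by linarith)
  have Fδ := fin pδ y y _ _ by' by' bδ qδ (by linarith)
  have Fβ := fin pβ x (b - a) _ _ bx b0 bβ lβ (by linarith)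
  have Fγ := fin pγ y (b - a) _ _ by' b0 bγ lγ (by linarith)
  set α := pα - contr x x G with hα
  set β := pβ - contr x (b - a) G with hβ
  set γ := pγ - contr y (b - a) G with hγ
  set δ := pδ - contr y y G with hδ
  have degsub : ∀ {p q : Poly}, p.totalDegree ≤ k → q.totalDegree ≤ k →
      (p - q).totalDegree ≤ k := fun hp hq =>
    (MvPolynomial.totalDegree_sub _ _).trans (max_le hp hq)
  have Hc := contr_shiftTen hDxy0 G α β γ δ
  rw [← hE0] at Hc
  refine ⟨shiftTen x y G α β γ δ, ?_, ?_, ?_, ?_, ?_, ?_⟩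
  · intro i j
    exact (MvPolynomial.totalDegree_add _ _).trans (max_le (hG i j) (totalDegree_shiftEntry _ _ _ _
      (degsub dα (totalDegree_contr _ _ hG)) (degsub dβ (totalDegree_contr _ _ hG))
      (degsub dγ (totalDegree_contr _ _ hG)) (degsub dδ (totalDegree_contr _ _ hG))))
  · intro z hz i
    obtain ⟨-, h2, h3, -⟩ := Hc z
    have e2 := eβ z hz
    have e3 := eγ z hz
    have := app_of_contr (z := z) (H := shiftTen x y G α β γ δ) nab hDxy0
      (j0 := ev z (j0 0)) (j1 := ev z (j0 1))
      (by rw [h2, hβ, ev_sub, e2, ev_add, ev_smul, ev_smul]; ring)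
      (by rw [h3, hγ, ev_sub, e3, ev_add, ev_smul, ev_smul]; ring)
    fin_cases i
    · exact this.1
    · exact this.2
  · intro z hz
    refine quad_of_contr nbc ?_
    rw [(Hc z).1, hα, ev_sub, eα z hz, ev_smul]; ring
  · intro z hz
    refine quad_of_contr nca ?_
    rw [(Hc z).2.2.2, hδ, ev_sub, eδ z hz, ev_smul]; ring
  · intro i j q hq
    have m : ∀ p ∈ ({α, β, γ, δ} : Set Poly), intL K hKc (p * q) = 0 := by
      rintro p (rfl | rfl | rfl | rfl)
      exacts [mα q hq, mβ q hq, mγ q hq, mδ q hq]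
    change intL K hKc _ = 0
    rw [shiftTen, add_sub_cancel_left, shiftEntry]
    simp only [add_mul, sub_mul, smul_mul_assoc, map_add, map_sub, map_smul,
      m α (by simp), m β (by simp), m γ (by simp), m δ (by simp)]
    simp
  · have hm : ∀ u v : Pt, (∀ i, |u i| ≤ d) → (∀ i, |v i| ≤ d) → ∀ i j,
        (u i / D * (v j / D)) ^ 2 ≤ d ^ 4 / D ^ 4 := by
      intro u v hu hv i j
      have q0 : u i ^ 2 ≤ d ^ 2 := sq_le_sq' (abs_le.1 (hu i)).1 (abs_le.1 (hu i)).2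
      have q1 : v j ^ 2 ≤ d ^ 2 := sq_le_sq' (abs_le.1 (hv j)).1 (abs_le.1 (hv j)).2
      calc (u i / D * (v j / D)) ^ 2 = u i ^ 2 * v j ^ 2 / D ^ 4 := by ring
        _ ≤ d ^ 2 * d ^ 2 / D ^ 4 := by gcongr
        _ = d ^ 4 / D ^ 4 := by ring
    have pt : ∀ z i j, ev z (shiftTen x y G α β γ δ i j) ^ 2 ≤ 14 * ev z (G i j) ^ 2 +
        14 * (d ^ 4 / D ^ 4) * (ev z α ^ 2 + ev z β ^ 2 + ev z γ ^ 2 + ev z δ ^ 2) := by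
      intro z i j
      simp only [shiftTen, shiftEntry, ev_add, ev_sub, ev_smul, hDxy]
      refine shift_sq_le ?_ ?_ ?_ ?_ _ _ _ _ _
      · fin_cases i <;> fin_cases j <;>
          simpa [neg_div] using hm y y by' by' _ _
      · fin_cases i <;> fin_cases j <;>
          simpa [neg_div] using hm y x by' bx _ _
      · fin_cases i <;> fin_cases j <;>
          simpa [neg_div] using hm x y bx by' _ _
      · fin_cases i <;> fin_cases j <;>
          simpa [neg_div] using hm x x bx bx _ _
    have h1 : ∫ z in K, ∑ i, ∑ j, ev z (shiftTen x y G α β γ δ i j) ^ 2 ≤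
        ∫ z in K, (14 * (∑ i, ∑ j, ev z (G i j) ^ 2) + 56 * (d ^ 4 / D ^ 4) *
          (ev z α ^ 2 + ev z β ^ 2 + ev z γ ^ 2 + ev z δ ^ 2)) := by
      refine integral_mono (hint (by fun_prop)) (hint (by fun_prop)) fun z => ?_
      simp only [Fin.sum_univ_two]
      linarith [pt z 0 0, pt z 0 1, pt z 1 0, pt z 1 1]
    rw [integral_add (hint (by fun_prop)) (hint (by fun_prop)), integral_const_mul,
      integral_const_mul, integral_add (hint (by fun_prop)) (hint (by fun_prop)),
      integral_add (hint (by fun_prop)) (hint (by fun_prop)),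
      integral_add (hint (by fun_prop)) (hint (by fun_prop))] at h1
    have h2 : d ^ 4 / D ^ 4 * d ^ 4 ≤ (κ ^ 4)⁻¹ := by
      rw [div_mul_eq_mul_div, div_le_iff₀ (by positivity), ← div_eq_inv_mul,
        le_div_iff₀ (by positivity)]
      calc d ^ 4 * d ^ 4 * κ ^ 4 = (κ * d ^ 2) ^ 4 := by ring
        _ ≤ D ^ 4 := by gcongr
    have hW0 : 0 ≤ W := by positivity
    calc _ ≤ _ := h1
      _ ≤ 14 * W + 56 * (d ^ 4 / D ^ 4) * (8 * (C + 1) * d ^ 4 * W + 8 * (C + 1) * d ^ 4 * W +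
          8 * (C + 1) * d ^ 4 * W + 8 * (C + 1) * d ^ 4 * W) := by
        gcongr
        linarith
      _ = 14 * W + 1792 * (C + 1) * W * (d ^ 4 / D ^ 4 * d ^ 4) := by ring
      _ ≤ 14 * W + 1792 * (C + 1) * W * (κ ^ 4)⁻¹ := by gcongr
      _ = _ := by ring

end
end StaggeredDG

namespace StaggeredDG
noncomputable section
namespace StaggeredMesh

variable {Ω : Set Pt} (M : StaggeredMesh Ω)

/-! ### The inf-sup condition -/

lemma tenNorm_sq (H : M.Ten) : M.tenNorm H ^ 2 = M.tenInner H H := by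
  have h : 0 ≤ M.tenInner H H := by
    unfold tenInner meshInt
    exact Finset.sum_nonneg fun τ _ => setIntegral_nonneg (M.measurableSet_cell τ) fun y _ =>
      Finset.sum_nonneg fun _ _ => Finset.sum_nonneg fun _ _ => mul_self_nonneg _
  exact Real.sq_sqrt h

lemma tenNorm_nonneg (H : M.Ten) : 0 ≤ M.tenNorm H := Real.sqrt_nonneg _

lemma next_surjective : Function.Surjective M.next :=
  (Finite.injective_iff_surjective).1 M.next_injective

lemma lenPr_nbr {σ τ : Fin M.N} (h : M.nbr τ = some σ) : M.lenPr σ = M.lenPr τ := by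
  rw [M.nbr_eq_some] at h
  rw [lenPr, h.1, h.2, dist_comm]; rfl

lemma segment_nbr {σ τ : Fin M.N} (h : M.nbr τ = some σ) :
    segment ℝ (M.src σ) (M.tgt σ) = segment ℝ (M.src τ) (M.tgt τ) := by
  rw [M.nbr_eq_some] at h
  rw [h.1, h.2, segment_symm]

lemma jumpPr_comp_nbr (v : M.Vec) (i : Fin 2) {σ τ : Fin M.N} (h : M.nbr τ = some σ) (y : Pt) :
    M.jumpPr (v.comp i) σ y = -M.jumpPr (v.comp i) τ y := by
  simp [jumpPr, h, M.nbr_symm h]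

lemma totalDegree_jmpPr {k : ℕ} {p : M.Sca} (hp : ∀ τ, (p τ).totalDegree ≤ k) (τ : Fin M.N) :
    (M.jmpPr τ p).totalDegree ≤ k := by
  unfold jmpPr
  cases M.nbr τ with
  | none => exact hp τ
  | some σ => exact (MvPolynomial.totalDegree_sub _ _).trans (max_le (hp τ) (hp σ))

lemma totalDegree_jmpDl {k : ℕ} {p : M.Sca} (hp : ∀ τ, (p τ).totalDegree ≤ k) (τ : Fin M.N) :
    (M.jmpDl τ p).totalDegree ≤ k :=
  (MvPolynomial.totalDegree_sub _ _).trans (max_le (hp τ) (hp _))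

lemma totalDegree_dotL {k : ℕ} {v : M.Vec} (hv : ∀ τ i, (v τ i).totalDegree ≤ k) (a : Pt)
    (τ : Fin M.N) : (M.dotL a v τ).totalDegree ≤ k := by
  have : M.dotL a v τ = a 0 • v τ 0 + a 1 • v τ 1 := by
    simp [dotL, compL, Fin.sum_univ_two]
  rw [this]
  exact (MvPolynomial.totalDegree_add _ _).trans (max_le
    ((MvPolynomial.totalDegree_smul_le _ _).trans (hv τ 0))
    ((MvPolynomial.totalDegree_smul_le _ _).trans (hv τ 1)))

lemma totalDegree_neg_smul {k : ℕ} {p : Poly} (hp : p.totalDegree ≤ k) (r : ℝ) :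
    (r • p).totalDegree ≤ k := (MvPolynomial.totalDegree_smul_le _ _).trans hp

lemma totalDegree_pderiv {k : ℕ} {p : Poly} (hp : p.totalDegree ≤ k) (j : Fin 2) :
    (MvPolynomial.pderiv j p).totalDegree ≤ k := by
  have h := pderiv_mem_lowDeg hp j
  obtain _ | k := k
  · have h0 : MvPolynomial.pderiv j p = 0 := h
    rw [h0]; simp
  · exact ((MvPolynomial.mem_restrictTotalDegree _ _ _).1 h).trans (Nat.le_succ k)

lemma edge_weight {l : ℝ} (hl : 0 < l) (a b : Pt) (f g : Pt → ℝ)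
    (h : ∀ y, f y = (l⁻¹) ^ 2 * g y) : l * edgeInt a b f = l⁻¹ * edgeInt a b g := by
  have : f = fun y => (l⁻¹) ^ 2 * g y := funext h
  rw [this, edgeInt_const_mul]; field_simp

lemma exists_stable_tensor (k : ℕ) {ρE ρB : ℝ} (hρE : 0 < ρE) (hρB : 0 < ρB) :
    ∃ C, 0 < C ∧ ∀ {Ω : Set Pt} (M : StaggeredMesh Ω), M.IsRegular ρE ρB → ∀ v ∈ M.VSpace k,
      ∃ H ∈ M.HSpace k, M.formB H v = M.hNorm v ^ 2 ∧ M.tenInner H H ≤ C * M.hNorm v ^ 2 := by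
  obtain ⟨C, hC, hloc⟩ := exists_local_tensor k (κ := ρE * ρB) (by positivity)
  refine ⟨2 * C, by positivity, fun {Ω} M hM v hv => ?_⟩
  obtain ⟨prev, hprev⟩ := M.next_surjective.hasRightInverse
  have hprev' : ∀ τ, prev (M.next τ) = τ := fun τ => M.next_injective (hprev _)
  let G : Fin M.N → Fin 2 → Fin 2 → Poly := fun τ i j => MvPolynomial.pderiv j (v τ i)
  let j0 : Fin M.N → Fin 2 → Poly := fun τ i => (-(M.lenPr τ)⁻¹) • M.jmpPr τ (M.compL i v)
  let jd : Fin M.N → Poly := fun τ => (-(M.lenDl τ)⁻¹) • M.jmpDl τ (M.dotL (M.tanDl τ) v)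
  have hdegd : ∀ τ, (jd τ).totalDegree ≤ k := fun τ =>
    totalDegree_neg_smul (M.totalDegree_jmpDl (M.totalDegree_dotL hv.1 _) τ) _
  have hex := fun τ => hloc (M.src τ) (M.tgt τ) (M.ctr τ) (Metric.diam (M.primal τ)) (M.ccw_src τ)
    (M.dist_le_diam (M.src_mem_cell τ) (M.tgt_mem_cell τ))
    (M.dist_le_diam (M.tgt_mem_cell τ) (M.ctr_mem_cell τ))
    (M.dist_le_diam (M.ctr_mem_cell τ) (M.src_mem_cell τ))
    (by rw [cross_cyc]; exact hM.area_ge hρB τ) (G τ) (j0 τ) (jd τ) (jd (prev τ))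
    (fun i j => totalDegree_pderiv (hv.1 τ i) j)
    (fun i => totalDegree_neg_smul (M.totalDegree_jmpPr (fun σ => hv.1 σ i) τ) _)
    (hdegd τ) (hdegd _)
  choose H hdeg h0 h1 h2 hmom hbd using hex
  have ev_j0 : ∀ τ i y, ev y (j0 τ i) = -(M.lenPr τ)⁻¹ * M.jumpPr (v.comp i) τ y := by
    intro τ i y
    simp only [j0, ev_smul, ev_jmpPr, ev_compL]
  have ev_jd : ∀ τ y, ev y (jd τ) = -(M.lenDl τ)⁻¹ * M.jumpDl (v.dot (M.tanDl τ)) τ y := by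
    intro τ y
    simp only [jd, ev_smul, ev_jmpDl, ev_dotL]
  have happ : ∀ τ, ∀ y ∈ segment ℝ (M.src τ) (M.tgt τ), ∀ i,
      Ten.app (M := M) H (M.norPr τ) i τ y = -(M.lenPr τ)⁻¹ * M.jumpPr (v.comp i) τ y := by
    intro τ y hy i
    rw [← ev_j0]; exact h0 τ y hy i
  have happ' : ∀ σ τ, M.nbr τ = some σ → ∀ y ∈ segment ℝ (M.src τ) (M.tgt τ), ∀ i,
      Ten.app (M := M) H (M.norPr τ) i σ y = -(M.lenPr τ)⁻¹ * M.jumpPr (v.comp i) τ y := by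
    intro σ τ h y hy i
    have := happ σ y (by rwa [M.segment_nbr h]) i
    rw [M.norPr_nbr h, M.lenPr_nbr h, M.jumpPr_comp_nbr v i h] at this
    simp only [Ten.app, PiLp.neg_apply, mul_neg, Finset.sum_neg_distrib] at this ⊢
    linarith
  have hquad : ∀ τ, ∀ y ∈ segment ℝ (M.tgt τ) (M.ctr τ),
      Ten.quad (M := M) H (M.tanDl τ) (M.norDl τ) τ y =
        -(M.lenDl τ)⁻¹ * M.jumpDl (v.dot (M.tanDl τ)) τ y := by
    intro τ y hy
    rw [← ev_jd]; exact h1 τ y hy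
  have hquad' : ∀ τ, ∀ y ∈ segment ℝ (M.tgt τ) (M.ctr τ),
      Ten.quad (M := M) H (M.tanDl τ) (M.norDl τ) (M.next τ) y =
        -(M.lenDl τ)⁻¹ * M.jumpDl (v.dot (M.tanDl τ)) τ y := by
    intro τ y hy
    have := h2 (M.next τ) y (by rw [M.ctr_next, M.src_next, segment_symm]; exact hy)
    rw [M.ctr_next, M.src_next, hprev', utan_swap, unor_swap, ev_jd] at this
    rw [← this]
    simp [Ten.quad, Ten.app, tanDl, norDl]
    ring
  refine ⟨H, ⟨hdeg, ?_, ?_⟩, ?_, ?_⟩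
  · intro τ hτ y hy i
    obtain ⟨σ, hσ⟩ := Option.isSome_iff_exists.1 hτ
    rw [jumpPr, hσ, Option.elim_some, happ τ y hy i, happ' σ τ hσ y hy i, sub_self]
  · intro τ y hy
    rw [jumpDl, hquad τ y hy, hquad' τ y hy, sub_self]
  · rw [M.hNorm_sq]
    have e1 : (M.meshInt fun τ y => ∑ i, ∑ j, Ten.comp (M := M) H i j τ y * v.grad i j τ y) =
        M.gradSq v := by
      unfold gradSq meshInt
      refine Finset.sum_congr rfl fun τ _ => ?_
      have hz : ∀ i j, M.cellL τ (H τ i j * G τ i j) = M.cellL τ (G τ i j * G τ i j) := by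
        intro i j
        have := hmom τ i j (G τ i j) (pderiv_mem_lowDeg (hv.1 τ i) j)
        rw [← M.cell_eq_src] at this
        change M.cellL τ _ = 0 at this
        rwa [sub_mul, map_sub, sub_eq_zero] at this
      have ha : ∫ y in M.cell τ, ∑ i, ∑ j, Ten.comp (M := M) H i j τ y * v.grad i j τ y =
          M.cellL τ (∑ i, ∑ j, H τ i j * G τ i j) := by
        rw [cellL_apply]; simp only [ev_sum, ev_mul]; rfl
      have hb : ∫ y in M.cell τ, ∑ i, ∑ j, v.grad i j τ y ^ 2 =
          M.cellL τ (∑ i, ∑ j, G τ i j * G τ i j) := by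
        rw [cellL_apply]; simp only [ev_sum, ev_mul, pow_two]; rfl
      rw [ha, hb]
      simp only [map_sum, hz]
    have e2 : (∑ τ ∈ M.plus, M.intPr τ fun y =>
        ∑ i, M.avgPr (Ten.app (M := M) H (M.norPr τ) i) τ y * M.jumpPr (v.comp i) τ y) =
        -M.jumpPrSq v := by
      rw [jumpPrSq, ← Finset.sum_neg_distrib]
      refine Finset.sum_congr rfl fun τ _ => ?_
      rw [intPr, intPr, ← neg_mul, ← edgeInt_const_mul]
      refine edgeInt_congr fun y hy => ?_
      rw [Finset.mul_sum]
      refine Finset.sum_congr rfl fun i _ => ?_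
      have : M.avgPr (Ten.app (M := M) H (M.norPr τ) i) τ y =
          -(M.lenPr τ)⁻¹ * M.jumpPr (v.comp i) τ y := by
        unfold avgPr
        rcases h : M.nbr τ with _ | σ
        · exact happ τ y hy i
        · rw [Option.elim_some, happ τ y hy i, happ' σ τ h y hy i]; ring
      rw [this]; ring
    have e3 : (∑ τ, M.intDl τ fun y =>
        M.avgDl (Ten.quad (M := M) H (M.tanDl τ) (M.norDl τ)) τ y *
          M.jumpDl (v.dot (M.tanDl τ)) τ y) = -M.jumpDlSq v := by
      rw [jumpDlSq, ← Finset.sum_neg_distrib]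
      refine Finset.sum_congr rfl fun τ _ => ?_
      rw [intDl, intDl, ← neg_mul, ← edgeInt_const_mul]
      refine edgeInt_congr fun y hy => ?_
      rw [avgDl, hquad τ y hy, hquad' τ y hy]; ring
    rw [formB, e1, e2, e3]; ring
  · have e : M.tenInner H H = ∑ τ, ∫ y in M.cell τ, ∑ i, ∑ j, ev y (H τ i j) ^ 2 := by
      unfold tenInner meshInt
      simp only [Ten.comp, pow_two]
    let P : Fin M.N → ℝ := fun τ =>
      (M.lenPr τ)⁻¹ * M.intPr τ fun y => ∑ i, M.jumpPr (v.comp i) τ y ^ 2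
    let Q : Fin M.N → ℝ := fun τ =>
      (M.lenDl τ)⁻¹ * M.intDl τ fun y => M.jumpDl (v.dot (M.tanDl τ)) τ y ^ 2
    have hP : ∀ τ, 0 ≤ P τ := fun τ => mul_nonneg (inv_nonneg.2 (M.lenPr_pos τ).le)
      (edgeInt_nonneg fun y => by positivity)
    have hb : ∀ τ, ∫ y in M.cell τ, ∑ i, ∑ j, ev y (H τ i j) ^ 2 ≤
        C * ((∫ y in M.cell τ, ∑ i, ∑ j, v.grad i j τ y ^ 2) + P τ + Q τ + Q (prev τ)) := by
      intro τ
      have h := hbd τ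
      have q1 := edge_weight (M.lenPr_pos τ) (M.src τ) (M.tgt τ) (fun y => ∑ i, ev y (j0 τ i) ^ 2)
        (fun y => ∑ i, M.jumpPr (v.comp i) τ y ^ 2) (fun y => by
          simp only [ev_j0, Fin.sum_univ_two]; ring)
      have q2 := edge_weight (M.lenDl_pos τ) (M.tgt τ) (M.ctr τ) (fun y => ev y (jd τ) ^ 2)
        (fun y => M.jumpDl (v.dot (M.tanDl τ)) τ y ^ 2) (fun y => by
          simp only [ev_jd]; ring)
      have q3 := edge_weight (M.lenDl_pos (prev τ)) (M.tgt (prev τ)) (M.ctr (prev τ))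
        (fun y => ev y (jd (prev τ)) ^ 2)
        (fun y => M.jumpDl (v.dot (M.tanDl (prev τ))) (prev τ) y ^ 2) (fun y => by
          simp only [ev_jd]; ring)
      have s1 : M.src τ = M.tgt (prev τ) := by
        have := M.src_next (prev τ)
        rwa [hprev] at this
      have s2 : M.ctr τ = M.ctr (prev τ) := by
        have := M.ctr_next (prev τ)
        rwa [hprev] at this
      have q3' : dist (M.ctr τ) (M.src τ) * edgeInt (M.ctr τ) (M.src τ)
          (fun y => ev y (jd (prev τ)) ^ 2) = Q (prev τ) := by
        rw [s1, s2, dist_comm, edgeInt_comm]; exact q3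
      rw [q3', ← M.cell_eq_src] at h
      unfold lenPr at q1
      unfold lenDl at q2
      rw [q1, q2] at h
      exact h
    have hs1 : ∑ τ, Q (prev τ) = ∑ τ, Q τ := by
      rw [← M.sum_next]; simp only [hprev']
    have hs2 : ∑ τ, P τ ≤ 2 * ∑ τ ∈ M.plus, P τ := by
      rw [M.sum_primal, Finset.mul_sum]
      refine Finset.sum_le_sum fun τ _ => ?_
      rcases h : M.nbr τ with _ | σ
      · have := hP τ
        simp only [Option.elim_none]; linarith
      · have : P σ = P τ := by
          simp only [P, M.lenPr_nbr h, M.intPr_nbr h, M.jumpPr_comp_nbr v _ h, neg_sq]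
        simp only [Option.elim_some, this]; linarith
    have hs3 := Finset.sum_le_sum fun τ (_ : τ ∈ Finset.univ) => hb τ
    rw [← Finset.mul_sum, Finset.sum_add_distrib, Finset.sum_add_distrib, Finset.sum_add_distrib,
      hs1] at hs3
    have hg := M.gradSq_nonneg v
    rw [e, M.hNorm_sq]
    refine hs3.trans ?_
    rw [mul_comm 2 C, mul_assoc]
    refine mul_le_mul_of_nonneg_left ?_ hC.le
    change M.gradSq v + _ + M.jumpDlSq v + M.jumpDlSq v ≤ _
    have hs4 : ∑ τ ∈ M.plus, P τ = M.jumpPrSq v := rfl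
    linarith

end StaggeredMesh
end
end StaggeredDG

namespace StaggeredDG
noncomputable section
namespace StaggeredMesh

variable {Ω : Set Pt} (M : StaggeredMesh Ω)

/-! ### Discretely divergence free fields -/

lemma jmpPr_dotL_nbr (w : M.Vec) {σ τ : Fin M.N} (h : M.nbr τ = some σ) :
    M.jmpPr σ (M.dotL (M.norPr σ) w) = M.jmpPr τ (M.dotL (M.norPr τ) w) := by
  unfold jmpPr
  rw [h, M.nbr_symm h, M.norPr_nbr h]
  simp only [dotL, Option.elim_some, Fin.sum_univ_two, LinearMap.sub_apply, LinearMap.add_apply,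
    LinearMap.smul_apply, atL_apply, Pi.add_apply, Pi.smul_apply, PiLp.neg_apply, neg_smul, Pi.neg_apply]
  ring

lemma ev_jmpPr_dotL (w : M.Vec) (a : Pt) (τ : Fin M.N) (y : Pt) :
    ev y (M.jmpPr τ (M.dotL a w)) = M.jumpPr (w.dot a) τ y := by
  rw [ev_jmpPr, ev_dotL]

lemma divL_mem_lowDeg {k : ℕ} {w : M.Vec} (hw : ∀ τ i, (w τ i).totalDegree ≤ k) (τ : Fin M.N) :
    M.divL w τ ∈ lowDeg k := by
  have : M.divL w τ = ∑ i, MvPolynomial.pderiv i (w τ i) := by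
    simp [divL, gradL]
  rw [this]
  exact Submodule.sum_mem _ fun i _ => pderiv_mem_lowDeg (hw τ i) i

theorem div_eq_zero_of_formb_eq_zero {k : ℕ} {w : M.Vec} (hw : w ∈ M.VSpace k)
    (hb : ∀ q ∈ M.QSpace k, M.formb w q = 0) :
    (∀ τ y, w.div τ y = 0) ∧ ∀ τ, ∀ y ∈ segment ℝ (M.src τ) (M.tgt τ),
      M.jumpPr (w.dot (M.norPr τ)) τ y = 0 := by
  obtain ⟨C, -, hlift⟩ := exists_lift k
  set J : Fin M.N → Poly := fun τ => M.jmpPr τ (M.dotL (M.norPr τ) w) with hJ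
  have hdiv : ∀ τ y, ev y (M.divL w τ) = w.div τ y := fun τ y => by rw [← ev_divL]
  have hlow := M.divL_mem_lowDeg hw.1
  choose q hqd hqe hqm _ using fun τ => hlift (M.src τ) (M.tgt τ) (M.ctr τ) (M.ccw_src τ) (J τ)
    (-(M.divL w τ)) (M.totalDegree_jmpPr (M.totalDegree_dotL hw.1 _) τ)
    (by rw [MvPolynomial.totalDegree_neg]
        have : M.divL w τ = ∑ i, MvPolynomial.pderiv i (w τ i) := by
          simp [divL, gradL]
        rw [this]
        exact (MvPolynomial.totalDegree_finsetSum_le fun i _ => totalDegree_pderiv (hw.1 τ i) i))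
  have hq : q ∈ M.QSpace k := by
    refine ⟨hqd, fun τ hτ y hy => ?_⟩
    obtain ⟨σ, hσ⟩ := Option.isSome_iff_exists.1 hτ
    have h1 : M.jumpPr (Sca.val q) τ y = ev y (q τ) - ev y (q σ) := by simp [jumpPr, hσ, Sca.val]
    rw [h1, hqe τ y hy, hqe σ y (by rwa [M.segment_nbr hσ])]
    simp only [hJ, M.jmpPr_dotL_nbr w hσ, sub_self]
  have havg : ∀ τ, ∀ y ∈ segment ℝ (M.src τ) (M.tgt τ),
      M.avgPr (Sca.val q) τ y = M.jumpPr (w.dot (M.norPr τ)) τ y := by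
    intro τ y hy
    rw [← ev_jmpPr_dotL]
    rcases hσ : M.nbr τ with _ | σ
    · simpa [avgPr, hσ, Sca.val] using hqe τ y hy
    · have h1 : M.avgPr (Sca.val q) τ y = (ev y (q τ) + ev y (q σ)) / 2 := by
        simp [avgPr, hσ, Sca.val]
      rw [h1, hqe τ y hy, hqe σ y (by rwa [M.segment_nbr hσ])]
      simp only [hJ, M.jmpPr_dotL_nbr w hσ]
      ring
  have hcell : ∀ τ, ∫ y in M.cell τ, Sca.val q τ y * w.div τ y =
      -∫ y in M.cell τ, w.div τ y ^ 2 := by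
    intro τ
    have h1 : M.cellL τ ((q τ - -(M.divL w τ)) * M.divL w τ) = 0 := by
      rw [cellL_apply, cell_eq_src]; exact hqm τ _ (hlow τ)
    have h2 : (q τ - -(M.divL w τ)) * M.divL w τ = q τ * M.divL w τ + M.divL w τ ^ 2 := by ring
    rw [h2, map_add, cellL_apply, cellL_apply] at h1
    simp only [ev_mul, ev_pow, hdiv] at h1
    simp only [Sca.val]
    linarith
  have key : (∑ τ, ∫ y in M.cell τ, w.div τ y ^ 2) +
      ∑ τ ∈ M.plus, M.intPr τ (fun y => M.jumpPr (w.dot (M.norPr τ)) τ y ^ 2) = 0 := by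
    have h := hb q hq
    rw [M.formb_eq_neg hq hw, neg_eq_zero, formbStar, meshInt] at h
    rw [← h, ← Finset.sum_neg_distrib]
    congr 1
    · exact Finset.sum_congr rfl fun τ _ => by rw [hcell, neg_neg]
    · refine Finset.sum_congr rfl fun τ _ => edgeInt_congr fun y hy => ?_
      rw [havg τ y hy, sq]
  have p1 : ∀ τ, 0 ≤ ∫ y in M.cell τ, w.div τ y ^ 2 := fun τ =>
    integral_nonneg fun y => sq_nonneg _
  have p2 : ∀ τ, 0 ≤ M.intPr τ (fun y => M.jumpPr (w.dot (M.norPr τ)) τ y ^ 2) := fun τ =>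
    edgeInt_nonneg fun y => sq_nonneg _
  have s1 := Finset.sum_nonneg fun τ (_ : τ ∈ Finset.univ) => p1 τ
  have s2 := Finset.sum_nonneg fun τ (_ : τ ∈ M.plus) => p2 τ
  have z1 := (Finset.sum_eq_zero_iff_of_nonneg fun τ _ => p1 τ).1 (by linarith)
  have z2 := (Finset.sum_eq_zero_iff_of_nonneg fun τ _ => p2 τ).1 (by linarith)
  have e2 : ∀ τ ∈ M.plus, ∀ y ∈ segment ℝ (M.src τ) (M.tgt τ),
      M.jumpPr (w.dot (M.norPr τ)) τ y = 0 := fun τ hτ =>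
    eq_zero_of_edgeInt_sq (M.src_ne_tgt τ)
      (M.continuous_jumpPr (fun σ => M.continuous_dot w _ σ) τ) (z2 τ hτ)
  refine ⟨fun τ y => ?_, fun τ y hy => ?_⟩
  · have h0 : M.divL w τ = 0 := by
      refine eq_zero_of_integral_sq (M.isCompact_cell τ) (M.interior_cell_nonempty τ) ?_
      simpa only [hdiv] using z1 τ (Finset.mem_univ τ)
    rw [← hdiv, h0, ev_zero]
  · by_cases hτ : τ ∈ M.plus
    · exact e2 τ hτ y hy
    · rcases hσ : M.nbr τ with _ | σ
      · exact absurd (M.plus_boundary τ hσ) hτ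
      · have hσ' : σ ∈ M.plus := by
          by_contra h; exact hτ ((M.plus_interior σ τ hσ).2 h)
        have := e2 σ hσ' y (by rwa [M.segment_nbr hσ])
        rwa [← ev_jmpPr_dotL, M.jmpPr_dotL_nbr w hσ, ev_jmpPr_dotL] at this

end StaggeredMesh
end
end StaggeredDG

namespace StaggeredDG
noncomputable section

lemma clm_apply_toLp (L : Pt →L[ℝ] ℝ) (a : Fin 2 → ℝ) :
    L (WithLp.toLp 2 a) = ∑ j, a j * L (EuclideanSpace.single j 1) := by
  have h : (WithLp.toLp 2 a : Pt) = ∑ j, a j • EuclideanSpace.single j (1 : ℝ) := by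
    ext i; fin_cases i <;> simp
  rw [h, map_sum]
  simp

/-- The open triangle. -/
def openTri (a b c : Pt) : Set Pt :=
  {x | 0 < cross (b - a) (x - a) ∧ 0 < cross (c - b) (x - b) ∧ 0 < cross (a - c) (x - c)}

lemma isOpen_openTri (a b c : Pt) : IsOpen (openTri a b c) :=
  (isOpen_lt continuous_const (continuous_cross_sub a b)).inter
    ((isOpen_lt continuous_const (continuous_cross_sub b c)).inter
      (isOpen_lt continuous_const (continuous_cross_sub c a)))

lemma openTri_nonempty {a b c : Pt} (hD : 0 < cross (b - a) (c - a)) : (openTri a b c).Nonempty := by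
  refine ⟨tri a b c (1 / 3) (1 / 3), ?_, ?_, ?_⟩ <;> simp [tri, cross] at hD ⊢ <;> linarith

lemma openTri_subset {a b c : Pt} (hD : 0 < cross (b - a) (c - a)) :
    openTri a b c ⊆ interior (convexHull ℝ ({a, b, c} : Set Pt)) :=
  fun _ hx => mem_interior_hull hD hx.1 hx.2.1 hx.2.2

lemma cross_eq_zero_of_mem_segment {a b x : Pt} (hx : x ∈ segment ℝ a b) :
    cross (b - a) (x - a) = 0 := by
  rw [segment_eq_image_lineMap] at hx
  obtain ⟨s, -, rfl⟩ := hx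
  simp [AffineMap.lineMap_apply, cross]; ring

lemma edgeInt_mul_eq_zero {a b : Pt} {φ g : Pt → ℝ} (h : ∀ y ∈ segment ℝ a b, φ y = 0) :
    edgeInt a b (fun y => φ y * g y) = 0 := by
  rw [edgeInt_congr (g := fun _ => 0) fun y hy => by rw [h y hy, zero_mul]]
  simp [edgeInt]

namespace StaggeredMesh

variable {Ω : Set Pt} (M : StaggeredMesh Ω)

/-! ### The domain and the triangles -/

lemma interior_cell_subset (τ : Fin M.N) : interior (M.cell τ) ⊆ Ω :=
  (interior_mono (Set.subset_iUnion (fun τ => M.cell τ) τ)).trans_eq M.domain_eq.symm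

lemma volume_frontier_cell (τ : Fin M.N) : volume (frontier (M.cell τ)) = 0 :=
  (M.convex_cell τ).addHaar_frontier volume

lemma interior_cell_ae (τ : Fin M.N) : ∀ᵐ y ∂volume.restrict (M.cell τ), y ∈ interior (M.cell τ) := by
  rw [ae_restrict_iff' (M.measurableSet_cell τ), ae_iff]
  refine measure_mono_null (fun y hy => ?_) (M.volume_frontier_cell τ)
  simp only [Classical.not_imp, Set.mem_ofPred_eq] at hy
  exact ⟨subset_closure hy.1, hy.2⟩

lemma restrict_domain :
    volume.restrict Ω = ∑ τ, (volume : Measure Pt).restrict (M.cell τ) := by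
  have h1 : volume.restrict Ω = volume.restrict (⋃ τ, M.cell τ) := by
    refine Measure.restrict_congr_set (Filter.eventuallyLE_antisymm_iff.2 ⟨?_, ?_⟩)
    · exact Filter.Eventually.of_forall (M.domain_eq.subset.trans interior_subset)
    · rw [ae_le_set]
      refine measure_mono_null (t := ⋃ τ, frontier (M.cell τ)) ?_
        (measure_iUnion_null M.volume_frontier_cell)
      rintro y ⟨hy, hyΩ⟩
      obtain ⟨τ, hτ⟩ := Set.mem_iUnion.1 hy
      exact Set.mem_iUnion.2 ⟨τ, subset_closure hτ, fun h => hyΩ (M.interior_cell_subset τ h)⟩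
  rw [h1, Measure.restrict_iUnion_ae (fun σ τ h => M.volume_inter_cell h)
    fun τ => (M.measurableSet_cell τ).nullMeasurableSet, Measure.sum_fintype]

lemma integral_domain {h : Pt → ℝ} (hi : IntegrableOn h Ω) :
    ∫ y in Ω, h y = ∑ τ, ∫ y in M.cell τ, h y := by
  unfold IntegrableOn at hi
  rw [M.restrict_domain] at hi ⊢
  exact integral_finsetSum_measure (integrable_finsetSum_measure.1 hi)

lemma integrableOn_domain_iff {h : Pt → ℝ} :
    IntegrableOn h Ω ↔ ∀ τ, IntegrableOn h (M.cell τ) := by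
  unfold IntegrableOn
  rw [M.restrict_domain, integrable_finsetSum_measure]
  simp

lemma restrict_cell_le (τ : Fin M.N) :
    (volume : Measure Pt).restrict (M.cell τ) ≤ volume.restrict Ω := by
  rw [M.restrict_domain]
  exact Finset.single_le_sum (f := fun τ => (volume : Measure Pt).restrict (M.cell τ))
    (fun _ _ => Measure.zero_le _) (Finset.mem_univ τ)

lemma integral_domain_piecewise {h : Pt → ℝ} {H : Fin M.N → Pt → ℝ} (hc : ∀ τ, Continuous (H τ))
    (he : ∀ τ, ∀ y ∈ interior (M.cell τ), h y = H τ y) :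
    ∫ y in Ω, h y = ∑ τ, ∫ y in M.cell τ, H τ y := by
  have hae : ∀ τ, H τ =ᵐ[volume.restrict (M.cell τ)] h := fun τ => by
    filter_upwards [M.interior_cell_ae τ] with y hy using (he τ y hy).symm
  rw [M.integral_domain (M.integrableOn_domain_iff.2 fun τ =>
    ((hc τ).continuousOn.integrableOn_compact (M.isCompact_cell τ)).congr (hae τ))]
  exact Finset.sum_congr rfl fun τ _ => (integral_congr_ae (hae τ)).symm

lemma disjoint_open_cell {τ : Fin M.N} {s : Finset (Fin M.N)} (hτ : τ ∉ s) {U : Set Pt}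
    (hU : IsOpen U) (hs : U ⊆ ⋃ σ ∈ s, M.cell σ) : Disjoint (interior (M.cell τ)) U := by
  rw [Set.disjoint_iff_inter_eq_empty]
  refine (isOpen_interior.inter hU).eq_empty_of_measure_zero (μ := volume) ?_
  refine measure_mono_null (t := ⋃ σ ∈ s, M.cell σ ∩ M.cell τ) ?_ ?_
  · rintro y ⟨h1, h2⟩
    obtain ⟨σ, hσ, h3⟩ := Set.mem_iUnion₂.1 (hs h2)
    exact Set.mem_iUnion₂.2 ⟨σ, hσ, h3, interior_subset h1⟩
  · exact (measure_biUnion_null_iff s.countable_toSet).2 fun σ hσ =>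
      M.volume_inter_cell fun h => hτ (h ▸ hσ)

lemma glue_eq (v : M.Vec) {τ : Fin M.N} {y : Pt} (hy : y ∈ interior (M.cell τ)) :
    v.glue y = WithLp.toLp 2 fun i => ev y (v τ i) := by
  unfold Vec.glue
  rw [Finset.sum_eq_single τ, Set.indicator_of_mem hy]
  · intro σ _ hσ
    refine Set.indicator_of_notMem (fun h => ?_) _
    have := M.disjoint_open_cell (s := {τ}) (by simpa using hσ) (U := interior (M.cell τ))
      isOpen_interior (by simpa using interior_subset)
    exact this.le_bot ⟨h, hy⟩
  · simp

/-! ### Fields with vanishing weak divergence -/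

lemma green_test (z : M.Vec) (τ : Fin M.N) {φ : Pt → ℝ} (hφ : ContDiff ℝ 1 φ) :
    ∫ y in M.cell τ, (fderiv ℝ φ y (WithLp.toLp 2 fun i => ev y (z τ i)) + φ y * z.div τ y) =
      M.intPr τ (fun y => φ y * z.dot (M.norPr τ) τ y) +
      M.intDl τ (fun y => φ y * z.dot (M.norDl τ) τ y) +
      edgeInt (M.ctr τ) (M.src τ) (fun y => φ y * z.dot (unor (M.ctr τ) (M.src τ)) τ y) := by
  have hz : ∀ j, ContDiff ℝ 1 fun y : Pt => ev y (z τ j) := fun j =>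
    (contDiff_ev _).of_le (by simp)
  have h := M.integral_cell_fderiv τ (f := fun j y => φ y * ev y (z τ j)) fun j => hφ.mul (hz j)
  have e1 : ∀ y j, fderiv ℝ (fun y => φ y * ev y (z τ j)) y (EuclideanSpace.single j 1) =
      φ y * z.grad j j τ y + ev y (z τ j) * fderiv ℝ φ y (EuclideanSpace.single j 1) := by
    intro y j
    rw [fderiv_fun_mul (hφ.differentiable one_ne_zero y) ((hz j).differentiable one_ne_zero y)]
    simp [fderiv_ev, Vec.grad]
  simp only [e1] at h
  simp only [clm_apply_toLp, Vec.div, Vec.dot, Finset.mul_sum, ← mul_assoc]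
  rw [← h]
  refine integral_congr_ae (Filter.Eventually.of_forall fun y => ?_)
  simp only [Fin.sum_univ_two]
  ring

lemma sum_integral_fderiv_eq_zero {z : M.Vec} (hz : HasWeakDiv Ω z.glue 0) {s : Finset (Fin M.N)}
    {U : Set Pt} (hU : IsOpen U) (hs : U ⊆ ⋃ σ ∈ s, M.cell σ) {φ : Pt → ℝ} (hφ : ContDiff ℝ ∞ φ)
    (hc : HasCompactSupport φ) (hφU : tsupport φ ⊆ U) :
    ∑ τ ∈ s, ∫ y in M.cell τ, fderiv ℝ φ y (WithLp.toLp 2 fun i => ev y (z τ i)) = 0 := by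
  have hUΩ : U ⊆ Ω := by
    have : U ⊆ interior (⋃ τ, M.cell τ) := interior_maximal
      (hs.trans (Set.iUnion₂_subset fun σ _ => Set.subset_iUnion _ σ)) hU
    exact this.trans_eq M.domain_eq.symm
  have h := hz φ ⟨hφ, hc, hφU.trans hUΩ⟩
  have hcont : ∀ τ, Continuous fun y => fderiv ℝ φ y (WithLp.toLp 2 fun i => ev y (z τ i)) := by
    intro τ
    refine (hφ.continuous_fderiv (by simp)).clm_apply ?_
    exact (PiLp.continuous_toLp 2 _).comp (continuous_pi fun i => continuous_ev _)
  rw [M.integral_domain_piecewise (h := fun y => fderiv ℝ φ y (z.glue y)) hcont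
    fun τ y hy => by rw [M.glue_eq z hy]] at h
  simp only [Pi.zero_apply, zero_mul, integral_zero, neg_zero] at h
  rw [← h]
  refine Finset.sum_subset (Finset.subset_univ s) fun τ _ hτ => ?_
  refine integral_eq_zero_of_ae ?_
  filter_upwards [M.interior_cell_ae τ] with y hy
  have hy' : y ∉ tsupport φ := fun h =>
    (M.disjoint_open_cell hτ hU hs).le_bot ⟨hy, hφU h⟩
  have : fderiv ℝ φ y = 0 := image_eq_zero_of_notMem_tsupport fun h' =>
    hy' (tsupport_fderiv_subset ℝ h')
  simp [this]

lemma zero_of_tsupport {φ : Pt → ℝ} {U : Set Pt} {a b : Pt} (hφU : tsupport φ ⊆ U)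
    (hU : ∀ y ∈ U, cross (b - a) (y - a) ≠ 0) : ∀ y ∈ segment ℝ a b, φ y = 0 := fun _ hy =>
  image_eq_zero_of_notMem_tsupport fun h => hU _ (hφU h) (cross_eq_zero_of_mem_segment hy)

lemma div_eq_zero_of_hasWeakDiv {z : M.Vec} (hz : HasWeakDiv Ω z.glue 0) (τ : Fin M.N) (y : Pt) :
    z.div τ y = 0 := by
  have hdiv : ∀ y, ev y (M.divL z τ) = z.div τ y := fun y => by rw [← ev_divL]
  set U := openTri (M.ctr τ) (M.src τ) (M.tgt τ) with hU
  have hUc : U ⊆ interior (M.cell τ) := openTri_subset (M.ccw τ)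
  suffices h : M.divL z τ = 0 by rw [← hdiv, h, ev_zero]
  refine eq_zero_of_ev_eq_zero (isOpen_openTri _ _ _) (openTri_nonempty (M.ccw τ)) fun x hx => ?_
  obtain ⟨ψ, h1, h2, h3, -, h5⟩ := exists_contDiff_tsupport_subset (n := ⊤)
    ((isOpen_openTri _ _ _).mem_nhds hx)
  have h3' : ContDiff ℝ ∞ ψ := h3
  set d : Pt → ℝ := fun y => ev y (M.divL z τ) with hd
  have hds : ContDiff ℝ ∞ d := contDiff_ev _
  set φ : Pt → ℝ := fun y => ψ y * (ψ y * d y) with hφ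
  have hφs : ContDiff ℝ ∞ φ := h3'.mul (h3'.mul hds)
  have hts : tsupport φ ⊆ tsupport ψ := tsupport_mul_subset_left
  have g := M.green_test z τ (hφs.of_le (by simp))
  have n1 := zero_of_tsupport (a := M.src τ) (b := M.tgt τ) (hts.trans h1) fun y hy => hy.2.1.ne'
  have n2 := zero_of_tsupport (a := M.tgt τ) (b := M.ctr τ) (hts.trans h1) fun y hy => hy.2.2.ne'
  have n3 := zero_of_tsupport (a := M.ctr τ) (b := M.src τ) (hts.trans h1) fun y hy => hy.1.ne'
  rw [intPr, intDl, edgeInt_mul_eq_zero n1, edgeInt_mul_eq_zero n2, edgeInt_mul_eq_zero n3] at g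
  have w := M.sum_integral_fderiv_eq_zero hz (s := {τ}) (U := U) (isOpen_openTri _ _ _)
    (by simpa using hUc.trans interior_subset) hφs h2.mul_right (hts.trans h1)
  rw [Finset.sum_singleton] at w
  have c1 : Continuous fun y => fderiv ℝ φ y (WithLp.toLp 2 fun i => ev y (z τ i)) :=
    (hφs.continuous_fderiv (by simp)).clm_apply
      ((PiLp.continuous_toLp 2 _).comp (continuous_pi fun i => continuous_ev _))
  have c2 : Continuous fun y => φ y * z.div τ y := hφs.continuous.mul (M.continuous_div z τ)
  rw [integral_add (c1.continuousOn.integrableOn_compact (M.isCompact_cell τ))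
    (c2.continuousOn.integrableOn_compact (M.isCompact_cell τ)), w, zero_add] at g
  have e : ∀ y, φ y * z.div τ y = (ψ y * d y) ^ 2 := fun y => by
    simp only [hφ, hd, hdiv]; ring
  simp only [e, add_zero] at g
  have c3 : Continuous fun y => (ψ y * d y) ^ 2 := (h3'.continuous.mul hds.continuous).pow 2
  rw [setIntegral_eq_zero_iff_of_nonneg_ae (Filter.Eventually.of_forall fun y => sq_nonneg _)
    (c3.continuousOn.integrableOn_compact (M.isCompact_cell τ))] at g
  have g' := Measure.eqOn_open_of_ae_eq (ae_restrict_of_ae_restrict_of_subset interior_subset g)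
    isOpen_interior c3.continuousOn continuousOn_const (hUc hx)
  simpa [h5, hd] using g'

lemma jump_eq_zero_of_hasWeakDiv {z : M.Vec} (hz : HasWeakDiv Ω z.glue 0) {σ τ : Fin M.N}
    (hn : M.nbr τ = some σ) : ∀ y ∈ segment ℝ (M.src τ) (M.tgt τ),
      M.jumpPr (z.dot (M.norPr τ)) τ y = 0 := by
  have hn' := (M.nbr_eq_some σ τ).1 hn
  have hne : τ ≠ σ := by
    rintro rfl
    exact M.src_ne_tgt τ hn'.1
  set U : Set Pt := {x | 0 < cross (M.src τ - M.ctr τ) (x - M.ctr τ)} ∩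
    {x | 0 < cross (M.ctr τ - M.tgt τ) (x - M.tgt τ)} ∩
    ({x | 0 < cross (M.src σ - M.ctr σ) (x - M.ctr σ)} ∩
    {x | 0 < cross (M.ctr σ - M.tgt σ) (x - M.tgt σ)}) with hU
  have hUo : IsOpen U := ((isOpen_lt continuous_const (continuous_cross_sub _ _)).inter
    (isOpen_lt continuous_const (continuous_cross_sub _ _))).inter
    ((isOpen_lt continuous_const (continuous_cross_sub _ _)).inter
    (isOpen_lt continuous_const (continuous_cross_sub _ _)))
  have hUs : U ⊆ ⋃ ρ ∈ ({τ, σ} : Finset (Fin M.N)), M.cell ρ := by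
    intro x hx
    rcases le_total 0 (cross (M.tgt τ - M.src τ) (x - M.src τ)) with h | h
    · exact Set.mem_iUnion₂.2 ⟨τ, by simp, (mem_hull_iff (M.ccw τ) x).2 ⟨hx.1.1.le, h, hx.1.2.le⟩⟩
    · refine Set.mem_iUnion₂.2 ⟨σ, by simp, (mem_hull_iff (M.ccw σ) x).2 ⟨hx.2.1.le, ?_, hx.2.2.le⟩⟩
      rw [hn'.1, hn'.2]
      simp [cross] at h ⊢
      linarith
  set g : Pt → ℝ := M.jumpPr (z.dot (M.norPr τ)) τ with hg
  have hge : g = fun y => ev y (M.jmpPr τ (M.dotL (M.norPr τ) z)) := by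
    funext y; rw [ev_jmpPr_dotL]
  have hgs : ContDiff ℝ ∞ g := by rw [hge]; exact contDiff_ev _
  have hopen : ∀ s ∈ Set.Ioo (0 : ℝ) 1, g (AffineMap.lineMap (M.src τ) (M.tgt τ) s) = 0 := by
    intro s hs
    set x := AffineMap.lineMap (M.src τ) (M.tgt τ) s with hxdef
    have hs1 : 0 < 1 - s := by linarith [hs.2]
    have hx : x ∈ U := by
      have A := M.ccw τ
      have B := M.ccw σ
      rw [hn'.1, hn'.2] at B
      have P1 := mul_pos hs.1 A
      have P2 := mul_pos hs1 A
      have P3 := mul_pos hs.1 B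
      have P4 := mul_pos hs1 B
      simp only [hU, Set.mem_inter_iff, Set.mem_ofPred_eq, hn'.1, hn'.2, hxdef]
      refine ⟨⟨?_, ?_⟩, ?_, ?_⟩ <;>
        simp [AffineMap.lineMap_apply, cross] at P1 P2 P3 P4 ⊢ <;> nlinarith
    obtain ⟨ψ, h1, h2, h3, -, h5⟩ := exists_contDiff_tsupport_subset (n := ⊤) (hUo.mem_nhds hx)
    have h3' : ContDiff ℝ ∞ ψ := h3
    set φ : Pt → ℝ := fun y => ψ y * (ψ y * g y) with hφ
    have hφs : ContDiff ℝ ∞ φ := h3'.mul (h3'.mul hgs)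
    have hts : tsupport φ ⊆ U := tsupport_mul_subset_left.trans h1
    have w := M.sum_integral_fderiv_eq_zero hz hUo hUs hφs h2.mul_right hts
    rw [Finset.sum_pair hne] at w
    have gτ := M.green_test z τ (hφs.of_le (by simp))
    have gσ := M.green_test z σ (hφs.of_le (by simp))
    have d0 := M.div_eq_zero_of_hasWeakDiv hz
    simp only [d0, mul_zero, add_zero] at gτ gσ
    rw [gτ, gσ, intDl, intDl,
      edgeInt_mul_eq_zero (zero_of_tsupport hts fun y hy => hy.1.2.ne'),
      edgeInt_mul_eq_zero (zero_of_tsupport hts fun y hy => hy.1.1.ne'),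
      edgeInt_mul_eq_zero (zero_of_tsupport hts fun y hy => hy.2.2.ne'),
      edgeInt_mul_eq_zero (zero_of_tsupport hts fun y hy => hy.2.1.ne'),
      M.intPr_nbr hn, M.norPr_nbr hn] at w
    have e : M.intPr τ (fun y => (ψ y * g y) ^ 2) = 0 := by
      rw [← w, add_zero, add_zero, add_zero, add_zero, intPr, intPr, intPr]
      have c : ∀ a ρ, Continuous fun y => φ y * z.dot a ρ y := fun a ρ =>
        hφs.continuous.mul (M.continuous_dot z a ρ)
      rw [← edgeInt_add _ _ (c _ _) (c _ _)]
      congr 1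
      funext y
      simp only [dot_neg, hφ, hg, jumpPr, hn, Option.elim_some]
      ring
    have := eq_zero_of_edgeInt_sq (M.src_ne_tgt τ) (h3'.continuous.mul hgs.continuous) e x (by
      rw [segment_eq_image_lineMap]
      exact ⟨s, Set.Ioo_subset_Icc_self hs, rfl⟩)
    simpa [h5] using this
  intro y hy
  rw [segment_eq_image_lineMap] at hy
  obtain ⟨s, hs, rfl⟩ := hy
  have hcl : s ∈ closure (Set.Ioo (0 : ℝ) 1) := by rwa [closure_Ioo zero_ne_one]
  exact Set.EqOn.closure (f := fun s => g (AffineMap.lineMap (M.src τ) (M.tgt τ) s)) (g := fun _ => 0)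
    hopen (hgs.continuous.comp AffineMap.lineMap_continuous) continuous_const hcl

end StaggeredMesh
end
end StaggeredDG

namespace StaggeredDG
noncomputable section

open Filter Topology Convolution in
lemma integral_dilated_kernel {K : Set Pt} (hK : MeasurableSet K) (F : Pt → ℝ) (ρ : Pt → ℝ)
    (c x : Pt) {l : ℝ} (hl : 0 < l) :
    ∫ y in K, F y * ρ (x - (c + l • (y - c))) =
      (l ^ 2)⁻¹ * (ρ ⋆[ContinuousLinearMap.lsmul ℝ ℝ, volume]
        fun z => K.indicator F (c + l⁻¹ • (z - c))) x := by
  have h1 : ∫ y in K, F y * ρ (x - (c + l • (y - c))) =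
      ∫ y, K.indicator F y * ρ (x - (c + l • (y - c))) := by
    rw [← integral_indicator hK]
    refine integral_congr_ae (Eventually.of_forall fun y => ?_)
    by_cases hy : y ∈ K <;> simp [hy]
  set Φ : Pt → ℝ := fun y => K.indicator F y * ρ (x - (c + l • (y - c))) with hΦ
  have h2 : (ρ ⋆[ContinuousLinearMap.lsmul ℝ ℝ, volume]
      fun z => K.indicator F (c + l⁻¹ • (z - c))) x = ∫ t, Φ (c + l⁻¹ • (x - c - t)) := by
    unfold convolution
    refine integral_congr_ae (Eventually.of_forall fun t => ?_)
    have e : x - (c + l • (c + l⁻¹ • (x - c - t) - c)) = t := by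
      rw [add_sub_cancel_left, smul_smul, mul_inv_cancel₀ hl.ne', one_smul]; abel
    have e2 : x - t - c = x - c - t := by abel
    simp only [hΦ, e, e2, ContinuousLinearMap.lsmul_apply, smul_eq_mul]
    ring
  rw [h1, h2, integral_sub_left_eq_self (fun t => Φ (c + l⁻¹ • t)),
    Measure.integral_comp_smul volume (fun t => Φ (c + t)), integral_add_left_eq_self Φ]
  have : |((l⁻¹) ^ Module.finrank ℝ Pt)⁻¹| = l ^ 2 := by
    rw [finrank_euclideanSpace_fin, inv_pow, inv_inv, abs_of_nonneg (by positivity)]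
  rw [this, smul_eq_mul, ← mul_assoc, inv_mul_cancel₀ (by positivity), one_mul]

open Filter Topology Convolution in
lemma tendsto_integral_dilated_kernel {K : Set Pt} (hK : MeasurableSet K) {F : Pt → ℝ}
    (hF : Continuous F) (c : Pt) {l : ℕ → ℝ} (hl : ∀ n, 0 < l n) (hl1 : Tendsto l atTop (𝓝 1))
    (ρ : ℕ → ContDiffBump (0 : Pt)) (hρ : Tendsto (fun n => (ρ n).rOut) atTop (𝓝 0))
    {x : Pt} (hx : x ∉ frontier K) :
    Tendsto (fun n => ∫ y in K, F y * (ρ n).normed volume (x - (c + l n • (y - c)))) atTop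
      (𝓝 (K.indicator F x)) := by
  have hcont : ContinuousAt (K.indicator F) x := by
    rw [frontier_eq_closure_inter_closure, Set.mem_inter_iff, not_and_or] at hx
    rcases hx with hx | hx
    · have : K.indicator F =ᶠ[𝓝 x] fun _ => 0 := by
        filter_upwards [isClosed_closure.isOpen_compl.mem_nhds hx] with y hy
        exact Set.indicator_of_notMem (fun h => hy (subset_closure h)) F
      exact continuousAt_const.congr this.symm
    · have : K.indicator F =ᶠ[𝓝 x] F := by
        filter_upwards [isClosed_closure.isOpen_compl.mem_nhds hx] with y hy
        refine Set.indicator_of_mem ?_ F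
        by_contra h
        exact hy (subset_closure h)
      exact hF.continuousAt.congr this.symm
  have hlim : Tendsto (fun p : ℕ × Pt => c + (l p.1)⁻¹ • (p.2 - c)) (atTop ×ˢ 𝓝 x) (𝓝 x) := by
    have h1 : Tendsto (fun p : ℕ × Pt => (l p.1)⁻¹) (atTop ×ˢ 𝓝 x) (𝓝 1) := by
      have h0 : Tendsto (fun n => (l n)⁻¹) atTop (𝓝 1) := by simpa using hl1.inv₀ one_ne_zero
      exact h0.comp tendsto_fst
    have h2 : Tendsto (fun p : ℕ × Pt => p.2 - c) (atTop ×ˢ 𝓝 x) (𝓝 (x - c)) :=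
      (tendsto_snd (f := (atTop : Filter ℕ)) (g := 𝓝 x)).sub_const c
    simpa using (h1.smul h2).const_add c
  have hconv := ContDiffBump.convolution_tendsto_right (μ := (volume : Measure Pt)) (φ := ρ)
    (g := fun n z => K.indicator F (c + (l n)⁻¹ • (z - c))) (k := fun _ => x) hρ
    (Eventually.of_forall fun n => ((hF.measurable.indicator hK).comp
      (by fun_prop : Continuous fun z : Pt => c + (l n)⁻¹ • (z - c)).measurable).aestronglyMeasurable)
    (hcont.tendsto.comp hlim) tendsto_const_nhds
  have hsq : Tendsto (fun n => ((l n) ^ 2)⁻¹) atTop (𝓝 1) := by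
    simpa using (hl1.pow 2).inv₀ (by norm_num)
  simpa [integral_dilated_kernel hK F _ c x (hl _)] using hsq.mul hconv

open Filter Topology Convolution in
lemma abs_integral_dilated_kernel_le {K : Set Pt} (hK : MeasurableSet K) {F : Pt → ℝ} {B : ℝ}
    (hB : ∀ y ∈ K, |F y| ≤ B) (hB0 : 0 ≤ B) (c x : Pt) {l : ℝ} (hl : 0 < l)
    (ρ : ContDiffBump (0 : Pt)) :
    |∫ y in K, F y * ρ.normed volume (x - (c + l • (y - c)))| ≤ (l ^ 2)⁻¹ * B := by
  rw [integral_dilated_kernel hK F _ c x hl, abs_mul, abs_of_nonneg (by positivity)]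
  refine mul_le_mul_of_nonneg_left ?_ (by positivity)
  have h : ‖∫ t, ρ.normed volume t * K.indicator F (c + l⁻¹ • (x - t - c))‖ ≤
      ∫ t, ρ.normed volume t * B := by
    refine norm_integral_le_of_norm_le (ρ.integrable_normed.mul_const B)
      (Eventually.of_forall fun t => ?_)
    rw [norm_mul, Real.norm_of_nonneg (ρ.nonneg_normed t)]
    refine mul_le_mul_of_nonneg_left ?_ (ρ.nonneg_normed t)
    by_cases hy : c + l⁻¹ • (x - t - c) ∈ K
    · rw [Set.indicator_of_mem hy]; exact hB _ hy
    · rw [Set.indicator_of_notMem hy, norm_zero]; exact hB0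
  rw [integral_mul_const, ρ.integral_normed, one_mul] at h
  exact h

open Filter Topology in
/-- Convergence of the integrals against dilated mollifications. -/
lemma tendsto_integral_mul_dilated_kernel {Ω K : Set Pt} (hK : IsCompact K)
    (hfr : volume (frontier K) = 0) {F : Pt → ℝ}
    (hF : Continuous F) (c : Pt) {l : ℕ → ℝ} (hl : ∀ n, 2⁻¹ ≤ l n) (hl1 : Tendsto l atTop (𝓝 1))
    (ρ : ℕ → ContDiffBump (0 : Pt)) (hρ : Tendsto (fun n => (ρ n).rOut) atTop (𝓝 0))
    {h : Pt → ℝ} (hh : IntegrableOn h Ω) :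
    Tendsto (fun n => ∫ x in Ω, h x *
      ∫ y in K, F y * (ρ n).normed volume (x - (c + l n • (y - c)))) atTop
      (𝓝 (∫ x in Ω, h x * K.indicator F x)) := by
  obtain ⟨B, hB⟩ := hK.exists_bound_of_continuousOn hF.continuousOn
  have hl0 : ∀ n, 0 < l n := fun n => lt_of_lt_of_le (by norm_num) (hl n)
  have hm : ∀ n, StronglyMeasurable fun x : Pt =>
      ∫ y in K, F y * (ρ n).normed volume (x - (c + l n • (y - c))) := by
    intro n
    refine StronglyMeasurable.integral_prod_right
      (f := fun (x y : Pt) => F y * (ρ n).normed volume (x - (c + l n • (y - c)))) ?_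
    have := (ρ n).continuous_normed (μ := (volume : Measure Pt))
    exact (by fun_prop : Continuous fun p : Pt × Pt =>
      F p.2 * (ρ n).normed volume (p.1 - (c + l n • (p.2 - c)))).stronglyMeasurable
  refine tendsto_integral_of_dominated_convergence (fun x => |h x| * (4 * max B 0))
    (fun n => hh.aestronglyMeasurable.mul (hm n).aestronglyMeasurable) (hh.abs.mul_const _)
    (fun n => Eventually.of_forall fun x => ?_) ?_
  · rw [norm_mul]
    refine mul_le_mul_of_nonneg_left ?_ (abs_nonneg _)
    refine (abs_integral_dilated_kernel_le hK.measurableSet (B := max B 0)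
      (fun y hy => (hB y hy).trans (le_max_left _ _)) (le_max_right _ _) c x (hl0 n) (ρ n)).trans ?_
    refine mul_le_mul_of_nonneg_right ?_ (le_max_right _ _)
    rw [inv_le_comm₀ (pow_pos (hl0 n) 2) (by norm_num)]
    nlinarith [hl n]
  · have hae : ∀ᵐ x ∂volume.restrict Ω, x ∉ frontier K :=
      ae_restrict_of_ae (measure_eq_zero_iff_ae_notMem.1 hfr)
    filter_upwards [hae] with x hx
    exact (tendsto_integral_dilated_kernel hK.measurableSet hF c hl0 hl1 ρ hρ hx).const_mul _

lemma integrable_mul_kernel {Ω K : Set Pt} (hK : IsCompact K) {F h : Pt → ℝ}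
    (hF : Continuous F) (hh : IntegrableOn h Ω) {ρ : Pt → Pt → ℝ}
    (hρ : Continuous fun p : Pt × Pt => ρ p.1 p.2) {B : ℝ} (hB : ∀ x y, |ρ x y| ≤ B) :
    Integrable (fun p : Pt × Pt => h p.1 * (F p.2 * ρ p.1 p.2))
      ((volume.restrict Ω).prod (volume.restrict K)) := by
  have hFi : IntegrableOn F K := hF.continuousOn.integrableOn_compact hK
  have := (hh.mul_prod hFi).mul_bdd (c := B) hρ.aestronglyMeasurable
    (Filter.Eventually.of_forall fun p => hB p.1 p.2)
  refine this.congr (Filter.Eventually.of_forall fun p => ?_)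
  simp only; ring

lemma integrableOn_mul_integral_kernel {Ω K : Set Pt} (hK : IsCompact K) {F h : Pt → ℝ}
    (hF : Continuous F) (hh : IntegrableOn h Ω) {ρ : Pt → Pt → ℝ}
    (hρ : Continuous fun p : Pt × Pt => ρ p.1 p.2) {B : ℝ} (hB : ∀ x y, |ρ x y| ≤ B) :
    IntegrableOn (fun x => h x * ∫ y in K, F y * ρ x y) Ω := by
  have := (integrable_mul_kernel hK hF hh hρ hB).integral_prod_left
  simp only [integral_const_mul] at this
  exact this

/-- Fubini's theorem for a bounded continuous kernel. -/
lemma integral_mul_kernel_swap {Ω K : Set Pt} (hK : IsCompact K) {F h : Pt → ℝ}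
    (hF : Continuous F) (hh : IntegrableOn h Ω) {ρ : Pt → Pt → ℝ}
    (hρ : Continuous fun p : Pt × Pt => ρ p.1 p.2) {B : ℝ} (hB : ∀ x y, |ρ x y| ≤ B) :
    ∫ x in Ω, h x * ∫ y in K, F y * ρ x y = ∫ y in K, F y * ∫ x in Ω, h x * ρ x y := by
  simp only [← integral_const_mul]
  rw [integral_integral_swap]
  · refine integral_congr_ae (Filter.Eventually.of_forall fun y => ?_)
    refine integral_congr_ae (Filter.Eventually.of_forall fun x => ?_)
    simp only; ring
  · exact integrable_mul_kernel hK hF hh hρ hB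

end
end StaggeredDG

namespace StaggeredDG
noncomputable section

lemma integral_lincomb {μ : Measure Pt} (a b : ℝ) {f g h : Pt → ℝ} (hf : Integrable f μ)
    (hg : Integrable g μ) (hh : Integrable h μ) :
    ∫ x, a * (f x + g x) + b * h x ∂μ = a * ((∫ x, f x ∂μ) + ∫ x, g x ∂μ) + b * ∫ x, h x ∂μ := by
  have h1 : Integrable (fun x => f x + g x) μ := hf.add hg
  rw [integral_add (h1.const_mul a) (hh.const_mul b), integral_const_mul, integral_const_mul,
    integral_add hf hg]

namespace StaggeredMesh

variable {Ω : Set Pt} (M : StaggeredMesh Ω)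

/-! ### Weak gradients and fields without distributional normal flux -/

lemma integral_domain_indicator (τ : Fin M.N) (h F : Pt → ℝ) :
    ∫ x in Ω, h x * (M.cell τ).indicator F x = ∫ x in M.cell τ, h x * F x := by
  have h1 : ∀ x, h x * (M.cell τ).indicator F x = (M.cell τ).indicator (fun x => h x * F x) x := by
    intro x; by_cases hx : x ∈ M.cell τ <;> simp [hx]
  simp only [h1]
  rw [integral_indicator (M.measurableSet_cell τ), Measure.restrict_restrict (M.measurableSet_cell τ)]
  congr 1
  refine Measure.restrict_congr_set (Filter.eventuallyLE_antisymm_iff.2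
    ⟨Filter.Eventually.of_forall Set.inter_subset_left, ?_⟩)
  rw [ae_le_set]
  refine measure_mono_null ?_ (M.volume_frontier_cell τ)
  rintro y ⟨hy, hy'⟩
  exact ⟨subset_closure hy, fun h => hy' ⟨hy, M.interior_cell_subset τ h⟩⟩

/-- The identity for a weak gradient tested with dilated mollifications of a field without
distributional normal flux. -/
lemma sum_dilated_kernel_eq_zero {χ : Pt → ℝ} {g : Pt → Pt}
    (hχ : IntegrableOn χ Ω) (hg : ∀ j, IntegrableOn (fun y => g y j) Ω)
    (hgrad : HasWeakGradient Ω χ g) (s : Finset (Fin M.N)) (u : M.Vec) (c : Pt)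
    (hfl : ∀ φ : Pt → ℝ, ContDiff ℝ 1 φ → ∑ τ ∈ s, ∫ y in M.cell τ,
      (fderiv ℝ φ y (WithLp.toLp 2 fun i => ev y (u τ i)) + φ y * u.div τ y) = 0)
    {l : ℝ} (hl : 0 < l) (ρ : ContDiffBump (0 : Pt))
    (hsupp : ∀ τ ∈ s, ∀ y ∈ M.cell τ, Metric.closedBall (c + l • (y - c)) ρ.rOut ⊆ Ω) :
    ∑ τ ∈ s, ((∑ j, ∫ x in Ω, g x j * ∫ y in M.cell τ,
        u.comp j τ y * ρ.normed volume (x - (c + l • (y - c)))) +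
      l⁻¹ * ∫ x in Ω, χ x * ∫ y in M.cell τ,
        u.div τ y * ρ.normed volume (x - (c + l • (y - c)))) = 0 := by
  set R : Pt → ℝ := ρ.normed volume with hR
  have hRs : ContDiff ℝ ∞ R := ρ.contDiff_normed
  have hRc : HasCompactSupport R := ρ.hasCompactSupport_normed
  set A : Pt → Pt := fun y => c + l • (y - c) with hA
  have hAc : Continuous A := by fun_prop
  have hAs : ContDiff ℝ 1 A := by fun_prop
  let e : Fin 2 → Pt := fun j => EuclideanSpace.single j 1
  have hDc : ∀ j, Continuous fun y => fderiv ℝ R y (e j) := fun j =>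
    (hRs.continuous_fderiv (by simp)).clm_apply continuous_const
  obtain ⟨B0, hB0⟩ := hRc.exists_bound_of_continuous hRs.continuous
  have hDs : ∀ j, HasCompactSupport fun y => fderiv ℝ R y (e j) := fun j =>
    (hRc.fderiv ℝ).comp_left (g := fun L : Pt →L[ℝ] ℝ => L (e j)) rfl
  choose B1 hB1 using fun j => (hDs j).exists_bound_of_continuous (hDc j)
  have k0 : Continuous fun p : Pt × Pt => R (p.1 - A p.2) :=
    hRs.continuous.comp (continuous_fst.sub (hAc.comp continuous_snd))
  have k1 : ∀ j, Continuous fun p : Pt × Pt => fderiv ℝ R (p.1 - A p.2) (e j) := fun j =>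
    (hDc j).comp (continuous_fst.sub (hAc.comp continuous_snd))
  have b0 : ∀ x y : Pt, |R (x - A y)| ≤ B0 := fun x y => hB0 _
  have b1 : ∀ j, ∀ x y : Pt, |fderiv ℝ R (x - A y) (e j)| ≤ B1 j := fun j x y => hB1 j _
  have htest : ∀ τ ∈ s, ∀ y ∈ M.cell τ, ∀ j,
      ∫ x in Ω, g x j * R (x - A y) = -∫ x in Ω, χ x * fderiv ℝ R (x - A y) (e j) := by
    intro τ hτ y hy j
    have hsub : Function.support (fun x => R (x - A y)) ⊆ Metric.closedBall (A y) ρ.rOut := by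
      intro x hx
      have : x - A y ∈ Function.support R := hx
      rw [hR, ρ.support_normed_eq, mem_ball_zero_iff] at this
      rw [Metric.mem_closedBall, dist_eq_norm]
      exact this.le
    have h := hgrad (fun x => R (x - A y)) ⟨hRs.comp (contDiff_id.sub contDiff_const),
      HasCompactSupport.of_support_subset_isCompact (isCompact_closedBall _ _) hsub,
      (closure_minimal hsub Metric.isClosed_closedBall).trans (hsupp τ hτ y hy)⟩ j
    simp only [fderiv_comp_sub] at h
    rw [h, neg_neg]
  have hswap : ∀ τ ∈ s, ∀ j, ∫ x in Ω, g x j * ∫ y in M.cell τ, u.comp j τ y * R (x - A y) =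
      -∫ x in Ω, χ x * ∫ y in M.cell τ, u.comp j τ y * fderiv ℝ R (x - A y) (e j) := by
    intro τ hτ j
    rw [integral_mul_kernel_swap (M.isCompact_cell τ) (M.continuous_comp u j τ) (hg j) k0 b0,
      integral_mul_kernel_swap (M.isCompact_cell τ) (M.continuous_comp u j τ) hχ (k1 j) (b1 j),
      ← integral_neg]
    refine setIntegral_congr_fun (M.measurableSet_cell τ) fun y hy => ?_
    simp only [htest τ hτ y hy j]
    ring
  have hflux : ∀ x, ∑ τ ∈ s, (-(∑ j, ∫ y in M.cell τ, u.comp j τ y *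
      fderiv ℝ R (x - A y) (e j)) + l⁻¹ * ∫ y in M.cell τ, u.div τ y * R (x - A y)) = 0 := by
    intro x
    have h := hfl (fun y => R (x - A y)) ((hRs.of_le (by simp)).comp (contDiff_const.sub hAs))
    have hder : ∀ y v, fderiv ℝ (fun y => R (x - A y)) y v = -(l * fderiv ℝ R (x - A y) v) := by
      intro y v
      have h1 : HasFDerivAt (fun y => x - A y) (-(l • ContinuousLinearMap.id ℝ Pt)) y :=
        ((((hasFDerivAt_id y).sub_const c).const_smul l).const_add c).const_sub x
      have h2 := ((hRs.differentiable (by simp)) (x - A y)).hasFDerivAt.comp y h1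
      have h3 := h2.fderiv
      simp only [Function.comp_def] at h3
      rw [h3]
      simp
    have hterm : ∀ τ ∈ s, (-(∑ j, ∫ y in M.cell τ, u.comp j τ y *
        fderiv ℝ R (x - A y) (e j)) + l⁻¹ * ∫ y in M.cell τ, u.div τ y * R (x - A y)) =
        l⁻¹ * ∫ y in M.cell τ, (fderiv ℝ (fun y => R (x - A y)) y
          (WithLp.toLp 2 fun i => ev y (u τ i)) + R (x - A y) * u.div τ y) := by
      intro τ _
      have c1 : ∀ j, Continuous fun y => u.comp j τ y * fderiv ℝ R (x - A y) (e j) := fun j =>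
        (M.continuous_comp u j τ).mul ((hDc j).comp (continuous_const.sub hAc))
      have c2 : Continuous fun y => u.div τ y * R (x - A y) :=
        (M.continuous_div u τ).mul (hRs.continuous.comp (continuous_const.sub hAc))
      have i1 := fun j => (c1 j).continuousOn.integrableOn_compact (M.isCompact_cell τ)
        (μ := volume)
      have i2 := c2.continuousOn.integrableOn_compact (M.isCompact_cell τ) (μ := volume)
      have e1 : ∀ y, fderiv ℝ (fun y => R (x - A y)) y (WithLp.toLp 2 fun i => ev y (u τ i)) +
          R (x - A y) * u.div τ y = -l * (u.comp 0 τ y * fderiv ℝ R (x - A y) (e 0) +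
            u.comp 1 τ y * fderiv ℝ R (x - A y) (e 1)) + 1 * (u.div τ y * R (x - A y)) := by
        intro y
        simp only [hder, clm_apply_toLp, Fin.sum_univ_two, e, Vec.comp]
        ring
      simp only [e1]
      rw [integral_lincomb (-l) 1 (i1 0) (i1 1) i2, Fin.sum_univ_two]
      field_simp
    rw [Finset.sum_congr rfl hterm, ← Finset.mul_sum, h, mul_zero]
  have hi1 : ∀ τ j, IntegrableOn (fun x => χ x * ∫ y in M.cell τ, u.comp j τ y *
      fderiv ℝ R (x - A y) (e j)) Ω := fun τ j =>
    integrableOn_mul_integral_kernel (M.isCompact_cell τ) (M.continuous_comp u j τ) hχ (k1 j) (b1 j)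
  have hi2 : ∀ τ, IntegrableOn (fun x => χ x * ∫ y in M.cell τ, u.div τ y * R (x - A y)) Ω := fun τ =>
    integrableOn_mul_integral_kernel (M.isCompact_cell τ) (M.continuous_div u τ) hχ k0 b0
  change ∑ τ ∈ s, ((∑ j, ∫ x in Ω, g x j * ∫ y in M.cell τ, u.comp j τ y * R (x - A y)) +
    l⁻¹ * ∫ x in Ω, χ x * ∫ y in M.cell τ, u.div τ y * R (x - A y)) = 0
  calc _ = ∑ τ ∈ s, ∫ x in Ω, χ x * (-(∑ j, ∫ y in M.cell τ, u.comp j τ y *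
      fderiv ℝ R (x - A y) (e j)) + l⁻¹ * ∫ y in M.cell τ, u.div τ y * R (x - A y)) := by
        refine Finset.sum_congr rfl fun τ hτ => ?_
        simp only [hswap τ hτ, Fin.sum_univ_two]
        have e2 : ∀ x, χ x * (-((∫ y in M.cell τ, u.comp 0 τ y * fderiv ℝ R (x - A y) (e 0)) +
            ∫ y in M.cell τ, u.comp 1 τ y * fderiv ℝ R (x - A y) (e 1)) +
            l⁻¹ * ∫ y in M.cell τ, u.div τ y * R (x - A y)) =
            -1 * ((χ x * ∫ y in M.cell τ, u.comp 0 τ y * fderiv ℝ R (x - A y) (e 0)) +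
              χ x * ∫ y in M.cell τ, u.comp 1 τ y * fderiv ℝ R (x - A y) (e 1)) +
            l⁻¹ * (χ x * ∫ y in M.cell τ, u.div τ y * R (x - A y)) := fun x => by ring
        simp only [e2]
        rw [integral_lincomb (-1) l⁻¹ (hi1 τ 0) (hi1 τ 1) (hi2 τ)]
        ring
    _ = ∫ x in Ω, ∑ τ ∈ s, χ x * (-(∑ j, ∫ y in M.cell τ, u.comp j τ y *
      fderiv ℝ R (x - A y) (e j)) + l⁻¹ * ∫ y in M.cell τ, u.div τ y * R (x - A y)) := by
        refine (integral_finsetSum s fun τ _ => ?_).symm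
        refine (((hi1 τ 0).add (hi1 τ 1)).neg.add ((hi2 τ).const_mul l⁻¹)).congr
          (Filter.Eventually.of_forall fun x => ?_)
        simp only [Pi.add_apply, Pi.neg_apply, Fin.sum_univ_two]
        ring
    _ = 0 := by simp only [← Finset.mul_sum, hflux, mul_zero, integral_zero]

open Filter Topology in
theorem patch_orthogonality (hΩ : IsOpen Ω) {χ : Pt → ℝ} {g : Pt → Pt}
    (hχ : IntegrableOn χ Ω) (hg : ∀ j, IntegrableOn (fun y => g y j) Ω)
    (hgrad : HasWeakGradient Ω χ g) (s : Finset (Fin M.N)) (u : M.Vec) (c : Pt)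
    (hstar : ∀ τ ∈ s, ∀ x ∈ M.cell τ, ∀ l ∈ Set.Ioo (0 : ℝ) 1, c + l • (x - c) ∈ Ω)
    (hfl : ∀ φ : Pt → ℝ, ContDiff ℝ 1 φ → ∑ τ ∈ s, ∫ y in M.cell τ,
      (fderiv ℝ φ y (WithLp.toLp 2 fun i => ev y (u τ i)) + φ y * u.div τ y) = 0) :
    ∑ τ ∈ s, ((∑ j, ∫ y in M.cell τ, g y j * u.comp j τ y) +
      ∫ y in M.cell τ, χ y * u.div τ y) = 0 := by
  let l : ℕ → ℝ := fun n => 1 - 1 / ((n : ℝ) + 1 + 1)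
  have hb : ∀ n : ℕ, 0 < 1 / ((n : ℝ) + 1 + 1) ∧ 1 / ((n : ℝ) + 1 + 1) ≤ 2⁻¹ := fun n => by
    refine ⟨by positivity, ?_⟩
    rw [one_div]
    exact inv_anti₀ (by norm_num) (by linarith [n.cast_nonneg (α := ℝ)])
  have hl : ∀ n, 2⁻¹ ≤ l n := fun n => by
    have := (hb n).2
    simp only [l]; norm_num at this ⊢; linarith
  have hl0 : ∀ n, 0 < l n := fun n => lt_of_lt_of_le (by norm_num) (hl n)
  have hl2 : ∀ n, l n < 1 := fun n => by have := (hb n).1; simp only [l]; linarith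
  have hl1 : Tendsto l atTop (𝓝 1) := by
    have h1 : Tendsto (fun n : ℕ => 1 / ((n : ℝ) + 1 + 1)) atTop (𝓝 0) := by
      have := (tendsto_add_atTop_iff_nat 1).2 (tendsto_one_div_add_atTop_nhds_zero_nat (𝕜 := ℝ))
      simpa using this
    simpa [l] using h1.const_sub 1
  have hball : ∀ n, ∃ ε : ℝ, 0 < ε ∧ ∀ τ ∈ s, ∀ y ∈ M.cell τ,
      Metric.closedBall (c + l n • (y - c)) ε ⊆ Ω := by
    intro n
    have hK : IsCompact ((fun y => c + l n • (y - c)) '' ⋃ τ ∈ s, M.cell τ) :=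
      (s.isCompact_biUnion fun τ _ => M.isCompact_cell τ).image (by fun_prop)
    obtain ⟨ε, hε, h⟩ := hK.exists_cthickening_subset_open hΩ (by
      rintro _ ⟨y, hy, rfl⟩
      obtain ⟨τ, hτ, hy⟩ := Set.mem_iUnion₂.1 hy
      exact hstar τ hτ y hy _ ⟨hl0 n, hl2 n⟩)
    refine ⟨ε, hε, fun τ hτ y hy => ?_⟩
    have hmem : c + l n • (y - c) ∈ (fun y => c + l n • (y - c)) '' ⋃ τ ∈ s, M.cell τ :=
      ⟨y, Set.mem_iUnion₂.2 ⟨τ, hτ, hy⟩, rfl⟩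
    exact (Metric.closedBall_subset_cthickening hmem ε).trans h
  choose ε hε hεΩ using hball
  let r : ℕ → ℝ := fun n => min (ε n) (1 / ((n : ℝ) + 1))
  have hr : ∀ n, 0 < r n := fun n => lt_min (hε n) (by positivity)
  let ρ : ℕ → ContDiffBump (0 : Pt) := fun n => ⟨r n / 2, r n, half_pos (hr n), half_lt_self (hr n)⟩
  have hρ : Tendsto (fun n => (ρ n).rOut) atTop (𝓝 0) :=
    squeeze_zero (fun n => (hr n).le) (fun n => min_le_right _ _)
      tendsto_one_div_add_atTop_nhds_zero_nat
  have hzero := fun n => M.sum_dilated_kernel_eq_zero hχ hg hgrad s u c hfl (hl0 n) (ρ n)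
    fun τ hτ y hy => (Metric.closedBall_subset_closedBall (min_le_left _ _)).trans (hεΩ n τ hτ y hy)
  have hinv : Tendsto (fun n => (l n)⁻¹) atTop (𝓝 1) := by simpa using hl1.inv₀ one_ne_zero
  have l1 : ∀ τ j, Tendsto (fun n => ∫ x in Ω, g x j * ∫ y in M.cell τ,
      u.comp j τ y * (ρ n).normed volume (x - (c + l n • (y - c)))) atTop
      (𝓝 (∫ x in M.cell τ, g x j * u.comp j τ x)) := fun τ j => by
    rw [← M.integral_domain_indicator]
    exact tendsto_integral_mul_dilated_kernel (M.isCompact_cell τ) (M.volume_frontier_cell τ)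
      (M.continuous_comp u j τ) c hl hl1 ρ hρ (hg j)
  have l2 : ∀ τ, Tendsto (fun n => (l n)⁻¹ * ∫ x in Ω, χ x * ∫ y in M.cell τ,
      u.div τ y * (ρ n).normed volume (x - (c + l n • (y - c)))) atTop
      (𝓝 (∫ x in M.cell τ, χ x * u.div τ x)) := fun τ => by
    rw [← M.integral_domain_indicator, ← one_mul (∫ x in Ω, _)]
    exact hinv.mul (tendsto_integral_mul_dilated_kernel (M.isCompact_cell τ)
      (M.volume_frontier_cell τ) (M.continuous_div u τ) c hl hl1 ρ hρ hχ)
  have hlim := tendsto_finsetSum s fun τ (_ : τ ∈ s) =>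
    (tendsto_finsetSum Finset.univ fun j (_ : j ∈ Finset.univ) => l1 τ j).add (l2 τ)
  exact tendsto_nhds_unique (hlim.congr hzero) tendsto_const_nhds

end StaggeredMesh
end
end StaggeredDG

namespace StaggeredDG
noncomputable section

/-! ### Normal fluxes on a triangle -/

/-- The normal component of a polynomial field on the line through `a` and `b`, multiplied by the
length of the segment. -/
def flux (a b : Pt) (p : Fin 2 → Poly) (y : Pt) : ℝ :=
  ev y (p 0) * (b 1 - a 1) - ev y (p 1) * (b 0 - a 0)

lemma flux_swap (a b : Pt) (p : Fin 2 → Poly) (y : Pt) : flux b a p y = -flux a b p y := by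
  unfold flux; ring

lemma flux_sub (a b : Pt) (p q : Fin 2 → Poly) (y : Pt) :
    flux a b (p - q) y = flux a b p y - flux a b q y := by
  simp [flux]; ring

lemma flux_eq (a b : Pt) (p : Fin 2 → Poly) (y : Pt) :
    flux a b p y = dist a b * ∑ i, ev y (p i) * unor a b i := by
  rw [Fin.sum_univ_two, mul_add, mul_left_comm, mul_left_comm (dist a b), dist_mul_unor_zero,
    dist_mul_unor_one]
  simp [flux]; ring

lemma segMean_mul_flux_eq_zero {a b : Pt} {p : Fin 2 → Poly} {φ : Pt → ℝ}
    (h : ∀ y ∈ segment ℝ a b, flux a b p y = 0) :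
    segMean a b (fun y => φ y * flux a b p y) = 0 := by
  have := edgeInt_mul_eq_zero (g := φ) h
  rw [edgeInt_eq, mul_eq_zero, dist_eq_zero] at this
  rcases this with rfl | h
  · simp [segMean, flux]
  · rw [← h]; congr 1; funext y; ring

lemma green_hull {a b c : Pt} (hD : 0 < cross (b - a) (c - a)) (p : Fin 2 → Poly) {φ : Pt → ℝ}
    (hφ : ContDiff ℝ 1 φ) :
    ∫ y in convexHull ℝ ({a, b, c} : Set Pt), (fderiv ℝ φ y (WithLp.toLp 2 fun i => ev y (p i)) +
      φ y * ∑ i, ev y (MvPolynomial.pderiv i (p i))) =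
      segMean a b (fun y => φ y * flux a b p y) + segMean b c (fun y => φ y * flux b c p y) +
      segMean c a (fun y => φ y * flux c a p y) := by
  have hz : ∀ j, ContDiff ℝ 1 fun y : Pt => ev y (p j) := fun j => (contDiff_ev _).of_le (by simp)
  have hf : ∀ j, ContDiff ℝ 1 fun y : Pt => φ y * ev y (p j) := fun j => hφ.mul (hz j)
  have h := fun j => integral_hull_fderiv hD (hf j) j
  have hi : ∀ j, IntegrableOn (fun y => fderiv ℝ (fun y => φ y * ev y (p j)) y
      (EuclideanSpace.single j 1)) (convexHull ℝ ({a, b, c} : Set Pt)) := fun j =>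
    (((hf j).continuous_fderiv one_ne_zero).clm_apply
      continuous_const).continuousOn.integrableOn_compact (isCompact_hull a b c)
  have e1 : ∀ y, fderiv ℝ φ y (WithLp.toLp 2 fun i => ev y (p i)) +
      φ y * ∑ i, ev y (MvPolynomial.pderiv i (p i)) =
      fderiv ℝ (fun y => φ y * ev y (p 0)) y (EuclideanSpace.single 0 1) +
      fderiv ℝ (fun y => φ y * ev y (p 1)) y (EuclideanSpace.single 1 1) := by
    intro y
    rw [fderiv_fun_mul (hφ.differentiable one_ne_zero y) ((hz 0).differentiable one_ne_zero y),
      fderiv_fun_mul (hφ.differentiable one_ne_zero y) ((hz 1).differentiable one_ne_zero y)]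
    simp [fderiv_ev, clm_apply_toLp, Fin.sum_univ_two]
    ring
  have e2 : ∀ u v : Pt, segMean u v (fun y => φ y * flux u v p y) =
      edgeInt u v (fun y => φ y * ev y (p 0) * unor u v 0) +
      edgeInt u v (fun y => φ y * ev y (p 1) * unor u v 1) := by
    intro u v
    have hc := hφ.continuous
    rw [← edgeInt_add _ _ (by fun_prop) (by fun_prop), edgeInt_eq, ← segMean_const_mul]
    congr 1
    funext y
    rw [flux_eq, Fin.sum_univ_two]
    ring
  simp only [e1]
  rw [integral_add (hi 0) (hi 1), h 0, h 1, e2, e2, e2]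
  ring

/-- The part of a polynomial field that carries its normal flux through the edge from `a` to `b`
and has none through the other edges of the triangle. -/
def edgePart (a b c : Pt) (p : Fin 2 → Poly) : Fin 2 → Poly := fun i =>
  (cross (b - a) (c - a))⁻¹ • ((MvPolynomial.X i - MvPolynomial.C (c i)) *
    (MvPolynomial.C (b 1 - a 1) * p 0 - MvPolynomial.C (b 0 - a 0) * p 1))

lemma flux_edgePart (a b c u v : Pt) (p : Fin 2 → Poly) (y : Pt) :
    flux u v (edgePart a b c p) y =
      (cross (b - a) (c - a))⁻¹ * cross (y - c) (v - u) * flux a b p y := by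
  simp [flux, edgePart, cross]; ring

lemma flux_edgePart_self {a b c : Pt} (hD : 0 < cross (b - a) (c - a)) (p : Fin 2 → Poly) {y : Pt}
    (hy : y ∈ segment ℝ a b) : flux a b (edgePart a b c p) y = flux a b p y := by
  have h : cross (y - c) (b - a) = cross (b - a) (c - a) := by
    have := cross_eq_zero_of_mem_segment hy
    simp [cross] at this ⊢
    linarith
  rw [flux_edgePart, h, inv_mul_cancel₀ hD.ne', one_mul]

lemma flux_edgePart_swap {a b c : Pt} (hD : 0 < cross (a - b) (c - b)) (p : Fin 2 → Poly) {y : Pt}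
    (hy : y ∈ segment ℝ a b) : flux a b (edgePart b a c p) y = flux a b p y := by
  rw [flux_swap, flux_edgePart_self hD p (by rwa [segment_symm]), ← flux_swap]

lemma flux_edgePart_right (a b c : Pt) (p : Fin 2 → Poly) {y : Pt} (hy : y ∈ segment ℝ b c) :
    flux b c (edgePart a b c p) y = 0 := by
  have h : cross (y - c) (c - b) = 0 := by
    have := cross_eq_zero_of_mem_segment hy
    simp [cross] at this ⊢
    linarith
  rw [flux_edgePart, h]; ring

lemma flux_edgePart_left (a b c : Pt) (p : Fin 2 → Poly) {y : Pt} (hy : y ∈ segment ℝ c a) :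
    flux c a (edgePart a b c p) y = 0 := by
  have h : cross (y - c) (a - c) = 0 := by
    have := cross_eq_zero_of_mem_segment hy
    simp [cross] at this ⊢
    linarith
  rw [flux_edgePart, h]; ring

lemma dilation_mem_interior_union {a b c c' : Pt} (hD : 0 < cross (b - a) (c - a))
    (hD' : 0 < cross (a - b) (c' - b)) {x : Pt} (hx : x ∈ convexHull ℝ ({a, b, c} : Set Pt))
    {l : ℝ} (hl : l ∈ Set.Ioo (0 : ℝ) 1) :
    (2⁻¹ : ℝ) • (a + b) + l • (x - (2⁻¹ : ℝ) • (a + b)) ∈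
      interior (convexHull ℝ ({a, b, c} : Set Pt) ∪ convexHull ℝ ({b, a, c'} : Set Pt)) := by
  obtain ⟨x1, x2, x3⟩ := (mem_hull_iff hD x).1 hx
  set y : Pt := (2⁻¹ : ℝ) • (a + b) + l • (x - (2⁻¹ : ℝ) • (a + b)) with hy
  have hl0 := hl.1
  have hl1 : 0 < 1 - l := by linarith [hl.2]
  have y1 : cross (b - a) (y - a) = l * cross (b - a) (x - a) := by
    simp [hy, cross]; ring
  have y2 : 0 < cross (c - b) (y - b) := by
    have : cross (c - b) (y - b) =
        l * cross (c - b) (x - b) + (1 - l) * (cross (b - a) (c - a) / 2) := by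
      simp [hy, cross]; ring
    rw [this]; positivity
  have y3 : 0 < cross (a - c) (y - c) := by
    have : cross (a - c) (y - c) =
        l * cross (a - c) (x - c) + (1 - l) * (cross (b - a) (c - a) / 2) := by
      simp [hy, cross]; ring
    rw [this]; positivity
  rcases x1.eq_or_lt with h0 | h0
  · rw [← h0, mul_zero] at y1
    have hyt := tri_cross hD y
    rw [y1, zero_div] at hyt
    set s := cross (a - c) (y - c) / cross (b - a) (c - a)
    have hs0 : 0 < s := div_pos y3 hD
    have hs1 : 0 < 1 - s := by
      have : 1 - s = cross (c - b) (y - b) / cross (b - a) (c - a) := by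
        rw [eq_div_iff hD.ne', sub_mul, div_mul_cancel₀ _ hD.ne']
        simp [cross] at y1 ⊢
        linarith
      rw [this]; exact div_pos y2 hD
    have z1 : 0 < cross (c' - a) (y - a) := by
      have : cross (c' - a) (y - a) = s * cross (a - b) (c' - b) := by
        rw [← hyt]; simp [tri, cross]; ring
      rw [this]; positivity
    have z2 : 0 < cross (b - c') (y - c') := by
      have : cross (b - c') (y - c') = (1 - s) * cross (a - b) (c' - b) := by
        rw [← hyt]; simp [tri, cross]; ring
      rw [this]; positivity
    rw [mem_interior]
    refine ⟨{y | 0 < cross (c - b) (y - b)} ∩ {y | 0 < cross (a - c) (y - c)} ∩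
      ({y | 0 < cross (c' - a) (y - a)} ∩ {y | 0 < cross (b - c') (y - c')}), ?_,
      ((isOpen_lt continuous_const (continuous_cross_sub _ _)).inter
        (isOpen_lt continuous_const (continuous_cross_sub _ _))).inter
      ((isOpen_lt continuous_const (continuous_cross_sub _ _)).inter
        (isOpen_lt continuous_const (continuous_cross_sub _ _))), ⟨y2, y3⟩, z1, z2⟩
    rintro z ⟨⟨h2, h3⟩, h4, h5⟩
    simp only [Set.mem_ofPred_eq] at h2 h3 h4 h5
    rcases le_total 0 (cross (b - a) (z - a)) with h | h
    · exact Or.inl ((mem_hull_iff hD z).2 ⟨h, h2.le, h3.le⟩)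
    · refine Or.inr ((mem_hull_iff hD' z).2 ⟨?_, h4.le, h5.le⟩)
      simp [cross] at h ⊢
      linarith
  · exact interior_mono Set.subset_union_left
      (mem_interior_hull hD (by rw [y1]; positivity) y2 y3)

namespace StaggeredMesh

variable {Ω : Set Pt} (M : StaggeredMesh Ω)

/-! ### Orthogonality of gradients and solenoidal fields -/

/-- The pairing of a weak gradient with a polynomial field on a triangle. -/
def gradPair (χ : Pt → ℝ) (g : Pt → Pt) (τ : Fin M.N) (p : Fin 2 → Poly) : ℝ :=
  (∑ j, ∫ y in M.cell τ, g y j * ev y (p j)) +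
    ∫ y in M.cell τ, χ y * ∑ i, ev y (MvPolynomial.pderiv i (p i))

variable {χ : Pt → ℝ} {g : Pt → Pt}

lemma integrableOn_mul_ev {h : Pt → ℝ} (hh : IntegrableOn h Ω) (τ : Fin M.N) {F : Pt → ℝ}
    (hF : Continuous F) : IntegrableOn (fun y => h y * F y) (M.cell τ) := by
  obtain ⟨B, hB⟩ := (M.isCompact_cell τ).exists_bound_of_continuousOn hF.continuousOn
  refine Integrable.mul_bdd (c := B) (M.integrableOn_domain_iff.1 hh τ) hF.aestronglyMeasurable ?_
  exact (ae_restrict_iff' (M.measurableSet_cell τ)).2 (Filter.Eventually.of_forall hB)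

lemma gradPair_sub (hχ : IntegrableOn χ Ω) (hg : ∀ j, IntegrableOn (fun y => g y j) Ω)
    (τ : Fin M.N) (p q : Fin 2 → Poly) :
    M.gradPair χ g τ (p - q) = M.gradPair χ g τ p - M.gradPair χ g τ q := by
  have c1 : ∀ p : Fin 2 → Poly, Continuous fun y => ∑ i, ev y (MvPolynomial.pderiv i (p i)) :=
    fun p => by fun_prop
  have h1 : ∀ j, ∫ y in M.cell τ, g y j * ev y ((p - q) j) =
      (∫ y in M.cell τ, g y j * ev y (p j)) - ∫ y in M.cell τ, g y j * ev y (q j) := fun j => by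
    rw [← integral_sub (M.integrableOn_mul_ev (hg j) τ (continuous_ev _))
      (M.integrableOn_mul_ev (hg j) τ (continuous_ev _))]
    simp [mul_sub]
  have h2 : ∫ y in M.cell τ, χ y * ∑ i, ev y (MvPolynomial.pderiv i ((p - q) i)) =
      (∫ y in M.cell τ, χ y * ∑ i, ev y (MvPolynomial.pderiv i (p i))) -
      ∫ y in M.cell τ, χ y * ∑ i, ev y (MvPolynomial.pderiv i (q i)) := by
    rw [← integral_sub (M.integrableOn_mul_ev hχ τ (c1 p)) (M.integrableOn_mul_ev hχ τ (c1 q))]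
    simp [mul_sub]
  unfold gradPair
  rw [h2]
  simp only [h1, Fin.sum_univ_two]
  ring

lemma gradPair_eq_zero (hΩ : IsOpen Ω) (hχ : IntegrableOn χ Ω)
    (hg : ∀ j, IntegrableOn (fun y => g y j) Ω) (hgrad : HasWeakGradient Ω χ g) {τ : Fin M.N}
    {a b c : Pt} (hD : 0 < cross (b - a) (c - a)) (hτ : M.cell τ = convexHull ℝ {a, b, c})
    {p : Fin 2 → Poly} (h1 : ∀ y ∈ segment ℝ a b, flux a b p y = 0)
    (h2 : ∀ y ∈ segment ℝ b c, flux b c p y = 0) (h3 : ∀ y ∈ segment ℝ c a, flux c a p y = 0) :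
    M.gradPair χ g τ p = 0 := by
  obtain ⟨x0, hx0⟩ := M.interior_cell_nonempty τ
  have := M.patch_orthogonality hΩ hχ hg hgrad {τ} (fun _ => p) x0 (fun σ hσ x hx l hl => ?_)
    fun φ hφ => ?_
  · rw [Finset.sum_singleton] at this
    exact this
  · rw [Finset.mem_singleton] at hσ
    subst hσ
    have := (M.convex_cell σ).add_smul_sub_mem_interior hx hx0 (t := 1 - l)
      ⟨by linarith [hl.2], by linarith [hl.1]⟩
    refine M.interior_cell_subset σ ?_
    convert this using 1
    module
  · rw [Finset.sum_singleton, hτ]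
    refine (green_hull hD p hφ).trans ?_
    rw [segMean_mul_flux_eq_zero h1, segMean_mul_flux_eq_zero h2,
      segMean_mul_flux_eq_zero h3]
    simp

lemma gradPair_add_eq_zero (hΩ : IsOpen Ω) (hχ : IntegrableOn χ Ω)
    (hg : ∀ j, IntegrableOn (fun y => g y j) Ω) (hgrad : HasWeakGradient Ω χ g) {σ τ : Fin M.N}
    (hne : τ ≠ σ) {a b c c' : Pt} (hD : 0 < cross (b - a) (c - a))
    (hτ : M.cell τ = convexHull ℝ {a, b, c}) (hD' : 0 < cross (a - b) (c' - b))
    (hσ : M.cell σ = convexHull ℝ {b, a, c'}) {p q : Fin 2 → Poly}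
    (hpq : ∀ y ∈ segment ℝ a b, flux a b p y = flux a b q y)
    (h2 : ∀ y ∈ segment ℝ b c, flux b c p y = 0) (h3 : ∀ y ∈ segment ℝ c a, flux c a p y = 0)
    (h4 : ∀ y ∈ segment ℝ a c', flux a c' q y = 0) (h5 : ∀ y ∈ segment ℝ c' b, flux c' b q y = 0) :
    M.gradPair χ g τ p + M.gradPair χ g σ q = 0 := by
  have hint : interior (convexHull ℝ ({a, b, c} : Set Pt) ∪ convexHull ℝ ({b, a, c'} : Set Pt)) ⊆ Ω := by
    rw [← hτ, ← hσ]
    exact (interior_mono (Set.union_subset (Set.subset_iUnion (fun τ => M.cell τ) τ)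
      (Set.subset_iUnion (fun τ => M.cell τ) σ))).trans_eq M.domain_eq.symm
  let u : M.Vec := fun ρ => if ρ = τ then p else q
  have uτ : u τ = p := if_pos rfl
  have uσ : u σ = q := if_neg hne.symm
  have := M.patch_orthogonality hΩ hχ hg hgrad {τ, σ} u ((2⁻¹ : ℝ) • (a + b))
    (fun ρ hρ x hx l hl => ?_) fun φ hφ => ?_
  · rw [Finset.sum_pair hne] at this
    simpa only [Vec.comp, Vec.div, Vec.grad, uτ, uσ, gradPair] using this
  · rw [Finset.mem_insert, Finset.mem_singleton] at hρ
    rcases hρ with rfl | rfl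
    · rw [hτ] at hx
      exact hint (dilation_mem_interior_union hD hD' hx hl)
    · rw [hσ] at hx
      have := dilation_mem_interior_union hD' hD hx hl
      rw [Set.union_comm, add_comm b a] at this
      exact hint this
  · rw [Finset.sum_pair hne]
    simp only [Vec.div, Vec.grad, uτ, uσ]
    rw [hτ, hσ, green_hull hD p hφ, green_hull hD' q hφ, segMean_mul_flux_eq_zero h2,
      segMean_mul_flux_eq_zero h3, segMean_mul_flux_eq_zero h4, segMean_mul_flux_eq_zero h5,
      segMean_comm b a]
    have e1 : ∀ y, φ y * flux b a q y = -1 * (φ y * flux a b q y) := fun y => by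
      rw [flux_swap]; ring
    simp only [e1]
    rw [segMean_const_mul]
    have e2 : segMean a b (fun y => φ y * flux a b p y) =
        segMean a b (fun y => φ y * flux a b q y) := by
      unfold segMean
      refine intervalIntegral.integral_congr fun s hs => ?_
      rw [Set.uIcc_of_le zero_le_one] at hs
      have : AffineMap.lineMap a b s ∈ segment ℝ a b := by
        rw [segment_eq_image_lineMap]; exact ⟨s, hs, rfl⟩
      simp only [hpq _ this]
    rw [e2]; ring

end StaggeredMesh
end
end StaggeredDG

namespace StaggeredDG
noncomputable section
namespace StaggeredMesh

variable {Ω : Set Pt} (M : StaggeredMesh Ω) {χ : Pt → ℝ} {g : Pt → Pt}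

lemma flux_eq_dot (w : M.Vec) (a b : Pt) (τ : Fin M.N) (y : Pt) :
    flux a b (w τ) y = dist a b * w.dot (unor a b) τ y := flux_eq a b (w τ) y

lemma sum_gradPair_eq_zero (hΩ : IsOpen Ω) (hχ : IntegrableOn χ Ω)
    (hg : ∀ j, IntegrableOn (fun y => g y j) Ω) (hgrad : HasWeakGradient Ω χ g) {k : ℕ}
    {w : M.Vec} (hw : w ∈ M.VSpace k)
    (hn : ∀ τ, ∀ y ∈ segment ℝ (M.src τ) (M.tgt τ), M.jumpPr (w.dot (M.norPr τ)) τ y = 0) :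
    ∑ τ, M.gradPair χ g τ (w τ) = 0 := by
  let E1 : ∀ τ, Fin 2 → Poly := fun τ => edgePart (M.src τ) (M.tgt τ) (M.ctr τ) (w τ)
  let E2 : ∀ τ, Fin 2 → Poly := fun τ => edgePart (M.tgt τ) (M.ctr τ) (M.src τ) (w τ)
  let E3 : ∀ τ, Fin 2 → Poly := fun τ => edgePart (M.ctr τ) (M.src τ) (M.tgt τ) (w τ)
  have hsplit : ∀ τ, M.gradPair χ g τ (w τ) = M.gradPair χ g τ (E1 τ) +
      (M.gradPair χ g τ (E2 τ) + M.gradPair χ g τ (E3 τ)) := by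
    intro τ
    have h := M.gradPair_eq_zero hΩ hχ hg hgrad (M.ccw_src τ) (M.cell_eq_src τ)
      (p := w τ - E1 τ - E2 τ - E3 τ) (fun y hy => ?_) (fun y hy => ?_) (fun y hy => ?_)
    · rw [M.gradPair_sub hχ hg, M.gradPair_sub hχ hg, M.gradPair_sub hχ hg] at h
      linarith
    · rw [flux_sub, flux_sub, flux_sub, flux_edgePart_self (M.ccw_src τ) _ hy,
        flux_edgePart_left _ _ _ _ hy, flux_edgePart_right _ _ _ _ hy]
      ring
    · rw [flux_sub, flux_sub, flux_sub, flux_edgePart_right _ _ _ _ hy,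
        flux_edgePart_self (M.ccw_tgt τ) _ hy, flux_edgePart_left _ _ _ _ hy]
      ring
    · rw [flux_sub, flux_sub, flux_sub, flux_edgePart_left _ _ _ _ hy,
        flux_edgePart_right _ _ _ _ hy, flux_edgePart_self (M.ccw τ) _ hy]
      ring
  have hpr : ∑ τ, M.gradPair χ g τ (E1 τ) = 0 := by
    rw [M.sum_primal]
    refine Finset.sum_eq_zero fun τ _ => ?_
    rcases hσ : M.nbr τ with _ | σ
    · simp only [Option.elim_none, add_zero]
      refine M.gradPair_eq_zero hΩ hχ hg hgrad (M.ccw_src τ) (M.cell_eq_src τ) (fun y hy => ?_)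
        (fun y hy => flux_edgePart_right _ _ _ _ hy) (fun y hy => flux_edgePart_left _ _ _ _ hy)
      have := hn τ y hy
      simp only [jumpPr, hσ, Option.elim_none, norPr] at this
      rw [flux_edgePart_self (M.ccw_src τ) _ hy, flux_eq_dot, this, mul_zero]
    · simp only [Option.elim_some]
      have h := (M.nbr_eq_some σ τ).1 hσ
      have hne : τ ≠ σ := by
        rintro rfl
        exact M.src_ne_tgt τ h.1
      have hD' := M.ccw_src σ
      have hcell := M.cell_eq_src σ
      have hE : E1 σ = edgePart (M.tgt τ) (M.src τ) (M.ctr σ) (w σ) := by simp only [E1, h.1, h.2]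
      rw [h.1, h.2] at hD' hcell
      rw [hE]
      refine M.gradPair_add_eq_zero hΩ hχ hg hgrad hne (M.ccw_src τ) (M.cell_eq_src τ) hD' hcell
        (fun y hy => ?_) (fun y hy => flux_edgePart_right _ _ _ _ hy)
        (fun y hy => flux_edgePart_left _ _ _ _ hy) (fun y hy => flux_edgePart_right _ _ _ _ hy)
        (fun y hy => flux_edgePart_left _ _ _ _ hy)
      have := hn τ y hy
      simp only [jumpPr, hσ, Option.elim_some, norPr] at this
      rw [flux_edgePart_self (M.ccw_src τ) _ hy, flux_edgePart_swap hD' _ hy, flux_eq_dot, flux_eq_dot,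
        sub_eq_zero.1 this]
  have hdl : ∑ τ, (M.gradPair χ g τ (E2 τ) + M.gradPair χ g τ (E3 τ)) = 0 := by
    rw [Finset.sum_add_distrib, ← M.sum_next fun τ => M.gradPair χ g τ (E3 τ),
      ← Finset.sum_add_distrib]
    refine Finset.sum_eq_zero fun τ _ => ?_
    have hne : τ ≠ M.next τ := by
      intro h
      have := M.src_next τ
      rw [← h] at this
      exact M.src_ne_tgt τ this
    have hD' := M.ccw (M.next τ)
    have hcell : M.cell (M.next τ) = convexHull ℝ {M.ctr τ, M.tgt τ, M.tgt (M.next τ)} := by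
      rw [cell, M.ctr_next, M.src_next]
    have hE : E3 (M.next τ) =
        edgePart (M.ctr τ) (M.tgt τ) (M.tgt (M.next τ)) (w (M.next τ)) := by
      simp only [E3, M.ctr_next, M.src_next]
    rw [M.ctr_next, M.src_next] at hD'
    rw [hE]
    refine M.gradPair_add_eq_zero hΩ hχ hg hgrad hne (M.ccw_tgt τ) (M.cell_eq_tgt τ) hD' hcell
      (fun y hy => ?_) (fun y hy => flux_edgePart_right _ _ _ _ hy)
      (fun y hy => flux_edgePart_left _ _ _ _ hy) (fun y hy => flux_edgePart_right _ _ _ _ hy)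
      (fun y hy => flux_edgePart_left _ _ _ _ hy)
    have := hw.2 τ y hy
    simp only [jumpDl, norDl] at this
    rw [flux_edgePart_self (M.ccw_tgt τ) _ hy, flux_edgePart_swap hD' _ hy, flux_eq_dot, flux_eq_dot,
      sub_eq_zero.1 this]
  rw [Finset.sum_congr rfl fun τ _ => hsplit τ, Finset.sum_add_distrib, hpr, hdl, add_zero]

lemma memLp_apply {f : Pt → Pt} (hf : MemLp f 2 (volume.restrict Ω)) (j : Fin 2) :
    MemLp (fun y => f y j) 2 (volume.restrict Ω) := by
  refine hf.of_le (((by fun_prop : Continuous fun x : Pt => x j)).comp_aestronglyMeasurable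
    hf.aestronglyMeasurable) (Filter.Eventually.of_forall fun y => ?_)
  exact PiLp.norm_apply_le (f y) j

lemma integrableOn_apply (hb : Bornology.IsBounded Ω) {f : Pt → Pt}
    (hf : MemLp f 2 (volume.restrict Ω)) (j : Fin 2) : IntegrableOn (fun y => f y j) Ω := by
  have : IsFiniteMeasure (volume.restrict Ω) := ⟨by simpa using hb.measure_lt_top⟩
  exact (memLp_apply hf j).integrable (by norm_num)

lemma load_eq (hb : Bornology.IsBounded Ω) {f : Pt → Pt} (hf : MemLp f 2 (volume.restrict Ω))
    (v : M.Vec) : M.load f v = ∑ τ, ∑ j, ∫ y in M.cell τ, f y j * v.comp j τ y := by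
  unfold load meshInt
  refine Finset.sum_congr rfl fun τ _ => ?_
  exact integral_finsetSum _ fun j _ =>
    M.integrableOn_mul_ev (integrableOn_apply hb hf j) τ (M.continuous_comp v j τ)

/-- Weak gradients are orthogonal to the discrete fields that are divergence free in the sense of
the form `b_h`. -/
theorem load_gradient_eq_zero (hΩ : IsOpen Ω) (hb : Bornology.IsBounded Ω)
    (hχ : MemLp χ 2 (volume.restrict Ω)) (hg : MemLp g 2 (volume.restrict Ω))
    (hgrad : HasWeakGradient Ω χ g) {k : ℕ} {w : M.Vec} (hw : w ∈ M.VSpace k)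
    (hbw : ∀ q ∈ M.QSpace k, M.formb w q = 0) : M.load g w = 0 := by
  have : IsFiniteMeasure (volume.restrict Ω) := ⟨by simpa using hb.measure_lt_top⟩
  obtain ⟨hdiv, hn⟩ := M.div_eq_zero_of_formb_eq_zero hw hbw
  rw [M.load_eq hb hg, ← M.sum_gradPair_eq_zero hΩ (hχ.integrable (by norm_num))
    (integrableOn_apply hb hg) hgrad hw hn]
  refine Finset.sum_congr rfl fun τ _ => ?_
  have : ∀ y, ∑ i, ev y (MvPolynomial.pderiv i (w τ i)) = 0 := hdiv τ
  simp [gradPair, this, Vec.comp]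

end StaggeredMesh
end
end StaggeredDG

namespace StaggeredDG
noncomputable section

/-! ### Finite dimensional saddle point problems -/

section SaddlePoint

variable {X Y P : Type*} [AddCommGroup X] [Module ℝ X] [Module.Finite ℝ X] [AddCommGroup Y]
  [Module ℝ Y] [Module.Finite ℝ Y] [AddCommGroup P] [Module ℝ P]

lemma exists_multiplier (b : P →ₗ[ℝ] Y →ₗ[ℝ] ℝ) (l : Y →ₗ[ℝ] ℝ)
    (h : ∀ v, (∀ q, b q v = 0) → l v = 0) : ∃ r, b r = l := by
  have hs : l ∈ Submodule.span ℝ (Set.range b) := by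
    refine FiniteDimensional.mem_span_of_iInf_ker_le_ker fun v hv => ?_
    simp only [Submodule.mem_iInf, LinearMap.mem_ker] at hv ⊢
    exact h v hv
  have : Set.range b = (LinearMap.range b : Set (Y →ₗ[ℝ] ℝ)) := rfl
  rw [this, Submodule.span_eq] at hs
  exact hs

lemma exists_saddle_point (a : X →ₗ[ℝ] X →ₗ[ℝ] ℝ) (B : X →ₗ[ℝ] Y →ₗ[ℝ] ℝ)
    (n : Y →ₗ[ℝ] Y →ₗ[ℝ] ℝ) (b : P →ₗ[ℝ] Y →ₗ[ℝ] ℝ) (ha : ∀ S, a S S ≤ 0 → S = 0)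
    (hB : ∀ w, (∀ H, B H w = 0) → w = 0) (hn : ∀ w, (∀ q, b q w = 0) → 0 ≤ n w w)
    (l : Y →ₗ[ℝ] ℝ) :
    ∃ S w r, (∀ H, a S H = B H w) ∧ (∀ v, B S v + n w v + b r v = l v) ∧ ∀ q, b q w = 0 := by
  let Z : Submodule ℝ Y := ⨅ q, LinearMap.ker (b q)
  have hZ : ∀ w, w ∈ Z ↔ ∀ q, b q w = 0 := fun w => by
    simp [Z, Submodule.mem_iInf]
  let F : X × Z →ₗ[ℝ] Module.Dual ℝ (X × Z) := LinearMap.mk₂ ℝ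
    (fun p p' : X × Z => a p.1 p'.1 - B p'.1 p.2 + B p.1 p'.2 + n p.2 p'.2)
    (fun _ _ _ => by simp; ring) (fun _ _ _ => by simp; ring)
    (fun _ _ _ => by simp; ring) (fun _ _ _ => by simp; ring)
  have hF : ∀ p p' : X × Z, F p p' = a p.1 p'.1 - B p'.1 p.2 + B p.1 p'.2 + n p.2 p'.2 :=
    fun _ _ => rfl
  have hinj : Function.Injective F := by
    refine (injective_iff_map_eq_zero F).2 fun ⟨S, w⟩ h => ?_
    have hw := (hZ w).1 w.2
    have h1 : F (S, w) (S, w) = 0 := by rw [h]; rfl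
    rw [hF] at h1
    simp only at h1
    have hS : S = 0 := ha S (by linarith [hn w hw])
    subst hS
    have h2 : (w : Y) = 0 := hB w fun H => by
      have : F (0, w) (H, 0) = 0 := by rw [h]; rfl
      rw [hF] at this
      simpa using this
    rw [Prod.mk_eq_zero]
    exact ⟨rfl, Subtype.ext h2⟩
  have hsurj := (LinearMap.injective_iff_surjective_of_finrank_eq_finrank
    (Subspace.dual_finrank_eq (K := ℝ) (V := X × Z)).symm).1 hinj
  obtain ⟨⟨S, w⟩, hSw⟩ := hsurj ((l ∘ₗ Z.subtype) ∘ₗ LinearMap.snd ℝ X Z)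
  have hSw' : ∀ H : X, ∀ v : Z, a S H - B H w + B S v + n w v = l v := fun H v => by
    rw [← hF (S, w) (H, v), hSw]; rfl
  obtain ⟨r, hr⟩ := exists_multiplier b (l - B S - n w) fun v hv => by
    have := hSw' 0 ⟨v, (hZ v).2 hv⟩
    simp at this ⊢
    linarith
  refine ⟨S, w, r, fun H => ?_, fun v => ?_, (hZ w).1 w.2⟩
  · have := hSw' H 0
    simp at this
    linarith
  · rw [hr]; simp

end SaddlePoint

namespace StaggeredMesh

variable {Ω : Set Pt} (M : StaggeredMesh Ω)

/-! ### The load -/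

lemma load_add (hb : Bornology.IsBounded Ω) {f g : Pt → Pt} (hf : MemLp f 2 (volume.restrict Ω))
    (hg : MemLp g 2 (volume.restrict Ω)) (v : M.Vec) :
    M.load (f + g) v = M.load f v + M.load g v := by
  rw [M.load_eq hb hf, M.load_eq hb hg, M.load_eq hb (hf.add hg), ← Finset.sum_add_distrib]
  refine Finset.sum_congr rfl fun τ _ => ?_
  rw [← Finset.sum_add_distrib]
  refine Finset.sum_congr rfl fun j _ => ?_
  rw [← integral_add (M.integrableOn_mul_ev (integrableOn_apply hb hf j) τ (M.continuous_comp v j τ))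
    (M.integrableOn_mul_ev (integrableOn_apply hb hg j) τ (M.continuous_comp v j τ))]
  simp [add_mul]

lemma load_congr {f g : Pt → Pt} (h : f =ᵐ[volume.restrict Ω] g) (v : M.Vec) :
    M.load f v = M.load g v := by
  unfold load meshInt
  refine Finset.sum_congr rfl fun τ _ => integral_congr_ae ?_
  filter_upwards [ae_mono (M.restrict_cell_le τ) h] with y hy
  rw [hy]

/-- The load as a linear functional. -/
def loadL (hb : Bornology.IsBounded Ω) {f : Pt → Pt} (hf : MemLp f 2 (volume.restrict Ω)) :
    M.Vec →ₗ[ℝ] ℝ where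
  toFun := M.load f
  map_add' u v := by
    have hi := fun (v : M.Vec) τ j =>
      M.integrableOn_mul_ev (integrableOn_apply hb hf j) τ (M.continuous_comp v j τ)
    have hc : ∀ j τ y, (u + v).comp j τ y = u.comp j τ y + v.comp j τ y := fun j τ y => by
      simp [Vec.comp]
    simp only [M.load_eq hb hf, ← Finset.sum_add_distrib]
    refine Finset.sum_congr rfl fun τ _ => Finset.sum_congr rfl fun j _ => ?_
    rw [← integral_add (hi u τ j) (hi v τ j)]
    simp only [hc, mul_add]
  map_smul' r v := by
    have hc : ∀ j τ y, (r • v).comp j τ y = r * v.comp j τ y := fun j τ y => by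
      simp [Vec.comp]
    simp only [M.load_eq hb hf, RingHom.id_apply, smul_eq_mul, Finset.mul_sum]
    refine Finset.sum_congr rfl fun τ _ => Finset.sum_congr rfl fun j _ => ?_
    rw [← integral_const_mul]
    simp only [hc, mul_left_comm]

lemma l2Norm_sq {f : Pt → Pt} (hf : MemLp f 2 (volume.restrict Ω)) :
    l2Norm Ω f ^ 2 = ∑ τ, ∑ j, ∫ y in M.cell τ, f y j ^ 2 := by
  have hi : ∀ j, IntegrableOn (fun y => f y j ^ 2) Ω := fun j => (memLp_apply hf j).integrable_sq
  have h1 : l2Norm Ω f ^ 2 = ∫ y in Ω, ‖f y‖ ^ 2 := by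
    rw [l2Norm, hf.eLpNorm_eq_integral_rpow_norm (by norm_num) (by norm_num),
      ENNReal.toReal_ofReal (by positivity), ← Real.rpow_natCast, ← Real.rpow_mul (by positivity)]
    simp
  have h2 : ∀ y, ‖f y‖ ^ 2 = ∑ j, f y j ^ 2 := fun y => by
    rw [EuclideanSpace.norm_sq_eq]; simp
  rw [h1]
  simp only [h2]
  rw [M.integral_domain (integrable_finsetSum _ fun j _ => hi j)]
  exact Finset.sum_congr rfl fun τ _ => integral_finsetSum _ fun j _ =>
    M.integrableOn_domain_iff.1 (hi j) τ

lemma load_sq_le (hb : Bornology.IsBounded Ω) {f : Pt → Pt} (hf : MemLp f 2 (volume.restrict Ω))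
    (v : M.Vec) : M.load f v ^ 2 ≤ l2Norm Ω f ^ 2 * ∑ τ, M.cellSq v τ := by
  have h : ∀ t : ℝ, 0 ≤ l2Norm Ω f ^ 2 * (t * t) + (-2 * M.load f v) * t + ∑ τ, M.cellSq v τ := by
    intro t
    have hi : ∀ j τ, IntegrableOn (fun y => f y j ^ 2) (M.cell τ) := fun j =>
      M.integrableOn_domain_iff.1 (memLp_apply hf j).integrable_sq
    have hfv := fun τ j =>
      M.integrableOn_mul_ev (integrableOn_apply hb hf j) τ (M.continuous_comp v j τ)
    have hv : ∀ τ j, IntegrableOn (fun y => v.comp j τ y ^ 2) (M.cell τ) := fun τ j =>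
      ((M.continuous_comp v j τ).pow 2).continuousOn.integrableOn_compact (M.isCompact_cell τ)
    have e : ∀ τ j, ∫ y in M.cell τ, (t * f y j - v.comp j τ y) ^ 2 =
        (t * t) * (∫ y in M.cell τ, f y j ^ 2) + (-2 * t) * (∫ y in M.cell τ, f y j * v.comp j τ y) +
        ∫ y in M.cell τ, v.comp j τ y ^ 2 := by
      intro τ j
      have hs : IntegrableOn (fun y => t * t * f y j ^ 2 + -2 * t * (f y j * v.comp j τ y))
          (M.cell τ) := ((hi j τ).const_mul _).add ((hfv τ j).const_mul _)
      rw [← integral_const_mul, ← integral_const_mul, ← integral_add ((hi j τ).const_mul _)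
        ((hfv τ j).const_mul _), ← integral_add hs (hv τ j)]
      refine integral_congr_ae (Filter.Eventually.of_forall fun y => ?_)
      simp only; ring
    have hc : ∀ τ, M.cellSq v τ = ∑ j, ∫ y in M.cell τ, v.comp j τ y ^ 2 := fun τ =>
      integral_finsetSum _ fun j _ => hv τ j
    have hpos : 0 ≤ ∑ τ, ∑ j, ∫ y in M.cell τ, (t * f y j - v.comp j τ y) ^ 2 :=
      Finset.sum_nonneg fun τ _ => Finset.sum_nonneg fun j _ => integral_nonneg fun y => sq_nonneg _
    simp only [e, Finset.sum_add_distrib, ← Finset.mul_sum] at hpos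
    rw [M.l2Norm_sq hf, M.load_eq hb hf]
    simp only [hc]
    linarith
  have := discrim_le_zero h
  rw [discrim] at this
  nlinarith

lemma load_le (hb : Bornology.IsBounded Ω) {f : Pt → Pt} (hf : MemLp f 2 (volume.restrict Ω))
    {v : M.Vec} {C : ℝ} (hC : 0 ≤ C) (hv : ∑ τ, M.cellSq v τ ≤ C * M.hNorm v ^ 2) :
    M.load f v ≤ √C * l2Norm Ω f * M.hNorm v := by
  have hf0 : 0 ≤ l2Norm Ω f := ENNReal.toReal_nonneg
  have hv0 := M.hNorm_nonneg v
  refine le_of_abs_le (abs_le_of_sq_le_sq ?_ (by positivity))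
  calc M.load f v ^ 2 ≤ l2Norm Ω f ^ 2 * ∑ τ, M.cellSq v τ := M.load_sq_le hb hf v
    _ ≤ l2Norm Ω f ^ 2 * (C * M.hNorm v ^ 2) := by gcongr
    _ = _ := by rw [mul_pow, mul_pow, Real.sq_sqrt hC]; ring

/-! ### Definiteness of the norms -/

lemma eq_zero_of_tenInner_self {S : M.Ten} (h : M.tenInner S S = 0) : S = 0 := by
  have hi : ∀ τ i j, 0 ≤ ∫ y in M.cell τ, ev y (S τ i j) ^ 2 := fun τ i j =>
    integral_nonneg fun y => sq_nonneg _
  have h1 : M.tenInner S S = ∑ τ, ∑ i, ∑ j, ∫ y in M.cell τ, ev y (S τ i j) ^ 2 := by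
    unfold tenInner meshInt
    refine Finset.sum_congr rfl fun τ _ => ?_
    have hc : ∀ i j, IntegrableOn (fun y => ev y (S τ i j) ^ 2) (M.cell τ) := fun i j =>
      ((continuous_ev _).pow 2).continuousOn.integrableOn_compact (M.isCompact_cell τ)
    rw [← Finset.sum_congr rfl fun i _ => integral_finsetSum _ fun j _ => hc i j,
      ← integral_finsetSum _ fun i _ => integrable_finsetSum _ fun j _ => hc i j]
    simp only [Ten.comp, sq]
  rw [h1] at h
  have h2 := (Finset.sum_eq_zero_iff_of_nonneg fun τ _ => Finset.sum_nonneg fun i _ =>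
    Finset.sum_nonneg fun j _ => hi τ i j).1 h
  funext τ i j
  have h3 := (Finset.sum_eq_zero_iff_of_nonneg fun i _ => Finset.sum_nonneg fun j _ => hi τ i j).1
    (h2 τ (Finset.mem_univ τ)) i (Finset.mem_univ i)
  have h4 := (Finset.sum_eq_zero_iff_of_nonneg fun j _ => hi τ i j).1 h3 j (Finset.mem_univ j)
  exact eq_zero_of_integral_sq (M.isCompact_cell τ) (M.interior_cell_nonempty τ) h4

lemma eq_zero_of_sum_cellSq {v : M.Vec} (h : ∑ τ, M.cellSq v τ ≤ 0) : v = 0 := by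
  have h2 := (Finset.sum_eq_zero_iff_of_nonneg fun τ _ => M.cellSq_nonneg v τ).1
    (h.antisymm (Finset.sum_nonneg fun τ _ => M.cellSq_nonneg v τ))
  funext τ i
  have hc : ∀ i, IntegrableOn (fun y => v.comp i τ y ^ 2) (M.cell τ) := fun i =>
    ((M.continuous_comp v i τ).pow 2).continuousOn.integrableOn_compact (M.isCompact_cell τ)
  have h3 := h2 τ (Finset.mem_univ τ)
  rw [cellSq, integral_finsetSum _ fun i _ => hc i] at h3
  exact eq_zero_of_integral_sq (M.isCompact_cell τ) (M.interior_cell_nonempty τ)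
    ((Finset.sum_eq_zero_iff_of_nonneg fun i _ => integral_nonneg fun y => sq_nonneg _).1 h3 i
      (Finset.mem_univ i))

lemma tenInner_le (S H : M.Ten) : M.tenInner S H ≤ M.tenNorm S * M.tenNorm H := by
  have hpos : ∀ H : M.Ten, 0 ≤ M.tenInnerL H H := fun H => by
    change 0 ≤ M.tenInner H H
    rw [← M.tenNorm_sq]; positivity
  have hsymm : M.tenInner H S = M.tenInner S H := by
    unfold tenInner
    simp only [mul_comm]
  have h : M.tenInner S H * M.tenInner H S ≤ M.tenInner S S * M.tenInner H H :=
    LinearMap.BilinForm.apply_mul_apply_le_of_forall_zero_le M.tenInnerL hpos S H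
  rw [hsymm, ← M.tenNorm_sq, ← M.tenNorm_sq] at h
  exact le_of_abs_le (abs_le_of_sq_le_sq (by nlinarith)
    (mul_nonneg (M.tenNorm_nonneg S) (M.tenNorm_nonneg H)))

end StaggeredMesh
end
end StaggeredDG

namespace StaggeredDG
noncomputable section
namespace StaggeredMesh

variable {Ω : Set Pt} (M : StaggeredMesh Ω)

/-! ### The linearized problem -/

lemma one_mem_QSpace (k : ℕ) : (fun _ => 1 : M.Sca) ∈ M.QSpace k := by
  refine ⟨fun τ => by simp, fun τ hτ y _ => ?_⟩
  obtain ⟨σ, hσ⟩ := Option.isSome_iff_exists.1 hτ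
  simp [jumpPr, hσ, Sca.val]

lemma formb_one (v : M.Vec) : M.formb v (fun _ => 1) = 0 := by
  simp [formb, Sca.grad, Sca.val, jumpDl, meshInt, intDl, edgeInt]

lemma formbStar_eq_zero {k : ℕ} {v : M.Vec} (hv : v ∈ M.VSpace k)
    (h : ∀ q ∈ M.QSpaceZero k, M.formbStar q v = 0) {q : M.Sca} (hq : q ∈ M.QSpace k) :
    M.formbStar q v = 0 := by
  rcases isEmpty_or_nonempty (Fin M.N) with hN | ⟨⟨τ0⟩⟩
  · exact h q ⟨hq, by simp [meshInt]⟩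
  · set e : M.Sca := fun _ => 1 with he
    have hm : 0 < M.meshInt e.val := by
      have h1 : ∀ τ, 0 < ∫ y in M.cell τ, e.val τ y := fun τ => by
        have hpos : 0 < volume (M.cell τ) := (isOpen_interior.measure_pos volume
          (M.interior_cell_nonempty τ)).trans_le (measure_mono interior_subset)
        simpa [he, Sca.val, Measure.real] using ENNReal.toReal_pos hpos.ne' (M.isCompact_cell τ).measure_ne_top
      exact Finset.sum_pos (fun τ _ => h1 τ) ⟨τ0, Finset.mem_univ _⟩
    have h1 : M.formbStar e v = 0 := by
      have := M.formb_eq_neg (M.one_mem_QSpace k) hv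
      rw [M.formb_one] at this
      exact neg_eq_zero.1 this.symm
    set r : ℝ := M.meshInt q.val / M.meshInt e.val with hr
    have h2 : q - r • e ∈ M.QSubZero k := by
      refine Submodule.mem_inf.2 ⟨(M.QSub k).sub_mem hq ((M.QSub k).smul_mem r
        (M.one_mem_QSpace k)), ?_⟩
      rw [LinearMap.mem_ker, map_sub, map_smul, meshIntL_apply, meshIntL_apply, smul_eq_mul, hr,
        div_mul_cancel₀ _ hm.ne', sub_self]
    have h3 : M.formbStarL (q - r • e) v = 0 := h _ (M.mem_QSubZero.1 h2)
    rw [map_sub, map_smul, LinearMap.sub_apply, LinearMap.smul_apply] at h3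
    change M.formbStar q v - r • M.formbStar e v = 0 at h3
    rwa [h1, smul_zero, sub_zero] at h3

/-- The equations of the linearized problem, one for each test function. -/
lemma isThImage_iff {k : ℕ} {ν : ℝ} {f : Pt → Pt} {z w : M.Vec} :
    M.IsThImage k ν f z w ↔ w ∈ M.VSpace k ∧ ∃ S ∈ M.HSpace k, ∃ r ∈ M.QSpaceZero k,
      (∀ H ∈ M.HSpace k, ν⁻¹ * M.tenInner S H = M.formB H w) ∧
      (∀ v ∈ M.VSpace k, M.formB S v + M.formN z w v + M.formbStar r v = M.load f v) ∧
      ∀ q ∈ M.QSpace k, M.formb w q = 0 := by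
  have zH : (0 : M.Ten) ∈ M.HSpace k := (M.HSub k).zero_mem
  have zV : (0 : M.Vec) ∈ M.VSpace k := (M.VSub k).zero_mem
  have zQ : (0 : M.Sca) ∈ M.QSpace k := (M.QSub k).zero_mem
  have l0 : M.load f 0 = 0 := by simp [load, meshInt, Vec.comp]
  have N0 : M.formN z w 0 = 0 := map_zero (M.formNL z w)
  have B0 : ∀ S, M.formB S 0 = 0 := fun S => map_zero (M.formBL S)
  have B0' : ∀ v, M.formB 0 v = 0 := fun v => by
    change M.formBL 0 v = 0
    rw [map_zero]; rfl
  have b0 : ∀ r, M.formbStar r 0 = 0 := fun r => map_zero (M.formbStarL r)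
  have b0' : ∀ v, M.formbStar 0 v = 0 := fun v => by
    change M.formbStarL 0 v = 0
    rw [map_zero]; rfl
  have t0 : ∀ S, M.tenInner S 0 = 0 := fun S => map_zero (M.tenInnerL S)
  refine and_congr_right fun hw => exists_congr fun S => and_congr_right fun hS =>
    exists_congr fun r => and_congr_right fun hr => ⟨fun h => ⟨fun H hH => ?_, fun v hv => ?_,
      fun q hq => ?_⟩, fun h H hH v hv q hq => ?_⟩
  · have := h H hH 0 zV 0 zQ
    rw [formA, M.formBStar_eq_neg hH hw, M.formb_eq_neg zQ hw, b0', B0, b0, N0, l0] at this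
    linarith
  · have := h 0 zH v hv 0 zQ
    rw [formA, M.formBStar_eq_neg zH hw, M.formb_eq_neg zQ hw, b0', B0', t0] at this
    linarith
  · have := h 0 zH 0 zV q hq
    rw [formA, M.formBStar_eq_neg zH hw, B0', B0, b0, N0, l0, t0] at this
    linarith
  · rw [formA, M.formBStar_eq_neg hH hw, h.1 H hH, h.2.2 q hq, ← h.2.1 v hv]
    ring

/-- Coercivity of the convection form for convective velocities in `V_h^div`. -/
lemma formN_nonneg_of_mem_VDiv {k : ℕ} {z : M.Vec} (hz : z ∈ M.VDiv k) (w : M.Vec) :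
    0 ≤ M.formN z w w :=
  M.formN_nonneg hz.1 (M.div_eq_zero_of_hasWeakDiv hz.2) (fun τ hτ => by
    obtain ⟨σ, hσ⟩ := Option.isSome_iff_exists.1 hτ
    exact M.jump_eq_zero_of_hasWeakDiv hz.2 hσ) w

lemma exists_isThImage {k : ℕ} (hb : Bornology.IsBounded Ω) {f : Pt → Pt}
    (hf : MemLp f 2 (volume.restrict Ω))
    (hinj : ∀ w ∈ M.VSpace k, (∀ H ∈ M.HSpace k, M.formB H w = 0) → w = 0) {ν : ℝ} (hν : 0 < ν)
    {z : M.Vec} (hz : z ∈ M.VDiv k) : ∃ w, M.IsThImage k ν f z w := by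
  let iH := (M.HSub k).subtype
  let iV := (M.VSub k).subtype
  let iQ := (M.QSubZero k).subtype
  have ha : ∀ S, (ν⁻¹ • (M.tenInnerL.compl₁₂ iH iH)) S S ≤ 0 → S = 0 := fun S hS => by
    have h : ν⁻¹ * M.tenInner S S ≤ 0 := hS
    have h0 : M.tenInner S S ≤ 0 := by
      by_contra h'
      push Not at h'
      have := mul_pos (inv_pos.2 hν) h'
      linarith
    refine Subtype.ext (M.eq_zero_of_tenInner_self (le_antisymm h0 ?_))
    rw [← M.tenNorm_sq]; positivity
  obtain ⟨S, w, r, h1, h2, h3⟩ := exists_saddle_point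
    (ν⁻¹ • (M.tenInnerL.compl₁₂ iH iH)) (M.formBL.compl₁₂ iH iV) ((M.formNL z).compl₁₂ iV iV)
    (M.formbStarL.compl₁₂ iQ iV) ha
    (fun w hw => Subtype.ext (hinj w w.2 fun H hH => hw ⟨H, hH⟩))
    (fun w _ => M.formN_nonneg_of_mem_VDiv hz w) (M.loadL hb hf ∘ₗ iV)
  refine ⟨w, M.isThImage_iff.2 ⟨w.2, S, S.2, r, M.mem_QSubZero.1 r.2, fun H hH => h1 ⟨H, hH⟩,
    fun v hv => h2 ⟨v, hv⟩, fun q hq => ?_⟩⟩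
  rw [M.formb_eq_neg hq w.2, M.formbStar_eq_zero w.2
    (fun q hq => h3 ⟨q, M.mem_QSubZero.2 hq⟩) hq, neg_zero]

lemma isThImage_unique {k : ℕ} {f : Pt → Pt}
    (hinj : ∀ w ∈ M.VSpace k, (∀ H ∈ M.HSpace k, M.formB H w = 0) → w = 0) {ν : ℝ} (hν : 0 < ν)
    {z : M.Vec} (hz : z ∈ M.VDiv k) {w w' : M.Vec} (hw : M.IsThImage k ν f z w)
    (hw' : M.IsThImage k ν f z w') : w = w' := by
  obtain ⟨hV, S, hS, r, hr, a1, a2, a3⟩ := M.isThImage_iff.1 hw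
  obtain ⟨hV', S', hS', r', hr', b1, b2, b3⟩ := M.isThImage_iff.1 hw'
  have hVd : w - w' ∈ M.VSpace k := (M.VSub k).sub_mem hV hV'
  have hSd : S - S' ∈ M.HSpace k := (M.HSub k).sub_mem hS hS'
  have c1 : ∀ H ∈ M.HSpace k, ν⁻¹ * M.tenInner (S - S') H = M.formB H (w - w') := by
    intro H hH
    have e1 : M.tenInner (S - S') H = M.tenInner S H - M.tenInner S' H := by
      change M.tenInnerL (S - S') H = _
      rw [map_sub]; rfl
    have e2 : M.formB H (w - w') = M.formB H w - M.formB H w' := map_sub (M.formBL H) w w'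
    rw [e1, e2, mul_sub, a1 H hH, b1 H hH]
  have hstar : ∀ q ∈ M.QSpaceZero k, M.formbStar q (w - w') = 0 := by
    intro q hq
    have e2 : M.formbStar q (w - w') = M.formbStar q w - M.formbStar q w' :=
      map_sub (M.formbStarL q) w w'
    have x1 := a3 q hq.1
    have x2 := b3 q hq.1
    rw [M.formb_eq_neg hq.1 hV] at x1
    rw [M.formb_eq_neg hq.1 hV'] at x2
    rw [e2]; linarith
  have c2 : M.formB (S - S') (w - w') + M.formN z (w - w') (w - w') = 0 := by
    have x1 := a2 _ hVd
    have x2 := b2 _ hVd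
    rw [hstar r hr] at x1
    rw [hstar r' hr'] at x2
    have e1 : M.formB (S - S') (w - w') = M.formB S (w - w') - M.formB S' (w - w') :=
      LinearMap.map_sub₂ M.formBL S S' (w - w')
    have e2 : M.formN z (w - w') (w - w') = M.formN z w (w - w') - M.formN z w' (w - w') :=
      LinearMap.map_sub₂ (M.formNL z) w w' (w - w')
    rw [e1, e2]; linarith
  have hN := M.formN_nonneg_of_mem_VDiv hz (w - w')
  rw [← c1 _ hSd] at c2
  have hS0 : 0 ≤ M.tenInner (S - S') (S - S') := by
    rw [← M.tenNorm_sq]; positivity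
  have h0 : M.tenInner (S - S') (S - S') = 0 := by
    rcases hS0.eq_or_lt with h | h
    · exact h.symm
    · have := mul_pos (inv_pos.2 hν) h
      linarith
  have hSz := M.eq_zero_of_tenInner_self h0
  refine sub_eq_zero.1 (hinj _ hVd fun H hH => ?_)
  rw [← c1 H hH, hSz]
  have : M.tenInner 0 H = 0 := by
    change M.tenInnerL 0 H = 0
    rw [map_zero]; rfl
  rw [this, mul_zero]

/-- The a priori bound for images of the solution operator. -/
lemma hNorm_le_of_isThImage {k : ℕ} (hb : Bornology.IsBounded Ω) {f : Pt → Pt}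
    (hf : MemLp f 2 (volume.restrict Ω)) {C : ℝ} (hC : 0 ≤ C)
    (hP : ∀ v ∈ M.VSpace k, ∑ τ, M.cellSq v τ ≤ C * M.hNorm v ^ 2) {ν : ℝ} (hν : 0 < ν)
    {z w : M.Vec} (hz : z ∈ M.VDiv k) (hw : M.IsThImage k ν f z w) {β : ℝ} (hβ : 0 < β)
    (hβ' : (β : EReal) ≤ M.infSup k) :
    M.hNorm w ≤ √C * β ^ (-2 : ℤ) * ν⁻¹ * l2Norm Ω f := by
  obtain ⟨hV, S, hS, r, hr, a1, a2, a3⟩ := M.isThImage_iff.1 hw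
  have hf0 : 0 ≤ l2Norm Ω f := ENNReal.toReal_nonneg
  have hβz : β ^ (-2 : ℤ) = (β ^ 2)⁻¹ := by rw [zpow_neg]; norm_cast
  have hi : 0 < ν⁻¹ := inv_pos.2 hν
  rcases (M.hNorm_nonneg w).eq_or_lt with h0 | hpos
  · rw [← h0, hβz]; positivity
  have hS0 := M.tenNorm_nonneg S
  have key : β * M.hNorm w ≤ ν⁻¹ * M.tenNorm S := by
    have hwne : w ≠ 0 := by
      rintro rfl
      have h0 : M.hNorm 0 ^ 2 = 0 := by
        have hv : ∀ σ, (0 : M.Vec) σ = 0 := fun _ => rfl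
        rw [M.hNorm_sq]
        simp [gradSq, jumpPrSq, jumpDlSq, meshInt, Vec.grad, Vec.comp, Vec.dot, jumpPr, jumpDl,
          intPr, intDl, edgeInt]
        refine Finset.sum_eq_zero fun τ _ => ?_
        cases M.nbr τ <;> simp
      exact hpos.ne' (pow_eq_zero_iff two_ne_zero |>.1 h0)
    have h1 : (β : EReal) ≤ ((ν⁻¹ * M.tenNorm S / M.hNorm w : ℝ) : EReal) := by
      refine (hβ'.trans (iInf₂_le w ⟨hV, hwne⟩)).trans (iSup₂_le fun H hH => ?_)
      rw [EReal.coe_le_coe_iff, ← a1 H hH.1]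
      rcases (M.tenNorm_nonneg H).eq_or_lt with hH0 | hH0
      · rw [← hH0, zero_mul, div_zero]; positivity
      · rw [div_le_div_iff₀ (by positivity) hpos]
        have := mul_le_mul_of_nonneg_left (M.tenInner_le S H) (mul_pos hi hpos).le
        nlinarith
    rw [EReal.coe_le_coe_iff, le_div_iff₀ hpos] at h1
    exact h1
  have energy : ν⁻¹ * M.tenNorm S ^ 2 ≤ M.load f w := by
    have x := a2 w hV
    have y := a3 r hr.1
    rw [M.formb_eq_neg hr.1 hV] at y
    rw [M.tenNorm_sq, a1 S hS]
    have := M.formN_nonneg_of_mem_VDiv hz w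
    linarith
  have hload := M.load_le hb hf hC (hP w hV)
  have h2 : (β * M.hNorm w) ^ 2 ≤ ν⁻¹ * (√C * l2Norm Ω f * M.hNorm w) := by
    calc (β * M.hNorm w) ^ 2 ≤ (ν⁻¹ * M.tenNorm S) ^ 2 := by gcongr
      _ = ν⁻¹ * (ν⁻¹ * M.tenNorm S ^ 2) := by ring
      _ ≤ _ := mul_le_mul_of_nonneg_left (energy.trans hload) hi.le
  have h3 : β ^ 2 * M.hNorm w ≤ ν⁻¹ * (√C * l2Norm Ω f) := by
    have : (β ^ 2 * M.hNorm w) * M.hNorm w ≤ (ν⁻¹ * (√C * l2Norm Ω f)) * M.hNorm w := by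
      calc _ = (β * M.hNorm w) ^ 2 := by ring
        _ ≤ _ := h2
        _ = _ := by ring
    exact le_of_mul_le_mul_right this hpos
  rw [hβz]
  calc M.hNorm w = (β ^ 2)⁻¹ * (β ^ 2 * M.hNorm w) := by field_simp
    _ ≤ (β ^ 2)⁻¹ * (ν⁻¹ * (√C * l2Norm Ω f)) := by gcongr
    _ = _ := by ring

/-! ### Irrotational forces -/

/-- An irrotational force is balanced by a discrete pressure. -/
lemma exists_pressure (hΩ : IsOpen Ω) (hb : Bornology.IsBounded Ω) (k : ℕ) {f f₀ : Pt → Pt}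
    {χ : Pt → ℝ} (h : IsHelmholtzHodge Ω f f₀ χ) :
    ∃ r ∈ M.QSubZero k, ∀ v ∈ M.VSpace k, M.load f v = M.load f₀ v + M.formbStar r v := by
  obtain ⟨g, hg, hgrad, hfg⟩ := h.decomposition
  let iV := (M.VSub k).subtype
  obtain ⟨r, hr⟩ := exists_multiplier (M.formbStarL.compl₁₂ (M.QSubZero k).subtype iV)
    (M.loadL hb hg ∘ₗ iV) fun v hv => by
      refine M.load_gradient_eq_zero hΩ hb h.memLp_potential hg hgrad v.2 fun q hq => ?_
      change M.formb (v : M.Vec) q = 0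
      rw [M.formb_eq_neg hq v.2, M.formbStar_eq_zero v.2
        (fun q hq => hv ⟨q, M.mem_QSubZero.2 hq⟩) hq, neg_zero]
  refine ⟨r, r.2, fun v hv => ?_⟩
  rw [M.load_congr hfg, M.load_add hb h.memLp_solenoidal hg]
  congr 1
  exact (LinearMap.congr_fun hr ⟨v, hv⟩).symm

lemma formbStar_add (p r : M.Sca) (v : M.Vec) :
    M.formbStar (p + r) v = M.formbStar p v + M.formbStar r v := by
  change M.formbStarL (p + r) v = _
  rw [map_add]; rfl

lemma IsThImage.of_load {k : ℕ} {ν : ℝ} {f f' : Pt → Pt} {z w : M.Vec} {r' : M.Sca}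
    (hr' : r' ∈ M.QSubZero k) (h : ∀ v ∈ M.VSpace k, M.load f' v = M.load f v + M.formbStar r' v)
    (hw : M.IsThImage k ν f z w) : M.IsThImage k ν f' z w := by
  obtain ⟨hV, S, hS, r, hr, h1, h2, h3⟩ := M.isThImage_iff.1 hw
  refine M.isThImage_iff.2 ⟨hV, S, hS, r + r',
    M.mem_QSubZero.1 ((M.QSubZero k).add_mem (M.mem_QSubZero.2 hr) hr'), h1, fun v hv => ?_, h3⟩
  rw [h v hv, ← h2 v hv, M.formbStar_add]
  ring

lemma IsDiscreteSolution.of_load {k : ℕ} {ν : ℝ} {f f' : Pt → Pt} {G : M.Ten} {u : M.Vec}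
    {p r' : M.Sca} (hr' : r' ∈ M.QSubZero k)
    (h : ∀ v ∈ M.VSpace k, M.load f' v = M.load f v + M.formbStar r' v)
    (hu : M.IsDiscreteSolution k ν f G u p) : M.IsDiscreteSolution k ν f' G u (p + r') := by
  obtain ⟨hG, hV, hp, h1, h2, h3⟩ := hu
  refine ⟨hG, hV, M.mem_QSubZero.1 ((M.QSubZero k).add_mem (M.mem_QSubZero.2 hp) hr'), h1,
    fun v hv => ?_, h3⟩
  rw [h v hv, ← h2 v hv, M.formbStar_add]
  ring

/-- The lower bound of the inf-sup constant. -/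
lemma le_infSup {k : ℕ} {C : ℝ} (hC : 0 < C)
    (hst : ∀ v ∈ M.VSpace k, ∃ H ∈ M.HSpace k, M.formB H v = M.hNorm v ^ 2 ∧
      M.tenInner H H ≤ C * M.hNorm v ^ 2)
    (hpos : ∀ v ∈ M.VSpace k, v ≠ 0 → 0 < M.hNorm v) : (((√C)⁻¹ : ℝ) : EReal) ≤ M.infSup k := by
  refine le_iInf₂ fun v hv => ?_
  obtain ⟨H, hH, h1, h2⟩ := hst v hv.1
  have hv0 := hpos v hv.1 hv.2
  have hne : H ≠ 0 := by
    rintro rfl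
    have : M.formB 0 v = 0 := by
      change M.formBL 0 v = 0
      rw [map_zero]; rfl
    rw [this] at h1
    exact (pow_pos hv0 2).ne h1
  refine le_iSup₂_of_le H ⟨hH, hne⟩ ?_
  rw [EReal.coe_le_coe_iff, h1]
  have hH0 : 0 < M.tenNorm H := by
    refine (M.tenNorm_nonneg H).lt_of_ne fun h => hne (M.eq_zero_of_tenInner_self ?_)
    rw [← M.tenNorm_sq, ← h]; norm_num
  have hle : M.tenNorm H ≤ √C * M.hNorm v := by
    refine le_of_abs_le (abs_le_of_sq_le_sq ?_ (by positivity))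
    rw [M.tenNorm_sq, mul_pow, Real.sq_sqrt hC.le]
    exact h2
  rw [inv_eq_one_div, div_le_div_iff₀ (by positivity) (by positivity)]
  nlinarith

end StaggeredMesh

end
end StaggeredDG

theorem mainTheorem6 (Ω : Set StaggeredDG.Pt) (hopen : IsOpen Ω) (hconn : IsConnected Ω)
    (hbdd : Bornology.IsBounded Ω) (k : ℕ) (ρE ρB : ℝ) (hρE : 0 < ρE) (hρB : 0 < ρB) :
    ∃ C_B C_P : ℝ, 0 < C_B ∧ 0 < C_P ∧
      ∀ M : StaggeredDG.StaggeredMesh Ω, M.IsRegular ρE ρB →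
        (C_B : EReal) ≤ M.infSup k ∧
        ∀ ν : ℝ, 0 < ν → ∀ (f f₀ : StaggeredDG.Pt → StaggeredDG.Pt) (χ : StaggeredDG.Pt → ℝ),
          MemLp f 2 (volume.restrict Ω) → StaggeredDG.IsHelmholtzHodge Ω f f₀ χ →
          (∀ z ∈ M.VDiv k,
            (∀ w : M.Vec, M.IsThImage k ν f z w ↔ w = M.Th k ν f z) ∧
            M.hNorm (M.Th k ν f z) ≤ C_B ^ (-2 : ℤ) * ν⁻¹ * StaggeredDG.l2Norm Ω f₀ ∧
            (∀ β : ℝ, 0 < β → (β : EReal) ≤ M.infSup k →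
              M.hNorm (M.Th k ν f z) ≤ C_P * β ^ (-2 : ℤ) * ν⁻¹ * StaggeredDG.l2Norm Ω f₀) ∧
            M.Th k ν f z = M.Th k ν f₀ z) ∧
          ∀ u : M.Vec, (∃ (G : M.Ten) (p : M.Sca), M.IsDiscreteSolution k ν f G u p) ↔
            ∃ (G : M.Ten) (p : M.Sca), M.IsDiscreteSolution k ν f₀ G u p := by
  obtain ⟨C, hC, hP⟩ := StaggeredDG.StaggeredMesh.exists_poincare Ω hbdd k hρE hρB
  obtain ⟨C', hC', hst⟩ := StaggeredDG.StaggeredMesh.exists_stable_tensor k hρE hρB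
  set β₀ : ℝ := (√C')⁻¹ with hβ₀
  have hβ₀pos : 0 < β₀ := by positivity
  have hsq : 0 < √C := Real.sqrt_pos.2 hC
  set m : ℝ := min 1 (√√C)⁻¹ with hm
  have hmpos : 0 < m := lt_min one_pos (by positivity)
  have hm2 : √C * m ^ 2 ≤ 1 := by
    have h1 : m ^ 2 ≤ ((√√C)⁻¹) ^ 2 := pow_le_pow_left₀ hmpos.le (min_le_right _ _) 2
    rw [inv_pow, Real.sq_sqrt hsq.le] at h1
    calc √C * m ^ 2 ≤ √C * (√C)⁻¹ := by gcongr
      _ = 1 := mul_inv_cancel₀ hsq.ne'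
  refine ⟨β₀ * m, √C, by positivity, hsq, fun M hM => ?_⟩
  have hpos : ∀ v ∈ M.VSpace k, v ≠ 0 → 0 < M.hNorm v := fun v hv hne => by
    refine (M.hNorm_nonneg v).lt_of_ne fun h => hne (M.eq_zero_of_sum_cellSq ?_)
    have := hP M hM v hv
    rwa [← h, zero_pow two_ne_zero, mul_zero] at this
  have hle : (β₀ : EReal) ≤ M.infSup k := M.le_infSup hC' (hst M hM) hpos
  have hinj : ∀ w ∈ M.VSpace k, (∀ H ∈ M.HSpace k, M.formB H w = 0) → w = 0 := by
    intro w hw h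
    by_contra hne
    obtain ⟨H, hH, h1, -⟩ := hst M hM w hw
    rw [h H hH] at h1
    exact (pow_pos (hpos w hw hne) 2).ne h1
  refine ⟨le_trans ?_ hle, fun ν hν f f₀ χ hf hHH => ?_⟩
  · rw [EReal.coe_le_coe_iff]
    exact mul_le_of_le_one_right hβ₀pos.le (min_le_left _ _)
  obtain ⟨r, hr, hload⟩ := M.exists_pressure hopen hbdd k hHH
  have hload' : ∀ v ∈ M.VSpace k, M.load f₀ v = M.load f v + M.formbStar (-r) v := fun v hv => by
    have h1 : M.formbStar (-r) v = -M.formbStar r v := LinearMap.map_neg₂ M.formbStarL r v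
    rw [hload v hv, h1]
    ring
  have hr' : -r ∈ M.QSubZero k := (M.QSubZero k).neg_mem hr
  refine ⟨fun z hz => ?_, fun u => ⟨?_, ?_⟩⟩
  · have heq : M.IsThImage k ν f z = M.IsThImage k ν f₀ z := funext fun w =>
      propext ⟨fun h => h.of_load M hr' hload', fun h => h.of_load M hr hload⟩
    have hTh : M.Th k ν f z = M.Th k ν f₀ z := by
      unfold StaggeredDG.StaggeredMesh.Th
      rw [heq]
    have hspec : M.IsThImage k ν f z (M.Th k ν f z) :=
      Classical.epsilon_spec (M.exists_isThImage hbdd hf hinj hν hz)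
    have hspec₀ : M.IsThImage k ν f₀ z (M.Th k ν f z) := heq ▸ hspec
    have hbound : ∀ β : ℝ, 0 < β → (β : EReal) ≤ M.infSup k →
        M.hNorm (M.Th k ν f z) ≤ √C * β ^ (-2 : ℤ) * ν⁻¹ * StaggeredDG.l2Norm Ω f₀ :=
      fun β hβ hβ' => M.hNorm_le_of_isThImage hbdd hHH.memLp_solenoidal hC.le (hP M hM) hν hz
        hspec₀ hβ hβ'
    refine ⟨fun w => ⟨fun h => M.isThImage_unique hinj hν hz h hspec, fun h => h ▸ hspec⟩, ?_,
      hbound, hTh⟩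
    refine (hbound β₀ hβ₀pos hle).trans ?_
    have hf0 : 0 ≤ StaggeredDG.l2Norm Ω f₀ := ENNReal.toReal_nonneg
    have hz2 : ∀ β : ℝ, β ^ (-2 : ℤ) = (β ^ 2)⁻¹ := fun β => by rw [zpow_neg]; norm_cast
    have : √C * β₀ ^ (-2 : ℤ) ≤ (β₀ * m) ^ (-2 : ℤ) := by
      rw [hz2, hz2, mul_pow, mul_inv, mul_comm]
      gcongr
      rw [← one_div, le_div_iff₀ (by positivity)]
      exact hm2
    gcongr
  · rintro ⟨G, p, h⟩
    exact ⟨G, p + -r, h.of_load M hr' hload'⟩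
  · rintro ⟨G, p, h⟩
    exact ⟨G, p + r, h.of_load M hr hload⟩
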